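/- **Setting.** Let $\mathcal M$ be an $n$-dimensional Riemannian manifold of class $C^2$ (without boundary, with continuous metric) with induced distance $d$, let $S>0$, let $\mathfrak W$ be a metric space, and let $\mathcal W=L^1([0,S],\mathfrak W)$ be the set of strongly measurable maps $w:[0,S]\to\mathfrak W$ with $\int_0^S d_{\mathfrak W}(w(s),\mathfrak w_0)\,ds<\infty$ for some $\mathfrak w_0\in\mathfrak W$. For $(s,\mathfrak w)\in[0,S]\times\mathfrak W$ let $y\mapsto f(s,y,\mathfrak w)\in T_y\mathcal M$ be a vector field on $\mathcal M$ such that: (i) it is of class $C^1$; (ii) there is $c\in L^1([0,S];\mathbb R)$ such that, for a.e. $s$, $|f(s,y,\mathfrak w)|\le c(s)$ for all $(y,\mathfrak w)$, and such that every point of $\mathcal M$ has a chart and, in it, a neighbourhood $U$ and a constant $K$ with $|D_yf(s,y,\mathfrak w)|\le K\,c(s)$ in coordinates for a.e. $s$ and all $(y,\mathfrak w)\in U\times\mathfrak W$; (iii) $s\mapsto f(s,y,\mathfrak w)$ is measurable for all $(y,\mathfrak w)$; (iv) $(y,\mathfrak w)\mapsto f(s,y,\mathfrak w)$ is continuous for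 all $s$. Fix $\bar y\in\mathcal M$. For $w\in\mathcal W$ let $y[w]$ be the absolutely continuous solution on $[0,S]$ of $\dot y=f(s,y,w(s))$, $y(0)=\bar y$, and let $d_f(w_1,w_2)=\max_{s\in[0,S]}d(y[w_1](s),y[w_2](s))$. Let $\mathcal V\subset\mathcal W$ and let $\mathfrak T\subset\mathcal M$ be closed. **Abundance.** Let $\Gamma_N=\{\gamma\in[0,\infty)^N:\sum_i\gamma^i\le1\}$ and let $y_\gamma[w,w_1,\dots,w_N]$ be the solution on $[0,S]$ of $\dot y=f(s,y,w)+\sum_i\gamma^i\big(f(s,y,w_i)-f(s,y,w)\big)$, $y(0)=\bar y$. The family $\mathcal V$ is *abundant* in $\mathcal W$ if for every $N\ge1$, all $w,w_1,\dots,w_N\in\mathcal W$ and every $\delta>0$ there is a map $\theta:\Gamma_N\to\mathcal V$, continuous for the pseudo-distance $d_f$ on $\mathcal V$, such that $$d\big(y_\gamma[w,w_1,\dots,w_N](s),\,y[\theta(\gamma)](s)\big)<\delta\qquad\text{for all }s\in[0,S],\ \gamma\in\Gamma_N$$ (the solutions involved being supposed to exist on all of $[0,S]$). **Scorza-Dragoni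 points.** For a compact $X\subset\mathcal M$ and a time-dependent vector field $\varphi$, a time $\bar s\in[0,S]$ belongs to $\mathrm{SD}_X\{\varphi\}$ if, for all $y\in X$, $\lim_{r\to0^+}\limsup_{\delta\to0}\frac1\delta\int_{\bar s}^{\bar s+\delta}\Lambda_r(s,y)\,ds=0$, where $\Lambda_r(s,y)=\sup\{|\varphi(s,x)-\varphi(\bar s,y)|: x\in X,\ d(x,y)\le r\}$ in a chart around $y$, and $\delta\ne0$ has either sign, with $\bar s+\delta\in[0,S]$. **QDQ approximating cones.** A modulus is a nondecreasing $\rho:[0,\infty)\to[0,\infty)$ with $\lim_{s\to0^+}\rho(s)=\rho(0)=0$. A compact set $\Lambda$ of linear maps $\mathbb R^k\to\mathbb R^n$ is a *Quasi Differential Quotient* (QDQ) of $F:\mathbb R^k\rightsquigarrow\mathbb R^n$ at $(0,0)$ in the direction of $\Gamma\subset\mathbb R^k$ if there is a modulus $\rho$ such that for every $\delta>0$ there is a continuous map $(L_\delta,h_\delta)$ on $\Gamma\cap\{|\gamma|\le\delta\}$ with $\min_{L'\in\Lambda}|L_\delta(\gamma)-L'|\le\rho(\delta)$, $|h_\delta(\gamma)|\le\delta\rho(\delta)$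 and $L_\delta(\gamma)\cdot\gamma+h_\delta(\gamma)\in F(\gamma)$ there. A set $C\subset T_z\mathcal M$ is a *QDQ approximating cone* to $\mathcal E\subset\mathcal M$ at $z\in\mathcal E$ if there are $k\ge0$, a set-valued map $F:\mathbb R^k\rightsquigarrow\mathcal M$, a convex cone $\Gamma\subset\mathbb R^k$ and a linear map $L:\mathbb R^k\to T_z\mathcal M$ such that $F(\Gamma)\subset\mathcal E$, $C=L\cdot\Gamma$, and, in a chart centred at $z$, $\{L\}$ is a QDQ of $F$ at $(0,0)$ in the direction of $\Gamma$. **Theorem.** Assume that $\mathcal V$ is abundant in $\mathcal W$ and let $(\hat y,\hat w)$ be a feasible extended process, i.e. $\hat w\in\mathcal W$, $\hat y=y[\hat w]$ and $\hat y(S)\in\mathfrak T$. Let $X\subset\mathcal M$ be a compact set whose interior contains $\hat y([0,S])$. Let $N\ge1$, let $\mathfrak w_1,\dots,\mathfrak w_N\in\mathfrak W$, and let $0<s_1<\dots<s_N\le S$ be such that each $s_i$ belongs to $\mathrm{SD}_X\{f(\cdot,\cdot,\hat w(\cdot))\}\cap\bigcap_{j=1}^N\mathrm{SD}_X\{f(\cdot,\cdot,\mathfrak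 w_j)\}$. Let $M(S,s)$ be the differential at $\hat y(s)$ of the flow of $\dot y=f(\sigma,y,\hat w(\sigma))$ from time $s$ to time $S$. Then, for every $r>0$, the extended variational cone $$\mathbf C=\mathrm{span}^+\big\{M(S,s_i)\cdot\big(f(s_i,\hat y(s_i),\mathfrak w_i)-f(s_i,\hat y(s_i),\hat w(s_i))\big):\ i=1,\dots,N\big\}\subset T_{\hat y(S)}\mathcal M$$ (the smallest convex cone, with vertex $0$ included, that contains these vectors) is a QDQ approximating cone at $\hat y(S)$ to $\mathcal R^{\hat w,r}_{\mathcal V}\cup\{\hat y(S)\}$, where $\mathcal R^{\hat w,r}_{\mathcal V}=\{y[v](S): v\in\mathcal V,\ d_f(\hat w,v)<r\}$. -/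

import Mathlib

open Set Filter Topology MeasureTheory Bundle Manifold
open scoped NNReal ENNReal

noncomputable section

namespace QDQGap

/-! ### Quasi Differential Quotients in Euclidean spaces -/

/-- A modulus: a nondecreasing `ρ : [0,∞) → [0,∞)` with `ρ 0 = 0` and `ρ s → 0` as `s → 0⁺`. -/
def IsModulus (ρ : ℝ≥0 → ℝ≥0) : Prop :=
  Monotone ρ ∧ ρ 0 = 0 ∧ Tendsto ρ (𝓝[>] 0) (𝓝 0)

/-- The compact set of linear maps `Λ` is a Quasi Differential Quotient of the set-valued map `F`
at `(γ₀, y₀)` in the direction of `Γ`. The domain `γ₀ + (B_δ ∩ Γ)` is written as an image. -/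
def IsQDQ {E₁ E₂ : Type*} [NormedAddCommGroup E₁] [NormedSpace ℝ E₁]
    [NormedAddCommGroup E₂] [NormedSpace ℝ E₂]
    (F : E₁ → Set E₂) (γ₀ : E₁) (y₀ : E₂) (Λ : Set (E₁ →L[ℝ] E₂)) (Γ : Set E₁) : Prop :=
  IsCompact Λ ∧ ∃ ρ : ℝ≥0 → ℝ≥0, IsModulus ρ ∧
    ∀ δ : ℝ≥0, 0 < δ → ∃ (L : E₁ → E₁ →L[ℝ] E₂) (h : E₁ → E₂),
      ContinuousOn (fun γ => (L γ, h γ))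
        ((fun v => γ₀ + v) '' (Metric.closedBall 0 (δ : ℝ) ∩ Γ)) ∧
      ∀ γ ∈ (fun v => γ₀ + v) '' (Metric.closedBall 0 (δ : ℝ) ∩ Γ),
        (∃ L' ∈ Λ, ‖L γ - L'‖ ≤ ρ δ) ∧ ‖h γ‖ ≤ δ * ρ δ ∧
        y₀ + L γ (γ - γ₀) + h γ ∈ F γ

section Manifold

variable {n : ℕ} {M : Type*} [EMetricSpace M] [ChartedSpace (EuclideanSpace ℝ (Fin n)) M]
  [IsManifold (𝓡 n) 2 M]

/-- The coordinates, in the chart centred at `p`, of a tangent vector `v` at `x`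
(meaningful when `x` lies in the domain of that chart). -/
def coordVec (p x : M) (v : TangentSpace (𝓡 n) x) : EuclideanSpace ℝ (Fin n) :=
  tangentCoordChange (𝓡 n) x p x v

/-! ### Quasi Differential Quotients and approximating cones on manifolds -/

/-- The set-valued map `ψ ∘ F`, where `ψ` is the chart at `z`, translated so that `ψ z = 0`. -/
def inChart {E₁ : Type*} (F : E₁ → Set M) (z : M) (γ : E₁) : Set (EuclideanSpace ℝ (Fin n)) :=
  (fun x => extChartAt (𝓡 n) z x - extChartAt (𝓡 n) z z) ''
    (F γ ∩ (extChartAt (𝓡 n) z).source)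

/-- `C ⊆ T_z M` is a QDQ approximating cone to `A` at `z`. The tangent space at `z` is identified
with `ℝⁿ` through the differential at `z` of the chart centred at `z`. -/
def IsQDQApproxCone (A : Set M) (z : M) (C : Set (TangentSpace (𝓡 n) z)) : Prop :=
  z ∈ A ∧
  ∃ (k : ℕ) (F : EuclideanSpace ℝ (Fin k) → Set M)
    (Γ : PointedCone ℝ (EuclideanSpace ℝ (Fin k)))
    (L : EuclideanSpace ℝ (Fin k) →L[ℝ] TangentSpace (𝓡 n) z),
    IsQDQ (E₂ := EuclideanSpace ℝ (Fin n)) (inChart F z) 0 0 {L} (Γ : Set _) ∧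
    (∀ γ ∈ Γ, F γ ⊆ A) ∧
    C = L '' (Γ : Set _)

/-! ### Trajectories of time-dependent vector fields -/

/-- `y` is, on `[a,b]`, an (absolutely continuous) solution of `y' = g(s, y)`, `y a = x₀`:
it is continuous and, in every chart and on every subinterval that `y` maps into the domain of
that chart, it is an integral of `s ↦ g(s, y s)`. -/
def IsTrajectory (g : ℝ → (x : M) → TangentSpace (𝓡 n) x) (a b : ℝ) (x₀ : M) (y : ℝ → M) :
    Prop :=
  y a = x₀ ∧ ContinuousOn y (Icc a b) ∧
  ∀ (p : M) (c d : ℝ), a ≤ c → c ≤ d → d ≤ b →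
    (∀ s ∈ Icc c d, y s ∈ (extChartAt (𝓡 n) p).source) →
    IntervalIntegrable (fun s => coordVec p (y s) (g s (y s))) volume c d ∧
    extChartAt (𝓡 n) p (y d) - extChartAt (𝓡 n) p (y c) =
      ∫ s in c..d, coordVec p (y s) (g s (y s))

open Classical in
/-- The flow of `g` from time `a` to time `b`: the value at `b` of the solution that starts from
`x` at time `a` (and `x` itself if there is no solution on `[a,b]`). -/
def flowMap (g : ℝ → (x : M) → TangentSpace (𝓡 n) x) (a b : ℝ) (x : M) : M :=
  if h : ∃ y : ℝ → M, IsTrajectory g a b x y then h.choose b else x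

/-- The differential at `x` of the flow of `g` from time `a` to time `b`. -/
def flowDiff (g : ℝ → (x : M) → TangentSpace (𝓡 n) x) (a b : ℝ) (x : M) :
    TangentSpace (𝓡 n) x →L[ℝ] TangentSpace (𝓡 n) (flowMap g a b x) :=
  mfderiv (𝓡 n) (𝓡 n) (flowMap g a b) x

/-! ### Scorza-Dragoni points -/

/-- The local oscillation `Λ_r(s, y) = sup { |φ(s,x) - φ(t,y)| : x ∈ X, d(x,y) ≤ r }`, the values
being compared in the chart centred at `y`. -/
def sdOsc (X : Set M) (φ : ℝ → (x : M) → TangentSpace (𝓡 n) x) (t : ℝ) (y : M) (r : ℝ) (s : ℝ) :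
    ℝ≥0∞ :=
  ⨆ (x : M) (_ : x ∈ X) (_ : edist x y ≤ ENNReal.ofReal r),
    ‖coordVec y x (φ s x) - coordVec y y (φ t y)‖ₑ

/-- `t` is a Scorza-Dragoni point of `φ` on `[a,b] × X`: for all `y ∈ X`,
`lim_{r → 0} limsup_{δ → 0} (1/δ) ∫_t^{t+δ} Λ_r(s,y) ds = 0`, where `δ ≠ 0` may have either sign
and `t + δ` stays in `[a,b]`. -/
def IsScorzaDragoniPt (a b : ℝ) (X : Set M) (φ : ℝ → (x : M) → TangentSpace (𝓡 n) x) (t : ℝ) :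
    Prop :=
  t ∈ Icc a b ∧ ∀ y ∈ X,
    Tendsto
      (fun r : ℝ => limsup
        (fun δ : ℝ => (∫⁻ s in uIoc t (t + δ), sdOsc X φ t y r s) / ENNReal.ofReal |δ|)
        (𝓝[{δ : ℝ | δ ≠ 0 ∧ t + δ ∈ Icc a b}] 0))
      (𝓝[>] 0) (𝓝 0)

/-! ### The control system -/

/-- The extended family of controls `L¹([0,S], 𝔚)`; values outside `[0,S]` are irrelevant. -/
def IsControl {𝔚 : Type*} [MetricSpace 𝔚] (S : ℝ) (w : ℝ → 𝔚) : Prop :=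
  AEStronglyMeasurable w (volume.restrict (Icc 0 S)) ∧
  ∃ 𝔲 : 𝔚, ∫⁻ s in Icc 0 S, edist (w s) 𝔲 < ∞

/-- The standing hypothesis on the dynamics. The bound on the derivative of `y ↦ f(s,y,𝔲)` is
expressed in charts, with a constant that may depend on the chart and on the neighbourhood. -/
structure StandingHyp [RiemannianBundle (fun x : M => TangentSpace (𝓡 n) x)]
    {𝔚 : Type*} [MetricSpace 𝔚] (S : ℝ)
    (f : ℝ → (x : M) → 𝔚 → TangentSpace (𝓡 n) x) : Prop where
  contMDiff : ∀ s ∈ Icc 0 S, ∀ 𝔲 : 𝔚,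
    ContMDiff (𝓡 n) (𝓡 n).tangent 1 (fun x => (⟨x, f s x 𝔲⟩ : TangentBundle (𝓡 n) M))
  bound : ∃ c : ℝ → ℝ, IntegrableOn c (Icc 0 S) ∧
    (∀ᵐ s ∂(volume.restrict (Icc 0 S)), ∀ (x : M) (𝔲 : 𝔚), ‖f s x 𝔲‖ ≤ c s) ∧
    ∀ p : M, ∃ U ∈ 𝓝 p, U ⊆ (extChartAt (𝓡 n) p).source ∧ ∃ K : ℝ,
      ∀ᵐ s ∂(volume.restrict (Icc 0 S)), ∀ x ∈ U, ∀ 𝔲 : 𝔚,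
        ‖fderiv ℝ (fun u : EuclideanSpace ℝ (Fin n) =>
            coordVec p ((extChartAt (𝓡 n) p).symm u) (f s ((extChartAt (𝓡 n) p).symm u) 𝔲))
          (extChartAt (𝓡 n) p x)‖ ≤ K * c s
  measurable : ∀ (x : M) (𝔲 : 𝔚),
    AEStronglyMeasurable (fun s => f s x 𝔲) (volume.restrict (Icc 0 S))
  continuous : ∀ s ∈ Icc 0 S,
    Continuous fun q : M × 𝔚 => (⟨q.1, f s q.1 q.2⟩ : TangentBundle (𝓡 n) M)

/-- The vector field `f(s, x, w(s))` obtained from a control `w`. -/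
def ctrlField {𝔚 : Type*} (f : ℝ → (x : M) → 𝔚 → TangentSpace (𝓡 n) x) (w : ℝ → 𝔚) :
    ℝ → (x : M) → TangentSpace (𝓡 n) x :=
  fun s x => f s x (w s)

/-- The vector field `f_γ = f(s,x,w) + ∑ᵢ γⁱ (f(s,x,wᵢ) - f(s,x,w))`. -/
def relaxedField {𝔚 : Type*} (f : ℝ → (x : M) → 𝔚 → TangentSpace (𝓡 n) x) {N : ℕ}
    (γ : Fin N → ℝ) (w : ℝ → 𝔚) (w' : Fin N → ℝ → 𝔚) : ℝ → (x : M) → TangentSpace (𝓡 n) x :=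
  fun s x => f s x (w s) + ∑ i, γ i • (f s x (w' i s) - f s x (w s))

/-- `d_f(w₁, w₂) < r`: the trajectories of `w₁` and `w₂` that start from `x₀` exist on `[0,S]` and
their uniform distance is less than `r`. -/
def CtrlDistLT {𝔚 : Type*} (f : ℝ → (x : M) → 𝔚 → TangentSpace (𝓡 n) x) (S : ℝ) (x₀ : M)
    (w₁ w₂ : ℝ → 𝔚) (r : ℝ) : Prop :=
  ∃ y₁ y₂ : ℝ → M, IsTrajectory (ctrlField f w₁) 0 S x₀ y₁ ∧
    IsTrajectory (ctrlField f w₂) 0 S x₀ y₂ ∧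
    ∀ s ∈ Icc 0 S, edist (y₁ s) (y₂ s) < ENNReal.ofReal r

/-- The local reachable set: end-points of the trajectories of controls `v ∈ V` with
`d_f(ŵ, v) < r`. -/
def localReach {𝔚 : Type*} (f : ℝ → (x : M) → 𝔚 → TangentSpace (𝓡 n) x) (S : ℝ) (x₀ : M)
    (V : Set (ℝ → 𝔚)) (wh : ℝ → 𝔚) (r : ℝ) : Set M :=
  {z | ∃ v ∈ V, CtrlDistLT f S x₀ wh v r ∧
    ∃ y : ℝ → M, IsTrajectory (ctrlField f v) 0 S x₀ y ∧ y S = z}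

/-- `Γ_N`, the convex hull of the origin and of the canonical basis. -/
def simplexHull (N : ℕ) : Set (Fin N → ℝ) := {γ | (∀ i, 0 ≤ γ i) ∧ ∑ i, γ i ≤ 1}

/-- `V` is abundant in `L¹([0,S], 𝔚)`: the trajectories of all the systems `f_γ`, `γ ∈ Γ_N`, are
uniformly approached by trajectories of controls `θ(γ) ∈ V`, where `θ` is continuous for the
pseudo-distance `d_f`. -/
def IsAbundant {𝔚 : Type*} [MetricSpace 𝔚] (f : ℝ → (x : M) → 𝔚 → TangentSpace (𝓡 n) x)
    (S : ℝ) (x₀ : M) (V : Set (ℝ → 𝔚)) : Prop :=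
  ∀ (N : ℕ), 0 < N → ∀ (w : ℝ → 𝔚) (w' : Fin N → ℝ → 𝔚),
    IsControl S w → (∀ i, IsControl S (w' i)) → ∀ δ : ℝ, 0 < δ →
    ∃ θ : (Fin N → ℝ) → ℝ → 𝔚,
      (∀ γ ∈ simplexHull N, θ γ ∈ V) ∧
      (∀ γ₀ ∈ simplexHull N, ∀ ε : ℝ, 0 < ε → ∃ η : ℝ, 0 < η ∧
        ∀ γ ∈ simplexHull N, dist γ γ₀ < η → CtrlDistLT f S x₀ (θ γ) (θ γ₀) ε) ∧
      ∀ γ ∈ simplexHull N, ∃ y z : ℝ → M,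
        IsTrajectory (relaxedField f γ w w') 0 S x₀ y ∧
        IsTrajectory (ctrlField f (θ γ)) 0 S x₀ z ∧
        ∀ s ∈ Icc 0 S, edist (y s) (z s) < ENNReal.ofReal δ

/-- A feasible extended process `(y, w)` for the target `T`. -/
def IsFeasibleProcess {𝔚 : Type*} [MetricSpace 𝔚]
    (f : ℝ → (x : M) → 𝔚 → TangentSpace (𝓡 n) x) (S : ℝ) (x₀ : M) (T : Set M)
    (y : ℝ → M) (w : ℝ → 𝔚) : Prop :=
  IsControl S w ∧ IsTrajectory (ctrlField f w) 0 S x₀ y ∧ y S ∈ T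

/-- The extended variational cone: the smallest convex cone of `T_{ŷ(S)} M` that contains the
vectors `M(S,sᵢ) (f(sᵢ,ŷ(sᵢ),𝔲ᵢ) - f(sᵢ,ŷ(sᵢ),ŵ(sᵢ)))`, where `M(S,sᵢ)` is the differential at
`ŷ(sᵢ)` of the flow of `f(·,·,ŵ(·))` from time `sᵢ` to time `S`. -/
def extVarCone {𝔚 : Type*} (f : ℝ → (x : M) → 𝔚 → TangentSpace (𝓡 n) x) (S : ℝ)
    (yh : ℝ → M) (wh : ℝ → 𝔚) {N : ℕ} (𝔲 : Fin N → 𝔚) (t : Fin N → ℝ) :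
    PointedCone ℝ (TangentSpace (𝓡 n) (yh S)) :=
  PointedCone.hull ℝ (range fun i : Fin N =>
    (flowDiff (ctrlField f wh) (t i) S (yh (t i))
      (f (t i) (yh (t i)) (𝔲 i) - f (t i) (yh (t i)) (wh (t i))) :
      TangentSpace (𝓡 n) (yh S)))

end Manifold

end QDQGap

end

noncomputable section

namespace QDQGap

/-! ### Carathéodory differential equations in a Banach space -/

/-! The cone is generated by first-order effects of needle variations. Let `τ = N δ` and, for `γ` in
the orthant with `|γ| ≤ δ`, let the relaxed system carry the constant `𝔲 i` with coefficient `γ i /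
τ` on `(t i - τ, t i]` and the reference control elsewhere. The windows have a common width and only
the intensities vary, so the coefficients fill a part of `Γ_N`, which is where abundance applies.

A single needle moves the state at `t i` by `γ i • (f(𝔲 i) - f(ŵ))`, up to `o(τ)`. No Gronwall
estimate is needed: the perturbed and unperturbed displacements over the window are integrals of `f`
along curves close to `ŷ (t i)`, and the Scorza-Dragoni property replaces each integrand by its
frozen value (`IsScorzaDragoniPt.norm_integral_le`, `IsLocalModel.needle_displacement`). The
reference flow transports the displacement to time `S`. Since the base point is an already perturbed
one, the flow must be strictly differentiable at `ŷ (t i)`; the contributions of successive needles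
then add up (`needle_step`, `needle_expansion`).

Strict differentiability is proved on short time intervals inside a chart, where the field is
extended to a global Carathéodory field and trajectories are solutions of `y - P y = x`, with `P` a
Picard operator of Lipschitz constant `1/2`. The superposition operator is strictly differentiable
by dominated convergence, and the solution map is an inverse of `id - P`. Composition along the
interval gives the whole flow (`IsTrajectory.flowsNear`).

The expansion is uniform in `γ` because it is proved along arbitrary filters
(`exists_needle_expansion_bound`). Finally abundance, used with a tolerance chosen after `δ`,
replaces relaxed trajectories by trajectories of controls in `V`, with end-points continuous in `γ`
and a further error `O(ε δ)`. Such maps for every small `δ` are what a QDQ with value `{L}` demands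
(`isQDQ_singleton_of_forall`). -/

theorem aestronglyMeasurable_comp_of_continuous {α Z F : Type*} [MeasurableSpace α]
    {μ : Measure α} [TopologicalSpace Z] [TopologicalSpace F]
    [TopologicalSpace.PseudoMetrizableSpace F] {h : α → Z → F} {ζ : α → Z}
    (hζ : AEStronglyMeasurable ζ μ) (hm : ∀ z, AEStronglyMeasurable (fun a => h a z) μ)
    (hc : ∀ᵐ a ∂μ, Continuous (h a)) : AEStronglyMeasurable (fun a => h a (ζ a)) μ := by
  -- For a simple `φ` the space is a finite union of measurable fibres on which `φ` is constant. The
  -- general case follows by simple approximation and continuity of `h a`.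
  have key : ∀ φ : SimpleFunc α Z, AEStronglyMeasurable (fun a => h a (φ a)) μ := by
    intro φ
    have hU : (⋃ z : φ.range, φ ⁻¹' {(z : Z)}) = univ := by
      refine eq_univ_of_forall fun a => mem_iUnion.2 ⟨⟨φ a, φ.mem_range_self a⟩, rfl⟩
    rw [← Measure.restrict_univ (μ := μ), ← hU, aestronglyMeasurable_iUnion_iff]
    intro z
    refine ((hm z).mono_measure Measure.restrict_le_self).congr ?_
    filter_upwards [ae_restrict_mem (φ.measurableSet_fiber z)] with a ha
    rw [show φ a = z from ha]
  obtain ⟨ζ', hζ', hae⟩ := hζ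
  refine AEStronglyMeasurable.congr (f := fun a => h a (ζ' a)) ?_
    (hae.mono fun a ha => by simp only [ha])
  refine aestronglyMeasurable_of_tendsto_ae atTop (fun n => key (hζ'.approx n)) ?_
  filter_upwards [hc] with a ha
  exact (ha.tendsto _).comp (hζ'.tendsto_approx a)

/-- A time-dependent vector field that is measurable in time, bounded by `k` and Lipschitz with
constant `k`, where `k` is integrable. -/
structure IsCaratheodory {E : Type*} [NormedAddCommGroup E] (g : ℝ → E → E) (k : ℝ → ℝ)
    (a b : ℝ) : Prop where
  meas : ∀ u, AEStronglyMeasurable (fun s => g s u) (volume.restrict (Icc a b))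
  int : IntegrableOn k (Icc a b)
  bound : ∀ᵐ s ∂(volume.restrict (Icc a b)), ∀ u, ‖g s u‖ ≤ k s
  lip : ∀ᵐ s ∂(volume.restrict (Icc a b)), ∀ u v, ‖g s u - g s v‖ ≤ k s * ‖u - v‖

section Banach

variable {E : Type*} [NormedAddCommGroup E] {g : ℝ → E → E} {k : ℝ → ℝ} {a b : ℝ}

theorem IsCaratheodory.mono (hg : IsCaratheodory g k a b) {c d : ℝ} (hac : a ≤ c) (hdb : d ≤ b) :
    IsCaratheodory g k c d where
  meas u := (hg.meas u).mono_measure (Measure.restrict_mono (Icc_subset_Icc hac hdb) le_rfl)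
  int := hg.int.mono_set (Icc_subset_Icc hac hdb)
  bound := ae_mono (Measure.restrict_mono (Icc_subset_Icc hac hdb) le_rfl) hg.bound
  lip := ae_mono (Measure.restrict_mono (Icc_subset_Icc hac hdb) le_rfl) hg.lip

theorem IsCaratheodory.nonneg (hg : IsCaratheodory g k a b) :
    ∀ᵐ s ∂(volume.restrict (Icc a b)), 0 ≤ k s := by
  filter_upwards [hg.bound] with s hs
  exact (norm_nonneg _).trans (hs 0)

theorem IsCaratheodory.aestronglyMeasurable_comp (hg : IsCaratheodory g k a b) {y : ℝ → E}
    (hy : AEStronglyMeasurable y (volume.restrict (Icc a b))) :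
    AEStronglyMeasurable (fun s => g s (y s)) (volume.restrict (Icc a b)) := by
  refine aestronglyMeasurable_comp_of_continuous hy hg.meas ?_
  filter_upwards [hg.lip] with s hs
  refine (LipschitzWith.of_dist_le_mul (K := (k s).toNNReal) fun u v => ?_).continuous
  rw [dist_eq_norm, dist_eq_norm]
  exact (hs u v).trans (mul_le_mul_of_nonneg_right (Real.le_coe_toNNReal _) (norm_nonneg _))

theorem IsCaratheodory.integrableOn_comp (hg : IsCaratheodory g k a b) {y : ℝ → E}
    (hy : AEStronglyMeasurable y (volume.restrict (Icc a b))) :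
    IntegrableOn (fun s => g s (y s)) (Icc a b) :=
  hg.int.mono' (hg.aestronglyMeasurable_comp hy) (hg.bound.mono fun _ hs => hs _)

theorem intervalIntegrable_of_integrableOn_Icc {F : Type*} [NormedAddCommGroup F] {φ : ℝ → F}
    (h : IntegrableOn φ (Icc a b)) {c d : ℝ} (hc : c ∈ Icc a b) (hd : d ∈ Icc a b) :
    IntervalIntegrable φ volume c d :=
  (h.mono_set (ordConnected_Icc.uIcc_subset hc hd)).intervalIntegrable

theorem norm_intervalIntegral_le_of_ae_restrict {F : Type*} [NormedAddCommGroup F]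
    [NormedSpace ℝ F] {φ : ℝ → F} {m : ℝ → ℝ} (hm : IntegrableOn m (Icc a b))
    (h : ∀ᵐ s ∂(volume.restrict (Icc a b)), ‖φ s‖ ≤ m s) {c d : ℝ} (hac : a ≤ c) (hcd : c ≤ d)
    (hdb : d ≤ b) : ‖∫ s in c..d, φ s‖ ≤ ∫ s in c..d, m s := by
  refine intervalIntegral.norm_integral_le_of_norm_le hcd ?_
    (intervalIntegrable_of_integrableOn_Icc hm ⟨hac, hcd.trans hdb⟩ ⟨hac.trans hcd, hdb⟩)
  rw [ae_restrict_iff' measurableSet_Icc] at h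
  filter_upwards [h] with s hs hs'
  exact hs ⟨hac.trans hs'.1.le, hs'.2.trans hdb⟩

theorem intervalIntegral_mono_of_ae_nonneg {m : ℝ → ℝ} (hm : IntegrableOn m (Icc a b))
    (h0 : ∀ᵐ s ∂(volume.restrict (Icc a b)), 0 ≤ m s) {c d : ℝ} (hac : a ≤ c) (hcd : c ≤ d)
    (hdb : d ≤ b) : ∫ s in c..d, m s ≤ ∫ s in a..b, m s := by
  have hab : a ≤ b := (hac.trans hcd).trans hdb
  rw [intervalIntegral.integral_of_le hcd, intervalIntegral.integral_of_le hab]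
  refine setIntegral_mono_set (hm.mono_set Ioc_subset_Icc_self) ?_
    (Ioc_subset_Ioc hac hdb).eventuallyLE
  exact ae_mono (Measure.restrict_mono Ioc_subset_Icc_self le_rfl) h0

variable [NormedSpace ℝ E]

theorem continuousOn_primitive_from {φ : ℝ → E} (h : IntegrableOn φ (Icc a b)) (hab : a ≤ b) :
    ContinuousOn (fun s => ∫ σ in a..s, φ σ) (Icc a b) := by
  have := intervalIntegral.continuousOn_primitive_interval (μ := volume) (f := φ) (a := a) (b := b)
    (by rwa [uIcc_of_le hab])
  rwa [uIcc_of_le hab] at this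

theorem aestronglyMeasurable_continuousMap_projIcc (hab : a ≤ b) (y : C(Icc a b, E)) :
    AEStronglyMeasurable (fun s => y (projIcc a b hab s)) (volume.restrict (Icc a b)) :=
  (y.continuous.comp continuous_projIcc).aestronglyMeasurable

/-- The Picard operator. -/
theorem IsCaratheodory.exists_picard (hg : IsCaratheodory g k a b) (hab : a ≤ b) :
    ∃ P : C(Icc a b, E) → C(Icc a b, E), ∀ y (s : Icc a b),
      P y s = ∫ σ in a..s, g σ (y (projIcc a b hab σ)) := by
  have h : ∀ y : C(Icc a b, E), ∃ v : C(Icc a b, E), ∀ s : Icc a b,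
      v s = ∫ σ in a..s, g σ (y (projIcc a b hab σ)) := fun y =>
    ⟨⟨_, (continuousOn_primitive_from (hg.integrableOn_comp
      (aestronglyMeasurable_continuousMap_projIcc hab y)) hab).domRestrict⟩, fun s => rfl⟩
  choose P hP using h
  exact ⟨P, hP⟩

/-- The constant `1/2` is the bound on `∫ k`. Working on short intervals gives a contraction for the
usual supremum norm, with no weighted norm. -/
theorem IsCaratheodory.picard_lipschitz (hg : IsCaratheodory g k a b) (hab : a ≤ b)
    (hk : ∫ s in a..b, k s ≤ 1 / 2)
    {P : C(Icc a b, E) → C(Icc a b, E)} (hP : ∀ y (s : Icc a b),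
      P y s = ∫ σ in a..s, g σ (y (projIcc a b hab σ))) (y₁ y₂ : C(Icc a b, E)) :
    ‖P y₁ - P y₂‖ ≤ 1 / 2 * ‖y₁ - y₂‖ := by
  rw [ContinuousMap.norm_le _ (by positivity)]
  intro s
  have ha : a ∈ Icc a b := left_mem_Icc.2 hab
  have hi := fun y : C(Icc a b, E) => intervalIntegrable_of_integrableOn_Icc (hg.integrableOn_comp
      (aestronglyMeasurable_continuousMap_projIcc hab y)) ha s.2
  rw [ContinuousMap.sub_apply, hP, hP, ← intervalIntegral.integral_sub (hi y₁) (hi y₂)]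
  have h1 : ‖∫ σ in a..s, (g σ (y₁ (projIcc a b hab σ)) - g σ (y₂ (projIcc a b hab σ)))‖
      ≤ ∫ σ in a..s, k σ * ‖y₁ - y₂‖ := by
    refine norm_intervalIntegral_le_of_ae_restrict (a := a) (b := b)
      (hg.int.mul_const _) ?_ le_rfl s.2.1 s.2.2
    filter_upwards [hg.lip, hg.nonneg] with σ hσ h0
    refine (hσ _ _).trans (mul_le_mul_of_nonneg_left ?_ h0)
    exact (y₁ - y₂).norm_coe_le_norm _
  refine h1.trans ?_
  rw [intervalIntegral.integral_mul_const]
  refine mul_le_mul_of_nonneg_right (le_trans ?_ hk) (norm_nonneg _)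
  exact intervalIntegral_mono_of_ae_nonneg hg.int hg.nonneg le_rfl s.2.1 s.2.2

/-- The remainder of the superposition operator, divided by the distance of the two curves, tends to
zero at almost every time and is dominated by `2 k`. Dominated convergence then makes its integral
small, and that integral bounds the remainder of `P` uniformly in time. -/
theorem IsCaratheodory.picard_strictDeriv (hg : IsCaratheodory g k a b) (hab : a ≤ b)
    (hk : ∫ s in a..b, k s ≤ 1 / 2)
    {P : C(Icc a b, E) → C(Icc a b, E)} (hP : ∀ y (s : Icc a b),
      P y s = ∫ σ in a..s, g σ (y (projIcc a b hab σ))) (y : C(Icc a b, E)) (D : ℝ → E →L[ℝ] E)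
    (hD : ∀ᵐ σ ∂(volume.restrict (Icc a b)),
      HasStrictFDerivAt (g σ) (D σ) (y (projIcc a b hab σ))) :
    ∃ P' : C(Icc a b, E) →L[ℝ] C(Icc a b, E), ‖P'‖ ≤ 1 / 2 ∧ HasStrictFDerivAt P P' y := by
  have ha : a ∈ Icc a b := left_mem_Icc.2 hab
  have hDk : ∀ᵐ σ ∂(volume.restrict (Icc a b)), ‖D σ‖ ≤ k σ := by
    filter_upwards [hD, hg.lip, hg.nonneg] with σ h1 h2 h3
    exact h1.hasFDerivAt.le_of_lip' h3 (Eventually.of_forall fun x => h2 _ _)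
  -- Nothing is assumed on the dependence of `D σ` on `σ`; its measurability is inherited from
  -- difference quotients of `g`.
  have hDe : ∀ e, AEStronglyMeasurable (fun σ => D σ e) (volume.restrict (Icc a b)) := by
    intro e
    refine aestronglyMeasurable_of_tendsto_ae atTop
      (f := fun (n : ℕ) σ => (n : ℝ) • (g σ (y (projIcc a b hab σ) + ((n : ℝ))⁻¹ • e) -
        g σ (y (projIcc a b hab σ)))) (fun n => ?_) ?_
    · exact ((hg.aestronglyMeasurable_comp
        ((aestronglyMeasurable_continuousMap_projIcc hab y).add_const _)).sub
        (hg.aestronglyMeasurable_comp (aestronglyMeasurable_continuousMap_projIcc hab y))).const_smul _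
    · filter_upwards [hD] with σ hσ
      refine hσ.hasFDerivAt.lim e ?_
      simpa using tendsto_natCast_atTop_atTop
  have hDv : ∀ v : C(Icc a b, E),
      IntegrableOn (fun σ => D σ (v (projIcc a b hab σ))) (Icc a b) := by
    intro v
    refine (hg.int.mul_const ‖v‖).mono' (aestronglyMeasurable_comp_of_continuous
      (h := fun σ e => D σ e)
      (aestronglyMeasurable_continuousMap_projIcc hab v) hDe
      (Eventually.of_forall fun σ => (D σ).continuous)) ?_
    filter_upwards [hDk, hg.nonneg] with σ h1 h2
    exact ((D σ).le_opNorm _).trans (mul_le_mul h1 (v.norm_coe_le_norm _) (norm_nonneg _) h2)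
  have hex : ∀ v : C(Icc a b, E), ∃ w : C(Icc a b, E), ∀ s : Icc a b,
      w s = ∫ σ in a..s, D σ (v (projIcc a b hab σ)) := fun v =>
    ⟨⟨_, (continuousOn_primitive_from (hDv v) hab).domRestrict⟩, fun s => rfl⟩
  choose Q hQ using hex
  have hii := fun (v : C(Icc a b, E)) (s : Icc a b) =>
    intervalIntegrable_of_integrableOn_Icc (hDv v) ha s.2
  let Q' : C(Icc a b, E) →ₗ[ℝ] C(Icc a b, E) :=
    { toFun := Q
      map_add' := fun v w => by
        ext s
        rw [ContinuousMap.add_apply, hQ, hQ, hQ, ← intervalIntegral.integral_add (hii v s) (hii w s)]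
        simp
      map_smul' := fun c v => by
        ext s
        rw [ContinuousMap.smul_apply, hQ, hQ, RingHom.id_apply,
          ← intervalIntegral.integral_smul]
        simp }
  have hQb : ∀ v, ‖Q' v‖ ≤ 1 / 2 * ‖v‖ := by
    intro v
    rw [ContinuousMap.norm_le _ (by positivity)]
    intro s
    have h1 : ‖∫ σ in a..s, D σ (v (projIcc a b hab σ))‖ ≤ ∫ σ in a..s, k σ * ‖v‖ := by
      refine norm_intervalIntegral_le_of_ae_restrict (a := a) (b := b)
        (hg.int.mul_const _) ?_ le_rfl s.2.1 s.2.2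
      filter_upwards [hDk, hg.nonneg] with σ h1 h2
      exact ((D σ).le_opNorm _).trans (mul_le_mul h1 (v.norm_coe_le_norm _) (norm_nonneg _) h2)
    rw [show Q' v s = Q v s from rfl, hQ]
    refine h1.trans ?_
    rw [intervalIntegral.integral_mul_const]
    refine mul_le_mul_of_nonneg_right (le_trans ?_ hk) (norm_nonneg _)
    exact intervalIntegral_mono_of_ae_nonneg hg.int hg.nonneg le_rfl s.2.1 s.2.2
  refine ⟨Q'.mkContinuous _ hQb, Q'.mkContinuous_norm_le (by norm_num) hQb, ?_⟩
  rw [hasStrictFDerivAt_iff_isLittleO]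
  set R : C(Icc a b, E) × C(Icc a b, E) → ℝ → E := fun p σ =>
    g σ (p.1 (projIcc a b hab σ)) - g σ (p.2 (projIcc a b hab σ)) -
      D σ ((p.1 - p.2) (projIcc a b hab σ)) with hR
  have hRi : ∀ p, IntegrableOn (R p) (Icc a b) := fun p =>
    ((hg.integrableOn_comp (aestronglyMeasurable_continuousMap_projIcc hab p.1)).sub
      (hg.integrableOn_comp (aestronglyMeasurable_continuousMap_projIcc hab p.2))).sub
      (hDv (p.1 - p.2))
  have hRb : ∀ᵐ σ ∂(volume.restrict (Icc a b)), ∀ p, ‖R p σ‖ ≤ 2 * k σ * ‖p.1 - p.2‖ := by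
    filter_upwards [hg.lip, hg.nonneg, hDk] with σ h1 h2 h3 p
    have e1 := (p.1 - p.2).norm_coe_le_norm (projIcc a b hab σ)
    have e2 := (h1 (p.1 (projIcc a b hab σ)) (p.2 (projIcc a b hab σ))).trans
      (mul_le_mul_of_nonneg_left e1 h2)
    have e3 := ((D σ).le_opNorm ((p.1 - p.2) (projIcc a b hab σ))).trans
      (mul_le_mul h3 e1 (norm_nonneg _) h2)
    refine (norm_sub_le _ _).trans ?_
    linarith
  have hlim : Tendsto (fun p : C(Icc a b, E) × C(Icc a b, E) =>
      ∫ σ in Icc a b, ‖R p σ‖ / ‖p.1 - p.2‖) (𝓝 (y, y)) (𝓝 (∫ σ in Icc a b, (0 : ℝ))) := by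
    refine tendsto_integral_filter_of_dominated_convergence (fun σ => 2 * k σ)
      (Eventually.of_forall fun p => ((hRi p).norm.div_const _).aestronglyMeasurable)
      (Eventually.of_forall fun p => ?_) (hg.int.const_mul 2) ?_
    · filter_upwards [hRb, hg.nonneg] with σ hσ h0
      rw [norm_div, norm_norm, norm_norm]
      exact div_le_of_le_mul₀ (norm_nonneg _) (by positivity) (hσ p)
    · filter_upwards [hD] with σ hσ
      have ho := hσ.isLittleO
      have ht : Tendsto (fun p : C(Icc a b, E) × C(Icc a b, E) =>
          (p.1 (projIcc a b hab σ), p.2 (projIcc a b hab σ))) (𝓝 (y, y))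
          (𝓝 (y (projIcc a b hab σ), y (projIcc a b hab σ))) := by
        have : Continuous (fun p : C(Icc a b, E) × C(Icc a b, E) =>
          (p.1 (projIcc a b hab σ), p.2 (projIcc a b hab σ))) :=
          ((continuous_eval_const _).comp continuous_fst).prodMk
            ((continuous_eval_const _).comp continuous_snd)
        exact this.tendsto (y, y)
      have ho' := ho.comp_tendsto ht
      have : (fun p => R p σ) =o[𝓝 (y, y)] fun p => p.1 - p.2 := by
        refine ho'.trans_isBigO (Asymptotics.IsBigO.of_bound 1 (Eventually.of_forall fun p => ?_))
        rw [one_mul]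
        exact (p.1 - p.2).norm_coe_le_norm (projIcc a b hab σ)
      exact this.norm_norm.tendsto_div_nhds_zero
  rw [integral_zero] at hlim
  rw [Asymptotics.isLittleO_iff]
  intro c hc
  filter_upwards [hlim.eventually (gt_mem_nhds hc)] with p hp
  have hle : ‖P p.1 - P p.2 - Q p.1 + Q p.2‖ ≤ ∫ σ in Icc a b, ‖R p σ‖ := by
    rw [ContinuousMap.norm_le _ (integral_nonneg fun _ => norm_nonneg _)]
    intro s
    have hi := fun y : C(Icc a b, E) => intervalIntegrable_of_integrableOn_Icc (hg.integrableOn_comp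
      (aestronglyMeasurable_continuousMap_projIcc hab y)) ha s.2
    have : (P p.1 - P p.2 - Q p.1 + Q p.2) s = ∫ σ in a..s, R p σ := by
      simp only [ContinuousMap.add_apply, ContinuousMap.sub_apply, hP, hQ, hR]
      simp only [map_sub]
      rw [intervalIntegral.integral_sub ((hi p.1).sub (hi p.2)) ((hii p.1 s).sub (hii p.2 s)),
        intervalIntegral.integral_sub (hi p.1) (hi p.2),
        intervalIntegral.integral_sub (hii p.1 s) (hii p.2 s)]
      abel
    rw [this]
    refine (intervalIntegral.norm_integral_le_integral_norm s.2.1).trans ?_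
    rw [intervalIntegral.integral_of_le s.2.1]
    exact setIntegral_mono_set (hRi p).norm (Eventually.of_forall fun _ => norm_nonneg _)
      (Ioc_subset_Icc_self.trans (Icc_subset_Icc le_rfl s.2.2)).eventuallyLE
  have heq : P p.1 - P p.2 - Q'.mkContinuous _ hQb (p.1 - p.2) = P p.1 - P p.2 - Q p.1 + Q p.2 := by
    rw [map_sub, LinearMap.mkContinuous_apply, LinearMap.mkContinuous_apply]
    change P p.1 - P p.2 - (Q p.1 - Q p.2) = _
    abel
  rw [heq]
  refine hle.trans ?_
  -- On the diagonal the quotient is `0` by the convention on division and carries no information,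
  -- but there the remainder vanishes.
  rcases eq_or_ne p.1 p.2 with h | h
  · have : R p = fun _ => 0 := by
      funext σ
      simp [hR, h]
    rw [this]
    simp [h]
  · have hpos : 0 < ‖p.1 - p.2‖ := norm_pos_iff.2 (sub_ne_zero.2 h)
    rw [integral_div, div_lt_iff₀ hpos] at hp
    exact hp.le

/-- A solution from `x` is a preimage of the constant curve `x` under `H = id - P`. As `P` is a
`1/2`-contraction, `H` is a homeomorphism, which gives existence, uniqueness and continuous
dependence at once; strict differentiability passes to `H.symm` through the invertible derivative
`id - P'`. -/
theorem IsCaratheodory.exists_solution [CompleteSpace E] (hg : IsCaratheodory g k a b)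
    (hab : a ≤ b) (hk : ∫ s in a..b, k s ≤ 1 / 2) :
    ∃ Sol : E → C(Icc a b, E), Continuous Sol ∧
      (∀ x (s : Icc a b), Sol x s = x + ∫ σ in a..s, g σ (Sol x (projIcc a b hab σ))) ∧
      (∀ x (y : C(Icc a b, E)),
        (∀ s : Icc a b, y s = x + ∫ σ in a..s, g σ (y (projIcc a b hab σ))) → y = Sol x) ∧
      ∀ x (D : ℝ → E →L[ℝ] E), (∀ᵐ σ ∂(volume.restrict (Icc a b)),
        HasStrictFDerivAt (g σ) (D σ) (Sol x (projIcc a b hab σ))) →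
        ∃ A : E →L[ℝ] E, HasStrictFDerivAt (fun x => Sol x ⟨b, right_mem_Icc.2 hab⟩) A x := by
  obtain ⟨P, hP⟩ := hg.exists_picard hab
  have hlip := hg.picard_lipschitz hab hk hP
  have happ : ApproximatesLinearOn (fun y => y - P y)
      ((ContinuousLinearEquiv.refl ℝ C(Icc a b, E) : C(Icc a b, E) →L[ℝ] C(Icc a b, E))) univ
      (1 / 2 : ℝ≥0) := by
    intro u _ v _
    have : u - P u - (v - P v) - (ContinuousLinearEquiv.refl ℝ C(Icc a b, E) :
        C(Icc a b, E) →L[ℝ] C(Icc a b, E)) (u - v) = -(P u - P v) := by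
      rw [ContinuousLinearEquiv.coe_coe, ContinuousLinearEquiv.refl_apply]
      abel
    rw [this, norm_neg]
    simpa using hlip u v
  -- The Lipschitz constant of the perturbation has to be below the inverse of the norm of the
  -- identity, which is `1` unless the space is trivial.
  have hc : Subsingleton C(Icc a b, E) ∨ (1 / 2 : ℝ≥0) <
      ‖((ContinuousLinearEquiv.refl ℝ C(Icc a b, E)).symm :
        C(Icc a b, E) →L[ℝ] C(Icc a b, E))‖₊⁻¹ := by
    rcases subsingleton_or_nontrivial C(Icc a b, E) with h | h
    · exact Or.inl h
    · right
      have : ‖((ContinuousLinearEquiv.refl ℝ C(Icc a b, E)).symm :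
        C(Icc a b, E) →L[ℝ] C(Icc a b, E))‖₊ = 1 := by
        have := ContinuousLinearMap.norm_id (𝕜 := ℝ) (E := C(Icc a b, E))
        ext
        exact this
      rw [this, inv_one, ← NNReal.coe_lt_coe]
      norm_num
  let H : C(Icc a b, E) ≃ₜ C(Icc a b, E) := happ.toHomeomorph _ hc
  have hH : ∀ y, H y = y - P y := fun y => rfl
  let cst : E →L[ℝ] C(Icc a b, E) :=
    LinearMap.mkContinuous
      { toFun := fun x => ContinuousMap.const _ x
        map_add' := fun _ _ => rfl
        map_smul' := fun _ _ => rfl } 1 (fun x => by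
          rw [ContinuousMap.norm_le _ (by positivity)]
          intro s
          rw [one_mul]
          exact le_rfl)
  have hcst : ∀ x s, cst x s = x := fun x s => rfl
  refine ⟨fun x => H.symm (cst x), H.symm.continuous.comp cst.continuous, ?_, ?_, ?_⟩
  · intro x s
    have h1 : H.symm (cst x) - P (H.symm (cst x)) = cst x := by
      rw [← hH, H.apply_symm_apply]
    have h2 := congrArg (fun v : C(Icc a b, E) => v s) h1
    simp only [ContinuousMap.sub_apply, hP, hcst] at h2
    exact sub_eq_iff_eq_add.1 h2
  · intro x y hy
    rw [eq_comm, H.symm_apply_eq, hH]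
    ext s
    rw [hcst, ContinuousMap.sub_apply, hP, hy s]
    simp
  · intro x D hD
    obtain ⟨P', hP'n, hP'⟩ := hg.picard_strictDeriv hab hk hP (H.symm (cst x)) D hD
    have hlt : ‖P'‖ < 1 := hP'n.trans_lt (by norm_num)
    -- The Neumann series inverts `1 - P'`, because `‖P'‖ ≤ 1/2`.
    let u : (C(Icc a b, E) →L[ℝ] C(Icc a b, E))ˣ := Units.oneSub P' hlt
    have hHd : HasStrictFDerivAt H
        (ContinuousLinearEquiv.ofUnit u : C(Icc a b, E) →L[ℝ] C(Icc a b, E))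
        (H.symm (cst x)) := by
      have := (hasStrictFDerivAt_id (𝕜 := ℝ) (H.symm (cst x))).sub hP'
      exact this
    have hsymm := HasStrictFDerivAt.of_local_left_inverse (g := H.symm) (a := cst x)
      H.symm.continuous.continuousAt hHd (Eventually.of_forall fun z => H.apply_symm_apply z)
    have h2 := ((ContinuousMap.evalCLM ℝ (⟨b, right_mem_Icc.2 hab⟩ : Icc a b)).hasStrictFDerivAt
      (x := H.symm (cst x))).comp x (hsymm.comp x (cst.hasStrictFDerivAt (x := x)))
    exact ⟨_, h2⟩

end Banach

/-- By the Lebesgue number property, a finite subdivision has each piece near a single `s`, so that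
`Q` holds on it; transitivity then concatenates the pieces. It serves for the chain rule, for
uniqueness of trajectories and for the flow. -/
theorem interval_induction {a b : ℝ} (hab : a ≤ b) {Q : ℝ → ℝ → Prop}
    (hloc : ∀ s ∈ Icc a b, ∃ ε > 0, ∀ c d, a ≤ c → c ≤ d → d ≤ b → |c - s| < ε → |d - s| < ε →
      Q c d)
    (htrans : ∀ c d e, a ≤ c → c ≤ d → d ≤ e → e ≤ b → Q c d → Q d e → Q c e) : Q a b := by
  choose! ε hε hQ using hloc
  obtain ⟨t, ht0, htm, ⟨m, hm⟩, hc⟩ := exists_monotone_Icc_subset_open_cover_Icc hab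
    (c := fun s : Icc a b => {σ : Icc a b | |(σ : ℝ) - s| < ε s})
    (fun s => isOpen_lt (by fun_prop) continuous_const)
    (fun s _ => mem_iUnion.2 ⟨s, by simpa using hε s s.2⟩)
  have hstep : ∀ n, Q (t n) (t (n + 1)) := by
    intro n
    obtain ⟨s, hs⟩ := hc n
    have hle := htm (Nat.le_succ n)
    exact hQ s s.2 _ _ (t n).2.1 hle (t (n + 1)).2.2 (hs (left_mem_Icc.2 hle))
      (hs (right_mem_Icc.2 hle))
  have hall : ∀ n, Q a (t n) := by
    intro n
    induction n with
    | zero =>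
      rw [ht0]
      have ha := left_mem_Icc.2 hab
      exact hQ a ha _ _ le_rfl le_rfl hab (by simpa using hε a ha) (by simpa using hε a ha)
    | succ n ih => exact htrans _ _ _ le_rfl (t n).2.1 (htm (Nat.le_succ n)) (t (n + 1)).2.2 ih
                     (hstep n)
  rw [← hm m le_rfl]
  exact hall m

section Banach

variable {E F : Type*} [NormedAddCommGroup E] [NormedSpace ℝ E] [NormedAddCommGroup F]
  [NormedSpace ℝ F]

/-- The chain rule for the composition of a `C¹` map with an absolutely continuous curve, in
integral form. -/
theorem integral_chain_rule [CompleteSpace E] [CompleteSpace F] {χ : E → F} {u v : ℝ → E} {D : ℝ → E →L[ℝ] F} {a b : ℝ} (hab : a ≤ b)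
    (hv : IntegrableOn v (Icc a b)) (hu : ContinuousOn u (Icc a b))
    (huv : ∀ c d, a ≤ c → c ≤ d → d ≤ b → u d - u c = ∫ s in c..d, v s)
    (hχ : ∀ s ∈ Icc a b, HasStrictFDerivAt χ (D s) (u s)) (hD : ContinuousOn D (Icc a b)) :
    IntegrableOn (fun s => D s (v s)) (Icc a b) ∧
      χ (u b) - χ (u a) = ∫ s in a..b, D s (v s) := by
  obtain ⟨C, hC⟩ := isCompact_Icc.exists_bound_of_continuousOn hD
  have hint : IntegrableOn (fun s => D s (v s)) (Icc a b) := by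
    refine (hv.norm.const_mul C).mono' (aestronglyMeasurable_comp_of_continuous
      (h := fun s e => D s e) hv.aestronglyMeasurable
      (fun e => (hD.clm_apply continuousOn_const).aestronglyMeasurable measurableSet_Icc)
      (Eventually.of_forall fun s => (D s).continuous)) ?_
    filter_upwards [ae_restrict_mem measurableSet_Icc] with s hs
    exact ((D s).le_opNorm _).trans (mul_le_mul_of_nonneg_right (hC s hs) (norm_nonneg _))
  refine ⟨hint, ?_⟩
  have key : ∀ ε > 0, ‖χ (u b) - χ (u a) - ∫ s in a..b, D s (v s)‖ ≤
      ε * ∫ s in a..b, ‖v s‖ := by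
    intro ε hε
    -- The error bound is additive under concatenation, so it suffices to prove it locally. One
    -- `ε/2` comes from strict differentiability of `χ`, the other from continuity of `D`; no almost
    -- everywhere derivative of `u` is needed.
    refine interval_induction (Q := fun c d => ‖χ (u d) - χ (u c) - ∫ s in c..d, D s (v s)‖ ≤
      ε * ∫ s in c..d, ‖v s‖) hab ?_ ?_
    · intro s hs
      have hε2 : 0 < ε / 2 := by positivity
      have h1 := (hasStrictFDerivAt_iff_isLittleO.1 (hχ s hs)).def hε2
      have h2 : ∀ᶠ p in 𝓝[Icc a b] s ×ˢ 𝓝[Icc a b] s,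
          ‖χ (u p.1) - χ (u p.2) - D s (u p.1 - u p.2)‖ ≤ ε / 2 * ‖u p.1 - u p.2‖ := by
        have ht : Tendsto (fun p : ℝ × ℝ => (u p.1, u p.2)) (𝓝[Icc a b] s ×ˢ 𝓝[Icc a b] s)
            (𝓝 (u s, u s)) := by
          rw [nhds_prod_eq]
          exact Tendsto.prodMap (hu s hs) (hu s hs)
        exact ht.eventually h1
      have h3 : ∀ᶠ σ in 𝓝[Icc a b] s, ‖D σ - D s‖ < ε / 2 := by
        have := (hD s hs).sub_const (D s)
        simp only [sub_self] at this
        have h := this.norm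
        rw [norm_zero] at h
        exact h.eventually (gt_mem_nhds hε2)
      obtain ⟨ε₁, hε₁, hp₁⟩ := Metric.mem_nhdsWithin_iff.1 h3
      obtain ⟨V, hV, hV'⟩ := mem_prod_same_iff.1 h2
      obtain ⟨ε₂, hε₂, hp₂⟩ := Metric.mem_nhdsWithin_iff.1 hV
      refine ⟨min ε₁ ε₂, lt_min hε₁ hε₂, fun c d hac hcd hdb hc hd => ?_⟩
      have hvi : IntervalIntegrable v volume c d :=
        intervalIntegrable_of_integrableOn_Icc hv ⟨hac, hcd.trans hdb⟩ ⟨hac.trans hcd, hdb⟩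
      have hDi : IntervalIntegrable (fun s => D s (v s)) volume c d :=
        intervalIntegrable_of_integrableOn_Icc hint ⟨hac, hcd.trans hdb⟩ ⟨hac.trans hcd, hdb⟩
      have e1 : ‖χ (u d) - χ (u c) - D s (u d - u c)‖ ≤ ε / 2 * ‖u d - u c‖ := by
        refine hV' (mk_mem_prod (hp₂ ⟨?_, hac.trans hcd, hdb⟩) (hp₂ ⟨?_, hac, hcd.trans hdb⟩))
        · exact (hd.trans_le (min_le_right _ _))
        · exact (hc.trans_le (min_le_right _ _))
      have e2 : ‖u d - u c‖ ≤ ∫ s in c..d, ‖v s‖ := by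
        rw [huv c d hac hcd hdb]
        exact intervalIntegral.norm_integral_le_integral_norm hcd
      have e3 : ‖(∫ σ in c..d, D σ (v σ)) - D s (u d - u c)‖ ≤ ε / 2 * ∫ s in c..d, ‖v s‖ := by
        have : D s (u d - u c) = ∫ σ in c..d, D s (v σ) := by
          rw [huv c d hac hcd hdb, ContinuousLinearMap.intervalIntegral_comp_comm _ hvi]
        rw [this, ← intervalIntegral.integral_sub hDi ⟨(D s).integrable_comp hvi.1, (D s).integrable_comp hvi.2⟩,
          ← intervalIntegral.integral_const_mul]
        refine intervalIntegral.norm_integral_le_of_norm_le hcd (Eventually.of_forall ?_)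
          (hvi.norm.const_mul _)
        intro σ hσ
        have hσ' : |σ - s| < ε₁ := by
          refine lt_of_le_of_lt (b := max |c - s| |d - s|) ?_
            ((max_lt hc hd).trans_le (min_le_left _ _))
          exact abs_le_max_abs_abs (by linarith [hσ.1]) (by linarith [hσ.2])
        have := hp₁ ⟨hσ', hac.trans hσ.1.le, hσ.2.trans hdb⟩
        rw [← sub_apply]
        exact ((D σ - D s).le_opNorm _).trans
          (mul_le_mul_of_nonneg_right (le_of_lt this) (norm_nonneg _))
      calc ‖χ (u d) - χ (u c) - ∫ s in c..d, D s (v s)‖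
          = ‖(χ (u d) - χ (u c) - D s (u d - u c)) -
              ((∫ σ in c..d, D σ (v σ)) - D s (u d - u c))‖ := by congr 1; abel
        _ ≤ ε / 2 * ‖u d - u c‖ + ε / 2 * ∫ s in c..d, ‖v s‖ :=
            (norm_sub_le _ _).trans (add_le_add e1 e3)
        _ ≤ ε / 2 * (∫ s in c..d, ‖v s‖) + ε / 2 * ∫ s in c..d, ‖v s‖ := by gcongr
        _ = ε * ∫ s in c..d, ‖v s‖ := by ring
    · intro c d e hac hcd hde heb h1 h2
      have mc : c ∈ Icc a b := ⟨hac, (hcd.trans hde).trans heb⟩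
      have md : d ∈ Icc a b := ⟨hac.trans hcd, hde.trans heb⟩
      have me : e ∈ Icc a b := ⟨(hac.trans hcd).trans hde, heb⟩
      rw [← intervalIntegral.integral_add_adjacent_intervals
          (intervalIntegrable_of_integrableOn_Icc hint mc md)
          (intervalIntegrable_of_integrableOn_Icc hint md me),
        ← intervalIntegral.integral_add_adjacent_intervals
          (intervalIntegrable_of_integrableOn_Icc hv.norm mc md)
          (intervalIntegrable_of_integrableOn_Icc hv.norm md me), mul_add]
      refine le_trans (le_of_eq ?_) ((norm_add_le _ _).trans (add_le_add h1 h2))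
      congr 1
      abel
  have hI : 0 ≤ ∫ s in a..b, ‖v s‖ := intervalIntegral.integral_nonneg hab fun _ _ => norm_nonneg _
  rw [← sub_eq_zero, ← norm_le_zero_iff]
  refine le_of_forall_pos_le_add fun η hη => ?_
  -- The added `1` keeps the denominator positive when `∫ ‖v‖ = 0`.
  have h := key (η / ((∫ s in a..b, ‖v s‖) + 1)) (by positivity)
  refine h.trans ?_
  rw [zero_add, div_mul_eq_mul_div, div_le_iff₀ (by positivity)]
  nlinarith

/-- The flow of a Carathéodory field on a short time interval. -/
theorem IsCaratheodory.exists_flow [CompleteSpace E] {g : ℝ → E → E} {k : ℝ → ℝ} {a b : ℝ}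
    (hg : IsCaratheodory g k a b) (hab : a ≤ b) (hk : ∫ s in a..b, k s ≤ 1 / 2) :
    ∃ Y : E → ℝ → E, (∀ x, ContinuousOn (Y x) (Icc a b)) ∧
      (∀ x, ∀ s ∈ Icc a b, Y x s = x + ∫ σ in a..s, g σ (Y x σ)) ∧
      (∀ x y, ContinuousOn y (Icc a b) → (∀ s ∈ Icc a b, y s = x + ∫ σ in a..s, g σ (y σ)) →
        EqOn y (Y x) (Icc a b)) ∧
      (∀ x, ∀ ε > 0, ∀ᶠ x' in 𝓝 x, ∀ s ∈ Icc a b, ‖Y x' s - Y x s‖ < ε) ∧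
      ∀ x (D : ℝ → E →L[ℝ] E), (∀ s ∈ Icc a b, HasStrictFDerivAt (g s) (D s) (Y x s)) →
        ∃ A : E →L[ℝ] E, HasStrictFDerivAt (fun x => Y x b) A x := by
  obtain ⟨Sol, hc, hs, hu, hd⟩ := hg.exists_solution hab hk
  refine ⟨fun x s => Sol x (projIcc a b hab s), fun x =>
    ((Sol x).continuous.comp continuous_projIcc).continuousOn, ?_, ?_, ?_, ?_⟩
  · intro x s hs'
    dsimp only
    rw [projIcc_of_mem hab hs', hs]
  · intro x y hy hy' s hs'
    have hyp : ∀ {σ}, σ ∈ Icc a b → (projIcc a b hab σ : ℝ) = σ := fun h => by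
      rw [projIcc_of_mem hab h]
    have := hu x ⟨_, hy.domRestrict⟩ (fun s => by
      change y s = _
      rw [hy' s s.2]
      congr 1
      refine intervalIntegral.integral_congr fun σ hσ => ?_
      rw [uIcc_of_le s.2.1] at hσ
      change g σ (y σ) = g σ (y (projIcc a b hab σ))
      rw [hyp ⟨hσ.1, hσ.2.trans s.2.2⟩])
    dsimp only
    rw [← this]
    change y s = y (projIcc a b hab s)
    rw [hyp hs']
  · intro x ε hε
    have := (Metric.tendsto_nhds.1 (hc.tendsto x)) ε hε
    filter_upwards [this] with x' hx' s _
    rw [← dist_eq_norm]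
    exact (ContinuousMap.dist_apply_le_dist _).trans_lt hx'
  · intro x D hD
    obtain ⟨A, hA⟩ := hd x D (by
      filter_upwards [ae_restrict_mem measurableSet_Icc] with s hs
      exact hD s hs)
    refine ⟨A, ?_⟩
    simp only [projIcc_right]
    exact hA

end Banach

/-- A Lipschitz map of a Hilbert space into a ball that fixes the points of the half ball. -/
theorem exists_lipschitz_localization {E : Type*} [NormedAddCommGroup E] [InnerProductSpace ℝ E]
    [FiniteDimensional ℝ E] (c : E) {R : ℝ} (hR : 0 < R) :
    ∃ (ϖ : E → E) (Λ : ℝ≥0), LipschitzWith Λ ϖ ∧ (∀ u ∈ Metric.closedBall c (R / 2), ϖ u = u) ∧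
      ∀ u, ϖ u ∈ Metric.closedBall c R := by
  let χ : ContDiffBump (0 : E) := ⟨R / 2, R, by positivity, by linarith⟩
  have hcs : HasCompactSupport fun v : E => χ v • v := χ.hasCompactSupport.smul_right
  have hcd : ContDiff ℝ 1 fun v : E => χ v • v := χ.contDiff.smul contDiff_id
  obtain ⟨Λ, hΛ⟩ := ContDiff.lipschitzWith_of_hasCompactSupport hcs hcd one_ne_zero
  refine ⟨fun u => c + χ (u - c) • (u - c), Λ, ?_, ?_, ?_⟩
  · refine LipschitzWith.of_dist_le_mul fun u v => ?_
    have := hΛ.dist_le_mul (u - c) (v - c)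
    simpa [dist_sub_right, dist_add_left] using this
  · intro u hu
    have : χ (u - c) = 1 := by
      refine χ.one_of_mem_closedBall ?_
      rw [mem_closedBall_zero_iff, ← dist_eq_norm]
      exact hu
    simp [this]
  · intro u
    rw [mem_closedBall_iff_norm, add_sub_cancel_left, norm_smul, Real.norm_of_nonneg χ.nonneg]
    by_cases h : ‖u - c‖ ≤ R
    · exact (mul_le_mul χ.le_one h (norm_nonneg _) zero_le_one).trans (one_mul R).le
    · rw [χ.zero_of_le_dist (by rw [dist_zero_right]; exact (not_le.1 h).le), zero_mul]
      exact hR.le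

/-! ### Vector fields in charts and local models. -/

section Manifold

variable {n : ℕ} {M : Type*} [EMetricSpace M] [ChartedSpace (EuclideanSpace ℝ (Fin n)) M]
  [IsManifold (𝓡 n) 2 M]

/-- Continuity of the Riemannian metric makes it locally comparable with the Euclidean norm of
coordinates. This turns the intrinsic bound `|f| ≤ c` into a bound in a chart. -/
theorem eventually_norm_coordVec_le [RiemannianBundle (fun x : M => TangentSpace (𝓡 n) x)]
    [IsContinuousRiemannianBundle (EuclideanSpace ℝ (Fin n)) (fun x : M => TangentSpace (𝓡 n) x)]
    (p : M) :
    ∃ C > 0, ∀ᶠ x in 𝓝 p, ∀ v : TangentSpace (𝓡 n) x, ‖coordVec p x v‖ ≤ C * ‖v‖ := by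
  obtain ⟨C, hC, h⟩ := eventually_norm_trivializationAt_lt (EuclideanSpace ℝ (Fin n))
    (fun x : M => TangentSpace (𝓡 n) x) p
  refine ⟨C, hC, ?_⟩
  filter_upwards [h, (trivializationAt (EuclideanSpace ℝ (Fin n)) (TangentSpace (𝓡 n))
    p).open_baseSet.mem_nhds (mem_baseSet_trivializationAt _ _ p)] with x hx hx2 v
  have := ((Trivialization.continuousLinearMapAt ℝ (trivializationAt (EuclideanSpace ℝ (Fin n))
    (TangentSpace (𝓡 n)) p) x).le_opNorm v).trans (mul_le_mul_of_nonneg_right hx.le (norm_nonneg _))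
  rw [Trivialization.continuousLinearMapAt_apply, Trivialization.coe_linearMapAt_of_mem _ hx2]
    at this
  exact this

theorem aestronglyMeasurable_coordVec (p : M) {x : M} {α : Type*} [MeasurableSpace α]
    {μ : Measure α} {v : α → TangentSpace (𝓡 n) x} (hv : AEStronglyMeasurable v μ) :
    AEStronglyMeasurable (fun s => coordVec p x (v s)) μ :=
  (tangentCoordChange (𝓡 n) x p x).continuous.comp_aestronglyMeasurable hv

theorem continuousOn_coordVec {𝔚 : Type*} [TopologicalSpace 𝔚]
    {f : (x : M) → 𝔚 → TangentSpace (𝓡 n) x} (p : M)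
    (h : Continuous fun q : M × 𝔚 => (⟨q.1, f q.1 q.2⟩ : TangentBundle (𝓡 n) M)) :
    ContinuousOn (fun q : M × 𝔚 => coordVec p q.1 (f q.1 q.2))
      ((extChartAt (𝓡 n) p).source ×ˢ univ) := by
  have h1 := (trivializationAt (EuclideanSpace ℝ (Fin n)) (TangentSpace (𝓡 n)) p).continuousOn
  exact continuous_snd.comp_continuousOn
    (h1.comp h.continuousOn (s := (extChartAt (𝓡 n) p).source ×ˢ univ) (fun q hq => by
      rw [Trivialization.mem_source]
      have := hq.1
      rw [extChartAt_source] at this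
      exact this))

theorem continuous_coordVec_comp {𝔚 α : Type*} [TopologicalSpace 𝔚] [TopologicalSpace α]
    {f : (x : M) → 𝔚 → TangentSpace (𝓡 n) x} (p : M)
    (h : Continuous fun q : M × 𝔚 => (⟨q.1, f q.1 q.2⟩ : TangentBundle (𝓡 n) M))
    {ξ : α → M} {𝔲 : α → 𝔚} (hξ : Continuous ξ) (h𝔲 : Continuous 𝔲)
    (hs : ∀ a, ξ a ∈ (extChartAt (𝓡 n) p).source) :
    Continuous fun a => coordVec p (ξ a) (f (ξ a) (𝔲 a)) :=
  (continuousOn_coordVec p h).comp_continuous (f := fun a => (ξ a, 𝔲 a)) (hξ.prodMk h𝔲)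
    (fun a => ⟨hs a, mem_univ _⟩)

theorem contDiffOn_coordVec {f : (x : M) → TangentSpace (𝓡 n) x} (p : M)
    (h : ContMDiff (𝓡 n) (𝓡 n).tangent 1 (fun x => (⟨x, f x⟩ : TangentBundle (𝓡 n) M))) :
    ContDiffOn ℝ 1 (fun u => coordVec p ((extChartAt (𝓡 n) p).symm u)
      (f ((extChartAt (𝓡 n) p).symm u))) (extChartAt (𝓡 n) p).target := by
  have h1 : ContMDiffOn (𝓡 n) 𝓘(ℝ, EuclideanSpace ℝ (Fin n)) 1 (fun x => coordVec p x (f x))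
      (extChartAt (𝓡 n) p).source := by
    intro x hx
    have := (Trivialization.contMDiffAt_iff (IB := 𝓡 n) (IM := 𝓡 n) (n := 1)
      (e := trivializationAt (EuclideanSpace ℝ (Fin n)) (TangentSpace (𝓡 n)) p)
      (f := fun x => (⟨x, f x⟩ : TangentBundle (𝓡 n) M)) (x₀ := x) (by
        rw [Trivialization.mem_source]
        rw [extChartAt_source] at hx
        exact hx)).1 (h x)
    exact this.2.contMDiffWithinAt
  rw [← contMDiffOn_iff_contDiffOn]
  exact h1.comp ((contMDiffOn_extChartAt_symm (n := 2) p).of_le (by norm_num))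
    (fun u hu => (extChartAt (𝓡 n) p).map_target hu)

/-- In the chart at `p` the dynamics `f` are represented on a closed ball by a globally defined
family `G` of vector fields that is bounded and Lipschitz. -/
structure IsLocalModel {𝔚 : Type*} [MetricSpace 𝔚] (S : ℝ)
    (f : ℝ → (x : M) → 𝔚 → TangentSpace (𝓡 n) x) (p : M) (R : ℝ) (k : ℝ → ℝ)
    (G : ℝ → EuclideanSpace ℝ (Fin n) → 𝔚 → EuclideanSpace ℝ (Fin n)) : Prop where
  pos : 0 < R
  subset_target : Metric.closedBall (extChartAt (𝓡 n) p p) R ⊆ (extChartAt (𝓡 n) p).target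
  eq : ∀ s, ∀ u ∈ Metric.closedBall (extChartAt (𝓡 n) p p) R, ∀ 𝔲, G s u 𝔲 =
    coordVec p ((extChartAt (𝓡 n) p).symm u) (f s ((extChartAt (𝓡 n) p).symm u) 𝔲)
  int : IntegrableOn k (Icc 0 S)
  meas : ∀ u 𝔲, AEStronglyMeasurable (fun s => G s u 𝔲) (volume.restrict (Icc 0 S))
  cont : ∀ s ∈ Icc 0 S, Continuous fun q : EuclideanSpace ℝ (Fin n) × 𝔚 => G s q.1 q.2
  bound : ∀ᵐ s ∂(volume.restrict (Icc 0 S)), ∀ u 𝔲, ‖G s u 𝔲‖ ≤ k s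
  lip : ∀ᵐ s ∂(volume.restrict (Icc 0 S)), ∀ u v 𝔲, ‖G s u 𝔲 - G s v 𝔲‖ ≤ k s * ‖u - v‖
  diff : ∀ s ∈ Icc 0 S, ∀ 𝔲, ∀ u ∈ Metric.ball (extChartAt (𝓡 n) p p) R,
    ∃ D : EuclideanSpace ℝ (Fin n) →L[ℝ] EuclideanSpace ℝ (Fin n),
      HasStrictFDerivAt (fun u => G s u 𝔲) D u

/-- The field read in the chart is precomposed with a Lipschitz map `ϖ` into a closed ball that is
the identity on the half ball. The extension inherits the bound on `f`; the derivative bound and the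
mean value inequality on the convex ball make it Lipschitz. -/
theorem StandingHyp.exists_localModel [RiemannianBundle (fun x : M => TangentSpace (𝓡 n) x)]
    [IsContinuousRiemannianBundle (EuclideanSpace ℝ (Fin n)) (fun x : M => TangentSpace (𝓡 n) x)]
    {𝔚 : Type*} [MetricSpace 𝔚] {S : ℝ} {f : ℝ → (x : M) → 𝔚 → TangentSpace (𝓡 n) x}
    (hf : StandingHyp S f) (p : M) : ∃ R k G, IsLocalModel S f p R k G := by
  obtain ⟨c, hcint, hcb, hcd⟩ := hf.bound
  obtain ⟨U, hU, -, K, hK⟩ := hcd p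
  obtain ⟨C, hC, hCe⟩ := eventually_norm_coordVec_le (n := n) p
  set ψ := extChartAt (𝓡 n) p
  have hN : ψ.target ∩ ψ.symm ⁻¹' (U ∩ {x | ∀ v : TangentSpace (𝓡 n) x,
      ‖coordVec p x v‖ ≤ C * ‖v‖}) ∈ 𝓝 (ψ p) := by
    refine inter_mem (extChartAt_target_mem_nhds p) ?_
    refine (continuousAt_extChartAt_symm p).preimage_mem_nhds ?_
    rw [extChartAt_to_inv]
    exact inter_mem hU hCe
  obtain ⟨R, hR, hRN⟩ := Metric.nhds_basis_closedBall.mem_iff.1 hN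
  obtain ⟨ϖ, Λ, hϖL, hϖe, hϖm⟩ := exists_lipschitz_localization (ψ p) hR
  have hϖs : ∀ u, ψ.symm (ϖ u) ∈ ψ.source := fun u => ψ.map_target (hRN (hϖm u)).1
  have hdiff : ∀ s ∈ Icc 0 S, ∀ 𝔲, ∀ u ∈ ψ.target,
      ContDiffAt ℝ 1 (fun u => coordVec p (ψ.symm u) (f s (ψ.symm u) 𝔲)) u := fun s hs 𝔲 u hu =>
    (contDiffOn_coordVec p (hf.contMDiff s hs 𝔲)).contDiffAt
      ((isOpen_extChartAt_target p).mem_nhds hu)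
  have hk : ∀ s, 0 ≤ (|K| * Λ) * |c s| := fun s => by positivity
  have hk' : ∀ s, 0 ≤ C * |c s| := fun s => by positivity
  -- The first summand of `k` bounds the field, the second is its Lipschitz constant. Absolute
  -- values are used because `K` is not assumed nonnegative, nor `c` outside a null set.
  refine ⟨R / 2, fun s => C * |c s| + (|K| * Λ) * |c s|,
    fun s u 𝔲 => coordVec p (ψ.symm (ϖ u)) (f s (ψ.symm (ϖ u)) 𝔲), by positivity,
    fun u hu => (hRN (Metric.closedBall_subset_closedBall (by linarith) hu)).1, ?_,
    (hcint.abs.const_mul _).add (hcint.abs.const_mul _), ?_, ?_, ?_, ?_, ?_⟩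
  · intro s u hu 𝔲
    rw [hϖe u hu]
  · intro u 𝔲
    exact aestronglyMeasurable_coordVec p (hf.measurable (ψ.symm (ϖ u)) 𝔲)
  · intro s hs
    have h2 : Continuous fun u => ψ.symm (ϖ u) :=
      (continuousOn_extChartAt_symm p).comp_continuous hϖL.continuous fun u => (hRN (hϖm u)).1
    exact continuous_coordVec_comp p (hf.continuous s hs) (h2.comp continuous_fst) continuous_snd
      (fun q => hϖs q.1)
  · filter_upwards [hcb] with s hs u 𝔲
    have h1 := (hRN (hϖm u)).2.2 (f s (ψ.symm (ϖ u)) 𝔲)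
    have h2 := mul_le_mul_of_nonneg_left ((hs (ψ.symm (ϖ u)) 𝔲).trans (le_abs_self _)) hC.le
    linarith [hk s]
  · filter_upwards [hK, ae_restrict_mem measurableSet_Icc] with s hs hsS u v 𝔲
    have h1 := Convex.norm_image_sub_le_of_norm_fderiv_le (𝕜 := ℝ) (C := |K| * |c s|)
      (f := fun u => coordVec p (ψ.symm u) (f s (ψ.symm u) 𝔲))
      (s := Metric.closedBall (ψ p) R)
      (fun u hu => (hdiff s hsS 𝔲 u (hRN hu).1).differentiableAt one_ne_zero)
      (fun u hu => by
        have := hs _ (hRN hu).2.1 𝔲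
        rw [ψ.right_inv (hRN hu).1] at this
        exact this.trans ((le_abs_self _).trans (abs_mul _ _).le))
      (convex_closedBall _ _) (hϖm v) (hϖm u)
    refine h1.trans ?_
    have h2 := hϖL.dist_le_mul u v
    rw [dist_eq_norm, dist_eq_norm] at h2
    calc |K| * |c s| * ‖ϖ u - ϖ v‖ ≤ |K| * |c s| * (Λ * ‖u - v‖) := by gcongr
      _ = |K| * Λ * |c s| * ‖u - v‖ := by ring
      _ ≤ _ := mul_le_mul_of_nonneg_right (by linarith [hk' s]) (norm_nonneg _)
  · intro s hs 𝔲 u hu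
    have hu' := (hRN (Metric.closedBall_subset_closedBall (by linarith)
      (Metric.ball_subset_closedBall hu))).1
    refine ⟨_, ((hdiff s hs 𝔲 u hu').hasStrictFDerivAt one_ne_zero).congr_of_eventuallyEq ?_⟩
    filter_upwards [Metric.isOpen_ball.mem_nhds hu] with v hv
    rw [hϖe v (Metric.ball_subset_closedBall hv)]

section LocalModel

variable {𝔚 : Type*} [MetricSpace 𝔚] {S : ℝ} {f : ℝ → (x : M) → 𝔚 → TangentSpace (𝓡 n) x} {p : M}
  {R : ℝ} {k : ℝ → ℝ} {G : ℝ → EuclideanSpace ℝ (Fin n) → 𝔚 → EuclideanSpace ℝ (Fin n)}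

theorem IsLocalModel.isCaratheodory (h : IsLocalModel S f p R k G) {w : ℝ → 𝔚}
    (hw : IsControl S w) : IsCaratheodory (fun s u => G s u (w s)) k 0 S where
  meas u := aestronglyMeasurable_comp_of_continuous (h := fun s 𝔲 => G s u 𝔲) hw.1
    (fun 𝔲 => h.meas u 𝔲) (by
      filter_upwards [ae_restrict_mem measurableSet_Icc] with s hs
      exact (h.cont s hs).comp (continuous_const.prodMk continuous_id))
  int := h.int
  bound := h.bound.mono fun s hs u => hs _ _
  lip := h.lip.mono fun s hs u v => hs _ _ _

theorem IsLocalModel.coordVec_eq (h : IsLocalModel S f p R k G) (s : ℝ) {x : M}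
    (hx : x ∈ (extChartAt (𝓡 n) p).source)
    (hxR : extChartAt (𝓡 n) p x ∈ Metric.closedBall (extChartAt (𝓡 n) p p) R) (𝔲 : 𝔚) :
    coordVec p x (f s x 𝔲) = G s (extChartAt (𝓡 n) p x) 𝔲 := by
  rw [h.eq s _ hxR, (extChartAt (𝓡 n) p).left_inv hx]

end LocalModel

end Manifold

/-! ### Trajectories on the manifold: restriction, gluing, change of chart. -/

section Trajectories

variable {n : ℕ} {M : Type*} [EMetricSpace M] [ChartedSpace (EuclideanSpace ℝ (Fin n)) M]
  [IsManifold (𝓡 n) 2 M] {g g' : ℝ → (x : M) → TangentSpace (𝓡 n) x} {a b c : ℝ} {x₀ : M}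
  {y z : ℝ → M}

theorem IsTrajectory.mono (h : IsTrajectory g a b x₀ y) {c d : ℝ} (hac : a ≤ c) (hdb : d ≤ b) :
    IsTrajectory g c d (y c) y :=
  ⟨rfl, h.2.1.mono (Icc_subset_Icc hac hdb), fun p c' d' h1 h2 h3 h4 =>
    h.2.2 p c' d' (hac.trans h1) h2 (h3.trans hdb) h4⟩

theorem IsTrajectory.mono_right (h : IsTrajectory g a b x₀ y) {d : ℝ} (hdb : d ≤ b) :
    IsTrajectory g a d x₀ y :=
  ⟨h.1, (h.mono le_rfl hdb).2⟩

theorem IsTrajectory.congr (h : IsTrajectory g a b x₀ y) (hab : a ≤ b)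
    (hyz : EqOn z y (Icc a b)) : IsTrajectory g a b x₀ z := by
  refine ⟨(hyz (left_mem_Icc.2 hab)).trans h.1, h.2.1.congr hyz, fun p c d hac hcd hdb hs => ?_⟩
  have hsub : ∀ s ∈ Icc c d, z s = y s := fun s hs =>
    hyz ⟨hac.trans hs.1, hs.2.trans hdb⟩
  have heq : EqOn (fun s => coordVec p (z s) (g s (z s))) (fun s => coordVec p (y s) (g s (y s)))
      (uIcc c d) := by
    intro s hs
    rw [uIcc_of_le hcd] at hs
    exact congrArg (fun x => coordVec p x (g s x)) (hsub s hs)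
  obtain ⟨h1, h2⟩ := h.2.2 p c d hac hcd hdb (fun s hs' => hsub s hs' ▸ hs s hs')
  rw [hsub d (right_mem_Icc.2 hcd), hsub c (left_mem_Icc.2 hcd),
    intervalIntegral.integral_congr heq]
  exact ⟨h1.congr (heq.symm.mono uIoc_subset_uIcc), h2⟩

/-- Agreement is asked only on the half-open interval. This matters since needles occupy intervals
`(t - τ, t]`: the left end of a piece without needles may belong to the preceding needle. -/
theorem IsTrajectory.congr_field (h : IsTrajectory g a b x₀ y)
    (hg : ∀ s ∈ Ioc a b, g' s (y s) = g s (y s)) : IsTrajectory g' a b x₀ y := by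
  refine ⟨h.1, h.2.1, fun p c d hac hcd hdb hs => ?_⟩
  have heq : ∀ s ∈ uIoc c d, coordVec p (y s) (g' s (y s)) = coordVec p (y s) (g s (y s)) := by
    intro s hs
    rw [uIoc_of_le hcd] at hs
    rw [hg s ⟨hac.trans_lt hs.1, hs.2.trans hdb⟩]
  obtain ⟨h1, h2⟩ := h.2.2 p c d hac hcd hdb hs
  rw [intervalIntegral.integral_congr_ae (Eventually.of_forall heq)]
  exact ⟨h1.congr fun s hs => (heq s hs).symm, h2⟩

theorem IsTrajectory.glue_same (hab : a ≤ b) (hbc : b ≤ c) (h₁ : IsTrajectory g a b x₀ y)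
    (h₂ : IsTrajectory g b c (y b) y) : IsTrajectory g a c x₀ y := by
  refine ⟨h₁.1, ?_, fun p c' d hac hcd hdb hs => ?_⟩
  · rw [← Icc_union_Icc_eq_Icc hab hbc]
    exact h₁.2.1.union_of_isClosed h₂.2.1 isClosed_Icc isClosed_Icc
  · rcases le_total d b with hd | hd
    · exact h₁.2.2 p c' d hac hcd hd hs
    rcases le_total b c' with hc | hc
    · exact h₂.2.2 p c' d hc hcd hdb hs
    obtain ⟨i1, e1⟩ := h₁.2.2 p c' b hac hc le_rfl fun s h => hs s ⟨h.1, h.2.trans hd⟩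
    obtain ⟨i2, e2⟩ := h₂.2.2 p b d le_rfl hd hdb fun s h => hs s ⟨hc.trans h.1, h.2⟩
    refine ⟨i1.trans i2, ?_⟩
    rw [← intervalIntegral.integral_add_adjacent_intervals i1 i2, ← e1, ← e2]
    abel

theorem IsTrajectory.glue (hab : a ≤ b) (hbc : b ≤ c) (h₁ : IsTrajectory g a b x₀ y)
    (h₂ : IsTrajectory g b c (y b) z) :
    ∃ v, IsTrajectory g a c x₀ v ∧ EqOn v y (Icc a b) ∧ EqOn v z (Icc b c) := by
  set v : ℝ → M := fun s => if s ≤ b then y s else z s with hv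
  have e1 : EqOn v y (Icc a b) := fun s hs => if_pos hs.2
  have e2 : EqOn v z (Icc b c) := by
    intro s hs
    rcases eq_or_lt_of_le hs.1 with h | h
    · subst h
      simp [hv, h₂.1]
    · exact if_neg (not_le.2 h)
  refine ⟨v, IsTrajectory.glue_same hab hbc (h₁.congr hab e1) ?_, e1, e2⟩
  rw [e1 (right_mem_Icc.2 hab)]
  exact h₂.congr hbc e2

/-- Transition maps of a `C²` manifold are `C¹`, and a `C¹` map is strictly differentiable. -/
theorem hasStrictFDerivAt_chart_transition (p q : M) {x : M}
    (hp : x ∈ (extChartAt (𝓡 n) p).source) (hq : x ∈ (extChartAt (𝓡 n) q).source) :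
    HasStrictFDerivAt (extChartAt (𝓡 n) q ∘ (extChartAt (𝓡 n) p).symm)
      (tangentCoordChange (𝓡 n) p q x) (extChartAt (𝓡 n) p x) := by
  have hs : extChartAt (𝓡 n) p x ∈
      ((extChartAt (𝓡 n) p).symm ≫ extChartAt (𝓡 n) q).source := by
    rw [PartialEquiv.trans_source, PartialEquiv.symm_source]
    refine ⟨(extChartAt (𝓡 n) p).map_source hp, ?_⟩
    rw [mem_preimage, (extChartAt (𝓡 n) p).left_inv hp]
    exact hq
  have h1 : ContDiffAt ℝ 1 (extChartAt (𝓡 n) q ∘ (extChartAt (𝓡 n) p).symm)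
      (extChartAt (𝓡 n) p x) := by
    have := contDiffWithinAt_ext_coord_change (n := 1) (I := 𝓡 n) q p hs
    rw [← contDiffWithinAt_univ]
    simpa using this
  have h2 := hasFDerivWithinAt_tangentCoordChange (I := 𝓡 n) (x := p) (y := q) (z := x) ⟨hp, hq⟩
  have h3 : HasFDerivAt (extChartAt (𝓡 n) q ∘ (extChartAt (𝓡 n) p).symm)
      (tangentCoordChange (𝓡 n) p q x) (extChartAt (𝓡 n) p x) := by
    simpa using h2
  exact h1.hasStrictFDerivAt' h3 one_ne_zero

/-- An integral curve of the field read in a single chart is a trajectory. -/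
theorem IsTrajectory.of_chart (p : M) (hya : y a = x₀)
    (hy : ContinuousOn y (Icc a b)) (hsrc : ∀ s ∈ Icc a b, y s ∈ (extChartAt (𝓡 n) p).source)
    (hint : IntegrableOn (fun s => coordVec p (y s) (g s (y s))) (Icc a b))
    (heq : ∀ c d, a ≤ c → c ≤ d → d ≤ b → extChartAt (𝓡 n) p (y d) - extChartAt (𝓡 n) p (y c) =
      ∫ s in c..d, coordVec p (y s) (g s (y s))) : IsTrajectory g a b x₀ y := by
  refine ⟨hya, hy, fun q c d hac hcd hdb hq => ?_⟩
  have hp : ∀ s ∈ Icc c d, y s ∈ (extChartAt (𝓡 n) p).source := fun s hs =>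
    hsrc s ⟨hac.trans hs.1, hs.2.trans hdb⟩
  have hyc : ContinuousOn y (Icc c d) := hy.mono (Icc_subset_Icc hac hdb)
  obtain ⟨h1, h2⟩ := integral_chain_rule (u := fun s => extChartAt (𝓡 n) p (y s))
    (v := fun s => coordVec p (y s) (g s (y s)))
    (χ := extChartAt (𝓡 n) q ∘ (extChartAt (𝓡 n) p).symm)
    (D := fun s => tangentCoordChange (𝓡 n) p q (y s)) hcd
    (hint.mono_set (Icc_subset_Icc hac hdb))
    ((continuousOn_extChartAt p).comp hyc hp)
    (fun c' d' h1 h2 h3 => heq c' d' (hac.trans h1) h2 (h3.trans hdb))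
    (fun s hs => hasStrictFDerivAt_chart_transition p q (hp s hs) (hq s hs))
    ((continuousOn_tangentCoordChange p q).comp hyc fun s hs => ⟨hp s hs, hq s hs⟩)
  have h3 : ∀ s ∈ Icc c d, tangentCoordChange (𝓡 n) p q (y s) (coordVec p (y s) (g s (y s))) =
      coordVec q (y s) (g s (y s)) := fun s hs =>
    tangentCoordChange_comp ⟨⟨mem_extChartAt_source (y s), hp s hs⟩, hq s hs⟩
  simp only [Function.comp_apply, (extChartAt (𝓡 n) p).left_inv (hp d (right_mem_Icc.2 hcd)),
    (extChartAt (𝓡 n) p).left_inv (hp c (left_mem_Icc.2 hcd))] at h2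
  refine ⟨?_, ?_⟩
  · refine IntervalIntegrable.congr (f := fun s => tangentCoordChange (𝓡 n) p q (y s)
      (coordVec p (y s) (g s (y s)))) (fun s hs => h3 s ?_) ?_
    · rw [uIoc_of_le hcd] at hs
      exact Ioc_subset_Icc_self hs
    · rw [intervalIntegrable_iff_integrableOn_Icc_of_le hcd]
      exact h1
  · rw [h2]
    refine intervalIntegral.integral_congr fun s hs => h3 s ?_
    rwa [uIcc_of_le hcd] at hs

end Trajectories

/-- Continuity of the primitive of `k`. It supplies both the intervals on which the Picard operator
contracts and those on which a needle trajectory cannot leave a chart ball. -/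
theorem exists_integral_le {k : ℝ → ℝ} {a b : ℝ} (hk : IntegrableOn k (Icc a b)) {η : ℝ}
    (hη : 0 < η) {s : ℝ} (hs : s ∈ Icc a b) : ∃ ε > 0, ∀ c d, a ≤ c → c ≤ d → d ≤ b →
      |c - s| < ε → |d - s| < ε → ∫ σ in c..d, k σ ≤ η := by
  have hab : a ≤ b := hs.1.trans hs.2
  have hF := continuousOn_primitive_from hk hab s hs
  obtain ⟨ε, hε, h⟩ := Metric.continuousWithinAt_iff.1 hF (η / 2) (by positivity)
  refine ⟨ε, hε, fun c d hac hcd hdb hc hd => ?_⟩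
  have mc : c ∈ Icc a b := ⟨hac, hcd.trans hdb⟩
  have md : d ∈ Icc a b := ⟨hac.trans hcd, hdb⟩
  have ma : a ∈ Icc a b := left_mem_Icc.2 hab
  have h1 := h mc hc
  have h2 := h md hd
  rw [← intervalIntegral.integral_interval_sub_left
    (intervalIntegrable_of_integrableOn_Icc hk ma md)
    (intervalIntegrable_of_integrableOn_Icc hk ma mc)]
  rw [Real.dist_eq, abs_lt] at h1 h2
  linarith [h1.1, h1.2, h2.1, h2.2]

/-! ### Uniqueness, continuous dependence and strict differentiability of the flow. -/

section Flows

variable {n : ℕ} {M : Type*} [EMetricSpace M] [ChartedSpace (EuclideanSpace ℝ (Fin n)) M]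
  [IsManifold (𝓡 n) 2 M] {𝔚 : Type*} [MetricSpace 𝔚] {S : ℝ}
  {f : ℝ → (x : M) → 𝔚 → TangentSpace (𝓡 n) x} {p : M}
  {R : ℝ} {k : ℝ → ℝ} {G : ℝ → EuclideanSpace ℝ (Fin n) → 𝔚 → EuclideanSpace ℝ (Fin n)}
  {w : ℝ → 𝔚} {a b : ℝ} {x₀ : M} {y z : ℝ → M}

theorem IsLocalModel.integral_curve (h : IsLocalModel S f p R k G)
    (hy : IsTrajectory (ctrlField f w) a b x₀ y)
    (hsrc : ∀ s ∈ Icc a b, y s ∈ (extChartAt (𝓡 n) p).source)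
    (hball : ∀ s ∈ Icc a b, extChartAt (𝓡 n) p (y s) ∈
      Metric.closedBall (extChartAt (𝓡 n) p p) R) :
    ContinuousOn (fun s => extChartAt (𝓡 n) p (y s)) (Icc a b) ∧ ∀ s ∈ Icc a b,
      extChartAt (𝓡 n) p (y s) = extChartAt (𝓡 n) p (y a) +
        ∫ σ in a..s, G σ (extChartAt (𝓡 n) p (y σ)) (w σ) := by
  refine ⟨(continuousOn_extChartAt p).comp hy.2.1 hsrc, fun s hs => ?_⟩
  obtain ⟨-, h2⟩ := hy.2.2 p a s le_rfl hs.1 hs.2 fun σ hσ => hsrc σ ⟨hσ.1, hσ.2.trans hs.2⟩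
  rw [← sub_eq_iff_eq_add', h2]
  refine intervalIntegral.integral_congr fun σ hσ => ?_
  rw [uIcc_of_le hs.1] at hσ
  have hσ' : σ ∈ Icc a b := ⟨hσ.1, hσ.2.trans hs.2⟩
  exact h.coordVec_eq σ (hsrc σ hσ') (hball σ hσ') (w σ)

theorem IsLocalModel.trajectory (h : IsLocalModel S f p R k G) (hw : IsControl S w)
    (ha : 0 ≤ a) (hb : b ≤ S) {v : ℝ → EuclideanSpace ℝ (Fin n)} {u : EuclideanSpace ℝ (Fin n)}
    (hab : a ≤ b) (hv : ContinuousOn v (Icc a b))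
    (hball : ∀ s ∈ Icc a b, v s ∈ Metric.closedBall (extChartAt (𝓡 n) p p) R)
    (heq : ∀ s ∈ Icc a b, v s = u + ∫ σ in a..s, G σ (v σ) (w σ)) :
    IsTrajectory (ctrlField f w) a b ((extChartAt (𝓡 n) p).symm u)
      (fun s => (extChartAt (𝓡 n) p).symm (v s)) := by
  have htgt : ∀ s ∈ Icc a b, v s ∈ (extChartAt (𝓡 n) p).target := fun s hs =>
    h.subset_target (hball s hs)
  have hC := (h.isCaratheodory hw).mono ha hb
  have hint : IntegrableOn (fun s => G s (v s) (w s)) (Icc a b) :=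
    hC.integrableOn_comp (hv.aestronglyMeasurable measurableSet_Icc)
  have hfeq : ∀ s ∈ Icc a b, G s (v s) (w s) = coordVec p ((extChartAt (𝓡 n) p).symm (v s))
      (ctrlField f w s ((extChartAt (𝓡 n) p).symm (v s))) := fun s hs => h.eq s _ (hball s hs) _
  refine IsTrajectory.of_chart p ?_ ((continuousOn_extChartAt_symm p).comp hv htgt)
    (fun s hs => (extChartAt (𝓡 n) p).map_target (htgt s hs))
    (hint.congr_fun hfeq measurableSet_Icc) ?_
  · rw [heq a (left_mem_Icc.2 hab), intervalIntegral.integral_same, add_zero]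
  · intro c d hac hcd hdb
    have mc : c ∈ Icc a b := ⟨hac, hcd.trans hdb⟩
    have md : d ∈ Icc a b := ⟨hac.trans hcd, hdb⟩
    have ma : a ∈ Icc a b := left_mem_Icc.2 hab
    rw [(extChartAt (𝓡 n) p).right_inv (htgt c mc), (extChartAt (𝓡 n) p).right_inv (htgt d md),
      heq c mc, heq d md, add_sub_add_left_eq_sub, intervalIntegral.integral_interval_sub_left
        (intervalIntegrable_of_integrableOn_Icc hint ma md)
        (intervalIntegrable_of_integrableOn_Icc hint ma mc)]
    refine intervalIntegral.integral_congr fun σ hσ => ?_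
    rw [uIcc_of_le hcd] at hσ
    exact hfeq σ ⟨hac.trans hσ.1, hσ.2.trans hdb⟩

theorem eventually_mem_chart_ball (hy : ContinuousOn y (Icc a b)) {s : ℝ} (hs : s ∈ Icc a b)
    (hR : 0 < R) : ∃ ε > 0, ∀ σ ∈ Icc a b, |σ - s| < ε →
      y σ ∈ (extChartAt (𝓡 n) (y s)).source ∧
      extChartAt (𝓡 n) (y s) (y σ) ∈ Metric.ball (extChartAt (𝓡 n) (y s) (y s)) R := by
  have h1 : ∀ᶠ x in 𝓝 (y s), x ∈ (extChartAt (𝓡 n) (y s)).source ∧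
      extChartAt (𝓡 n) (y s) x ∈ Metric.ball (extChartAt (𝓡 n) (y s) (y s)) R :=
    Filter.Eventually.and (extChartAt_source_mem_nhds (I := 𝓡 n) (y s))
      ((continuousAt_extChartAt (I := 𝓡 n) (y s)).preimage_mem_nhds (Metric.ball_mem_nhds _ hR))
  obtain ⟨ε, hε, h⟩ := Metric.mem_nhdsWithin_iff.1 ((hy s hs).eventually h1)
  exact ⟨ε, hε, fun σ hσ hd => h ⟨hd, hσ⟩⟩

/-- The trajectories of a control are determined by their initial points. -/
theorem IsTrajectory.eqOn (hf : ∀ p, ∃ R k G, IsLocalModel S f p R k G) (hw : IsControl S w)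
    (ha : 0 ≤ a) (hab : a ≤ b) (hb : b ≤ S) (hy : IsTrajectory (ctrlField f w) a b x₀ y)
    (hz : IsTrajectory (ctrlField f w) a b x₀ z) : EqOn y z (Icc a b) := by
  refine interval_induction (Q := fun c d => y c = z c → EqOn y z (Icc c d)) hab ?_ ?_
    (hy.1.trans hz.1.symm)
  · intro s hs
    -- If the curves meet at `s`, uniqueness in the chart applies nearby. Otherwise they differ at
    -- all nearby times and the premise `y c = z c` is void.
    by_cases hyz : y s = z s
    · obtain ⟨R, k, G, hm⟩ := hf (y s)
      obtain ⟨ε₁, hε₁, h₁⟩ := eventually_mem_chart_ball (n := n) hy.2.1 hs hm.pos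
      obtain ⟨ε₂, hε₂, h₂⟩ := eventually_mem_chart_ball (n := n) hz.2.1 hs hm.pos
      rw [← hyz] at h₂
      obtain ⟨ε₃, hε₃, h₃⟩ := exists_integral_le (hm.int.mono_set (Icc_subset_Icc ha hb))
        (η := 1 / 2) (by norm_num) hs
      refine ⟨min ε₁ (min ε₂ ε₃), by positivity, fun c d hac hcd hdb hc hd heq => ?_⟩
      have hsub : ∀ σ ∈ Icc c d, σ ∈ Icc a b := fun σ hσ => ⟨hac.trans hσ.1, hσ.2.trans hdb⟩
      have habs : ∀ σ ∈ Icc c d, |σ - s| < min ε₁ (min ε₂ ε₃) := fun σ hσ =>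
        (abs_le_max_abs_abs (by linarith [hσ.1]) (by linarith [hσ.2])).trans_lt (max_lt hc hd)
      have hy' := fun σ hσ => h₁ σ (hsub σ hσ) ((habs σ hσ).trans_le (min_le_left _ _))
      have hz' := fun σ hσ => h₂ σ (hsub σ hσ)
        ((habs σ hσ).trans_le ((min_le_right _ _).trans (min_le_left _ _)))
      have hk := h₃ c d hac hcd hdb
        (hc.trans_le ((min_le_right _ _).trans (min_le_right _ _)))
        (hd.trans_le ((min_le_right _ _).trans (min_le_right _ _)))
      obtain ⟨Y, -, -, hY, -⟩ := ((hm.isCaratheodory hw).mono (ha.trans hac)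
        (hdb.trans hb)).exists_flow hcd hk
      obtain ⟨cy, ey⟩ := hm.integral_curve (hy.mono hac hdb) (fun σ hσ => (hy' σ hσ).1)
        (fun σ hσ => Metric.ball_subset_closedBall (hy' σ hσ).2)
      obtain ⟨cz, ez⟩ := hm.integral_curve (hz.mono hac hdb) (fun σ hσ => (hz' σ hσ).1)
        (fun σ hσ => Metric.ball_subset_closedBall (hz' σ hσ).2)
      rw [← heq] at ez
      intro σ hσ
      refine (extChartAt (𝓡 n) (y s)).injOn (hy' σ hσ).1 (hz' σ hσ).1 ?_
      exact (hY _ _ cy ey hσ).trans (hY _ _ cz ez hσ).symm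
    · have h1 : ∀ᶠ q : M × M in 𝓝 (y s, z s), q.1 ≠ q.2 :=
        (isOpen_ne_fun continuous_fst continuous_snd).mem_nhds hyz
      have h2 := ((hy.2.1 s hs).prodMk (hz.2.1 s hs)).eventually h1
      obtain ⟨ε, hε, h⟩ := Metric.mem_nhdsWithin_iff.1 h2
      refine ⟨ε, hε, fun c d hac hcd hdb hc hd heq => absurd heq ?_⟩
      exact h (a := c) ⟨hc, hac, hcd.trans hdb⟩
  · intro c d e hac hcd hde heb h1 h2 h
    have h3 := h1 h
    rw [← Icc_union_Icc_eq_Icc hcd hde]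
    exact h3.union (h2 (h3 (right_mem_Icc.2 hcd)))

/-- Uniqueness makes the arbitrary choice in `flowMap` harmless. -/
theorem IsTrajectory.flowMap_eq (hf : ∀ p, ∃ R k G, IsLocalModel S f p R k G)
    (hw : IsControl S w) (ha : 0 ≤ a) (hab : a ≤ b) (hb : b ≤ S)
    (hy : IsTrajectory (ctrlField f w) a b x₀ y) : flowMap (ctrlField f w) a b x₀ = y b := by
  have hex : ∃ y, IsTrajectory (ctrlField f w) a b x₀ y := ⟨y, hy⟩
  rw [flowMap, dif_pos hex]
  exact hex.choose_spec.eqOn hf hw ha hab hb hy (right_mem_Icc.2 hab)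

/-- Near the point `y a` the flow from time `a` to time `b` is defined, is uniformly close to the
trajectory `y`, and is strictly differentiable at `y a`. -/
structure FlowsNear (g : ℝ → (x : M) → TangentSpace (𝓡 n) x) (y : ℝ → M) (a b : ℝ) : Prop where
  near : ∀ ε : ℝ≥0∞, 0 < ε → ∀ᶠ x in 𝓝 (y a), ∃ z, IsTrajectory g a b x z ∧
    ∀ s ∈ Icc a b, edist (z s) (y s) < ε
  diff : ∃ A : EuclideanSpace ℝ (Fin n) →L[ℝ] EuclideanSpace ℝ (Fin n),
    HasStrictFDerivAt (fun u => extChartAt (𝓡 n) (y b)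
      (flowMap g a b ((extChartAt (𝓡 n) (y a)).symm u))) A (extChartAt (𝓡 n) (y a) (y a))

theorem FlowsNear.eventually_flowMap (hf : ∀ p, ∃ R k G, IsLocalModel S f p R k G)
    (hw : IsControl S w) (ha : 0 ≤ a) (hab : a ≤ b) (hb : b ≤ S)
    (h : FlowsNear (ctrlField f w) y a b) {N : Set M} (hN : N ∈ 𝓝 (y b)) :
    ∀ᶠ x in 𝓝 (y a), flowMap (ctrlField f w) a b x ∈ N := by
  obtain ⟨ε, hε, hεN⟩ := EMetric.mem_nhds_iff.1 hN
  filter_upwards [h.near ε hε] with x hx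
  obtain ⟨z, hz, hzy⟩ := hx
  rw [hz.flowMap_eq hf hw ha hab hb]
  exact hεN (hzy b (right_mem_Icc.2 hab))

/-- Near `y a` the flow to time `c` factors through time `b`, by gluing the two trajectories.
Reading the factorization in the chart at `y b` gives the strict derivative of the composition. -/
theorem FlowsNear.trans (hf : ∀ p, ∃ R k G, IsLocalModel S f p R k G)
    (hw : IsControl S w) {c : ℝ} (ha : 0 ≤ a) (hab : a ≤ b) (hbc : b ≤ c) (hc : c ≤ S)
    (hyt : IsTrajectory (ctrlField f w) a c x₀ y)
    (h₁ : FlowsNear (ctrlField f w) y a b) (h₂ : FlowsNear (ctrlField f w) y b c) :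
    FlowsNear (ctrlField f w) y a c := by
  have hnear : ∀ ε : ℝ≥0∞, 0 < ε → ∀ᶠ x in 𝓝 (y a), ∃ z,
      IsTrajectory (ctrlField f w) a c x z ∧ (∀ s ∈ Icc a c, edist (z s) (y s) < ε) ∧
      flowMap (ctrlField f w) a c x =
        flowMap (ctrlField f w) b c (flowMap (ctrlField f w) a b x) := by
    intro ε hε
    obtain ⟨ε', hε', hN⟩ := EMetric.mem_nhds_iff.1 (h₂.near ε hε)
    filter_upwards [h₁.near (min ε ε') (lt_min hε hε')] with x hx
    obtain ⟨z₁, hz₁, hc₁⟩ := hx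
    obtain ⟨z₂, hz₂, hc₂⟩ := hN (a := z₁ b)
      ((hc₁ b (right_mem_Icc.2 hab)).trans_le (min_le_right _ _))
    obtain ⟨v, hv, e₁, e₂⟩ := hz₁.glue hab hbc hz₂
    refine ⟨v, hv, fun s hs => ?_, ?_⟩
    · rcases le_total s b with h | h
      · rw [e₁ ⟨hs.1, h⟩]
        exact (hc₁ s ⟨hs.1, h⟩).trans_le (min_le_left _ _)
      · rw [e₂ ⟨h, hs.2⟩]
        exact hc₂ s ⟨h, hs.2⟩
    · rw [hv.flowMap_eq hf hw ha (hab.trans hbc) hc, hz₁.flowMap_eq hf hw ha hab (hbc.trans hc),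
        hz₂.flowMap_eq hf hw (ha.trans hab) hbc hc, e₂ (right_mem_Icc.2 hbc)]
  refine ⟨fun ε hε => (hnear ε hε).mono fun x ⟨z, h1, h2, _⟩ => ⟨z, h1, h2⟩, ?_⟩
  obtain ⟨A, hA⟩ := h₁.diff
  obtain ⟨B, hB⟩ := h₂.diff
  have hflow : flowMap (ctrlField f w) a b (y a) = y b :=
    (hyt.mono le_rfl hbc).flowMap_eq hf hw ha hab (hbc.trans hc)
  have hval : extChartAt (𝓡 n) (y b) (flowMap (ctrlField f w) a b
      ((extChartAt (𝓡 n) (y a)).symm (extChartAt (𝓡 n) (y a) (y a)))) =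
      extChartAt (𝓡 n) (y b) (y b) := by
    rw [extChartAt_to_inv, hflow]
  refine ⟨B.comp A, ?_⟩
  rw [← hval] at hB
  refine (HasStrictFDerivAt.comp (f := fun u => extChartAt (𝓡 n) (y b)
    (flowMap (ctrlField f w) a b ((extChartAt (𝓡 n) (y a)).symm u))) _ hB hA).congr_of_eventuallyEq ?_
  have ht := continuousAt_extChartAt_symm (I := 𝓡 n) (y a)
  rw [ContinuousAt, extChartAt_to_inv] at ht
  filter_upwards [ht.eventually (hnear 1 one_pos), ht.eventually (h₁.eventually_flowMap hf hw ha hab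
    (hbc.trans hc) (extChartAt_source_mem_nhds (I := 𝓡 n) (y b)))] with u hu hu'
  obtain ⟨z, -, -, hz⟩ := hu
  rw [hz, (extChartAt (𝓡 n) (y b)).left_inv hu']

/-- Near time `s` everything takes place in the chart at `y s`, where the Banach space flow applies.
Transition maps then pass to the charts at `y c` and `y d`, in which `FlowsNear` is stated. -/
theorem exists_flowsNear_of_near (hf : ∀ p, ∃ R k G, IsLocalModel S f p R k G)
    (hw : IsControl S w) (hy : IsTrajectory (ctrlField f w) 0 S x₀ y) {s : ℝ}
    (hs : s ∈ Icc 0 S) : ∃ ε > 0, ∀ c d, 0 ≤ c → c ≤ d → d ≤ S → |c - s| < ε → |d - s| < ε →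
      FlowsNear (ctrlField f w) y c d := by
  obtain ⟨R, k, G, hm⟩ := hf (y s)
  set p := y s with hp
  set ψ := extChartAt (𝓡 n) p with hψ
  have hR := hm.pos
  obtain ⟨ε₁, hε₁, h₁⟩ := eventually_mem_chart_ball (n := n) (R := R / 2) hy.2.1 hs (by positivity)
  obtain ⟨ε₂, hε₂, h₂⟩ := exists_integral_le hm.int (η := 1 / 2) (by norm_num) hs
  refine ⟨min ε₁ ε₂, by positivity, fun c d h0c hcd hdS hc hd => ?_⟩
  have hsub : ∀ σ ∈ Icc c d, σ ∈ Icc 0 S := fun σ hσ => ⟨h0c.trans hσ.1, hσ.2.trans hdS⟩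
  have hyb : ∀ σ ∈ Icc c d, y σ ∈ ψ.source ∧ ψ (y σ) ∈ Metric.ball (ψ p) (R / 2) := fun σ hσ =>
    h₁ σ (hsub σ hσ) (((abs_le_max_abs_abs (by linarith [hσ.1]) (by linarith [hσ.2])).trans_lt
      (max_lt hc hd)).trans_le (min_le_left _ _))
  have hk := h₂ c d h0c hcd hdS (hc.trans_le (min_le_right _ _)) (hd.trans_le (min_le_right _ _))
  obtain ⟨Y, hYc, hYe, hYu, hYn, hYd⟩ :=
    ((hm.isCaratheodory hw).mono h0c hdS).exists_flow hcd hk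
  have mc : c ∈ Icc c d := left_mem_Icc.2 hcd
  have md : d ∈ Icc c d := right_mem_Icc.2 hcd
  have hyY : ∀ σ ∈ Icc c d, Y (ψ (y c)) σ = ψ (y σ) := by
    obtain ⟨cy, ey⟩ := hm.integral_curve (hy.mono h0c hdS) (fun σ hσ => (hyb σ hσ).1)
      (fun σ hσ => Metric.ball_subset_closedBall
        (Metric.ball_subset_ball (by linarith) (hyb σ hσ).2))
    exact fun σ hσ => (hYu _ _ cy ey hσ).symm
  have hYball : ∀ᶠ u in 𝓝 (ψ (y c)), ∀ σ ∈ Icc c d, Y u σ ∈ Metric.closedBall (ψ p) R := by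
    filter_upwards [hYn (ψ (y c)) (R / 2) (by positivity)] with u hu σ hσ
    have h1 := hu σ hσ
    rw [hyY σ hσ] at h1
    have h2 := (hyb σ hσ).2
    rw [mem_ball_iff_norm] at h2
    rw [mem_closedBall_iff_norm]
    calc ‖Y u σ - ψ p‖ = ‖(Y u σ - ψ (y σ)) + (ψ (y σ) - ψ p)‖ := by congr 1; abel
      _ ≤ R := (norm_add_le _ _).trans (by linarith)
  have hYt : ∀ᶠ u in 𝓝 (ψ (y c)), IsTrajectory (ctrlField f w) c d (ψ.symm u)
      (fun σ => ψ.symm (Y u σ)) := by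
    filter_upwards [hYball] with u hu
    exact hm.trajectory hw h0c hdS hcd (hYc u) hu (hYe u)
  have hψc : ContinuousAt ψ (y c) := continuousAt_extChartAt' (hyb c mc).1
  constructor
  · intro ε hε
    -- Uniform continuity of the inverse chart on a compact ball converts closeness of coordinates
    -- into closeness on the manifold.
    have huc := (isCompact_closedBall (ψ p) R).uniformContinuousOn_of_continuous
      ((continuousOn_extChartAt_symm (I := 𝓡 n) p).mono hm.subset_target)
    obtain ⟨η, hη, hu⟩ := EMetric.uniformContinuousOn_iff.1 huc ε hε
    obtain ⟨η', hη', hηη⟩ : ∃ η' : ℝ, 0 < η' ∧ ENNReal.ofReal η' ≤ η := by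
      rcases eq_or_ne η ⊤ with h | h
      · exact ⟨1, one_pos, h ▸ le_top⟩
      · exact ⟨η.toReal, ENNReal.toReal_pos hη.ne' h, ENNReal.ofReal_toReal_le⟩
    filter_upwards [hψc.eventually hYball, hψc.eventually hYt,
      hψc.eventually (hYn (ψ (y c)) η' hη'),
      (isOpen_extChartAt_source (I := 𝓡 n) p).mem_nhds (hyb c mc).1] with x hx1 hx2 hx3 hx4
    rw [ψ.left_inv hx4] at hx2
    refine ⟨_, hx2, fun σ hσ => ?_⟩
    have h1 := hu (hx1 σ hσ) (b := ψ (y σ)) (Metric.ball_subset_closedBall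
        (Metric.ball_subset_ball (by linarith) (hyb σ hσ).2)) (by
      rw [edist_dist, dist_eq_norm, ← hyY σ hσ]
      exact ((ENNReal.ofReal_lt_ofReal_iff hη').2 (hx3 σ hσ)).trans_le hηη)
    rwa [ψ.left_inv (hyb σ hσ).1] at h1
  · have hDex : ∀ σ, ∃ D : EuclideanSpace ℝ (Fin n) →L[ℝ] EuclideanSpace ℝ (Fin n), σ ∈ Icc c d →
        HasStrictFDerivAt (fun u => G σ u (w σ)) D (Y (ψ (y c)) σ) := by
      intro σ
      by_cases hσ : σ ∈ Icc c d
      · rw [hyY σ hσ]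
        obtain ⟨D, hD⟩ := hm.diff σ (hsub σ hσ) (w σ) (ψ (y σ))
          (Metric.ball_subset_ball (by linarith) (hyb σ hσ).2)
        exact ⟨D, fun _ => hD⟩
      · exact ⟨0, fun h => absurd h hσ⟩
    choose D hD using hDex
    obtain ⟨A, hA⟩ := hYd (ψ (y c)) D hD
    have h1 := hasStrictFDerivAt_chart_transition (n := n) (y c) p
      (mem_extChartAt_source (I := 𝓡 n) (y c)) (hyb c mc).1
    have h2 := hasStrictFDerivAt_chart_transition (n := n) p (y d) (hyb d md).1
      (mem_extChartAt_source (I := 𝓡 n) (y d))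
    have e1 : (extChartAt (𝓡 n) p ∘ (extChartAt (𝓡 n) (y c)).symm)
        (extChartAt (𝓡 n) (y c) (y c)) = ψ (y c) := by
      rw [Function.comp_apply, extChartAt_to_inv]
    rw [← hyY d md] at h2
    rw [← e1] at hA h2
    refine ⟨_, (HasStrictFDerivAt.comp _
      (HasStrictFDerivAt.comp (f := fun u => Y u d) _ h2 hA) h1).congr_of_eventuallyEq ?_⟩
    have ht := continuousAt_extChartAt_symm (I := 𝓡 n) (y c)
    rw [ContinuousAt, extChartAt_to_inv] at ht
    filter_upwards [ht.eventually (hψc.eventually hYt), ht.eventually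
      ((isOpen_extChartAt_source (I := 𝓡 n) p).mem_nhds (hyb c mc).1)] with u hu hu'
    rw [ψ.left_inv hu'] at hu
    simp only [Function.comp_apply]
    rw [hu.flowMap_eq hf hw h0c hcd hdS]

theorem IsTrajectory.flowsNear (hf : ∀ p, ∃ R k G, IsLocalModel S f p R k G)
    (hw : IsControl S w) (hy : IsTrajectory (ctrlField f w) 0 S x₀ y)
    (ha : 0 ≤ a) (hab : a ≤ b) (hb : b ≤ S) : FlowsNear (ctrlField f w) y a b := by
  refine interval_induction (Q := fun c d => FlowsNear (ctrlField f w) y c d) hab ?_ ?_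
  · intro s hs
    obtain ⟨ε, hε, h⟩ := exists_flowsNear_of_near hf hw hy (s := s)
      ⟨ha.trans hs.1, hs.2.trans hb⟩
    exact ⟨ε, hε, fun c d h1 h2 h3 => h c d (ha.trans h1) h2 (h3.trans hb)⟩
  · intro c d e h1 h2 h3 h4 h5 h6
    exact h5.trans hf hw (ha.trans h1) h2 h3 (h4.trans hb) (hy.mono (ha.trans h1) (h4.trans hb)) h6

end Flows

/-! ### Needle fields and Scorza-Dragoni points. -/

section Needle

variable {n : ℕ} {M : Type*} [EMetricSpace M] [ChartedSpace (EuclideanSpace ℝ (Fin n)) M]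
  [IsManifold (𝓡 n) 2 M] {𝔚 : Type*} [MetricSpace 𝔚] {S : ℝ}
  {f : ℝ → (x : M) → 𝔚 → TangentSpace (𝓡 n) x} {p : M}
  {R : ℝ} {k : ℝ → ℝ} {G : ℝ → EuclideanSpace ℝ (Fin n) → 𝔚 → EuclideanSpace ℝ (Fin n)}
  {w : ℝ → 𝔚} {a b : ℝ} {x₀ : M} {y z : ℝ → M}

theorem isControl_const (S : ℝ) (𝔲 : 𝔚) : IsControl S fun _ => 𝔲 :=
  ⟨aestronglyMeasurable_const, 𝔲, by simp⟩

/-- The field `f(s,x,w) + c (f(s,x,𝔲) - f(s,x,w))`. -/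
def needleField (f : ℝ → (x : M) → 𝔚 → TangentSpace (𝓡 n) x) (w : ℝ → 𝔚) (𝔲 : 𝔚) (c : ℝ) :
    ℝ → (x : M) → TangentSpace (𝓡 n) x :=
  fun s x => f s x (w s) + c • (f s x 𝔲 - f s x (w s))

theorem coordVec_sub (p x : M) (u v : TangentSpace (𝓡 n) x) :
    coordVec p x (u - v) = coordVec p x u - coordVec p x v :=
  map_sub (tangentCoordChange (𝓡 n) x p x) u v

theorem coordVec_add_smul (p x : M) (u v : TangentSpace (𝓡 n) x) (c : ℝ) :
    coordVec p x (u + c • v) = coordVec p x u + c • coordVec p x v :=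
  (map_add (tangentCoordChange (𝓡 n) x p x) u (c • v)).trans
    (congrArg _ (map_smul (tangentCoordChange (𝓡 n) x p x) c v))

theorem coordVec_self (p : M) (v : TangentSpace (𝓡 n) p) : coordVec p p v = v :=
  tangentCoordChange_self (mem_extChartAt_source p)

theorem coordVec_needleField (p x : M) (𝔲 : 𝔚) (c s : ℝ) :
    coordVec p x (needleField f w 𝔲 c s x) = coordVec p x (f s x (w s)) +
      c • (coordVec p x (f s x 𝔲) - coordVec p x (f s x (w s))) := by
  rw [needleField, coordVec_add_smul, coordVec_sub]

theorem IsLocalModel.integrableOn_coordVec (h : IsLocalModel S f p R k G) (hw : IsControl S w)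
    (ha : 0 ≤ a) (hb : b ≤ S) (hy : ContinuousOn y (Icc a b))
    (hsrc : ∀ s ∈ Icc a b, y s ∈ (extChartAt (𝓡 n) p).source)
    (hball : ∀ s ∈ Icc a b, extChartAt (𝓡 n) p (y s) ∈
      Metric.closedBall (extChartAt (𝓡 n) p p) R) :
    IntegrableOn (fun s => coordVec p (y s) (f s (y s) (w s))) (Icc a b) := by
  have h1 := ((h.isCaratheodory hw).mono ha hb).integrableOn_comp
    (((continuousOn_extChartAt (I := 𝓡 n) p).comp hy hsrc).aestronglyMeasurable measurableSet_Icc)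
  exact h1.congr_fun (fun s hs => (h.coordVec_eq s (hsrc s hs) (hball s hs) (w s)).symm)
    measurableSet_Icc

/-- A needle trajectory stays in a coordinate ball for as long as the bound `k` allows. -/
theorem IsLocalModel.mem_ball_of_needle (h : IsLocalModel S f p R k G) {𝔲 : 𝔚} {c : ℝ}
    (hc : c ∈ Icc (0 : ℝ) 1) (ha : 0 ≤ a) (hab : a ≤ b) (hb : b ≤ S)
    (hy : IsTrajectory (needleField f w 𝔲 c) a b x₀ y) {ρ : ℝ} (hρ : ρ ≤ R)
    (hya : y a ∈ (extChartAt (𝓡 n) p).source)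
    (hlt : ‖extChartAt (𝓡 n) p (y a) - extChartAt (𝓡 n) p p‖ + ∫ s in a..b, k s < ρ) :
    ∀ s ∈ Icc a b, y s ∈ (extChartAt (𝓡 n) p).source ∧
      extChartAt (𝓡 n) p (y s) ∈ Metric.ball (extChartAt (𝓡 n) p p) ρ := by
  set ψ := extChartAt (𝓡 n) p
  have hk0 : ∀ᵐ s ∂(volume.restrict (Icc a b)), 0 ≤ k s := by
    refine ae_mono (Measure.restrict_mono (Icc_subset_Icc ha hb) le_rfl) ?_
    filter_upwards [h.bound] with s hs
    exact (norm_nonneg _).trans (hs 0 𝔲)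
  have hki : IntegrableOn k (Icc a b) := h.int.mono_set (Icc_subset_Icc ha hb)
  have hI : ∀ d ∈ Icc a b, ∫ s in a..d, k s ≤ ∫ s in a..b, k s := fun d hd =>
    intervalIntegral_mono_of_ae_nonneg hki hk0 le_rfl hd.1 hd.2
  have hI0 : 0 ≤ ∫ s in a..b, k s := by
    have := hI a (left_mem_Icc.2 hab)
    rwa [intervalIntegral.integral_same] at this
  set O : Set M := ψ.source ∩ ψ ⁻¹' Metric.ball (ψ p) ρ with hO
  have hOo : IsOpen O :=
    (continuousOn_extChartAt (I := 𝓡 n) p).isOpen_inter_preimage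
      (isOpen_extChartAt_source (I := 𝓡 n) p) Metric.isOpen_ball
  have hsub : Metric.closedBall (ψ p) ρ ⊆ ψ.target :=
    (Metric.closedBall_subset_closedBall hρ).trans h.subset_target
  -- This compact set is closed in `M`, so at the first exit time `d` from `O` the curve is still in
  -- the chart domain. The integral formula is then valid up to `d` and contradicts the exit.
  set B : Set M := ψ.symm '' Metric.closedBall (ψ p) ρ with hB
  have hBc : IsClosed B := ((isCompact_closedBall (ψ p) ρ).image_of_continuousOn
    ((continuousOn_extChartAt_symm (I := 𝓡 n) p).mono hsub)).isClosed
  have hOB : O ⊆ B := fun x hx => ⟨ψ x, Metric.ball_subset_closedBall hx.2, ψ.left_inv hx.1⟩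
  have hBm : ∀ x ∈ B, x ∈ ψ.source ∧ ψ x ∈ Metric.closedBall (ψ p) ρ := by
    rintro _ ⟨u, hu, rfl⟩
    exact ⟨ψ.map_target (hsub hu), by rwa [ψ.right_inv (hsub hu)]⟩
  by_contra! hcon
  have hne : (Icc a b ∩ y ⁻¹' Oᶜ).Nonempty := by
    obtain ⟨s, hs, h1⟩ := hcon
    exact ⟨s, hs, fun h2 => h1 h2.1 h2.2⟩
  have hcl : IsClosed (Icc a b ∩ y ⁻¹' Oᶜ) :=
    hy.2.1.preimage_isClosed_of_isClosed isClosed_Icc hOo.isClosed_compl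
  obtain ⟨d, ⟨hd, hdO⟩, hmin⟩ := (isCompact_Icc.of_isClosed_subset hcl
    inter_subset_left).exists_isLeast hne
  have haO : y a ∈ O := ⟨hya, by rw [mem_preimage, mem_ball_iff_norm]; linarith⟩
  have had : a < d := lt_of_le_of_ne hd.1 fun h => hdO (h ▸ haO)
  have hlt' : ∀ s ∈ Ico a d, y s ∈ O := by
    intro s hs
    by_contra hsO
    exact absurd (hmin ⟨⟨hs.1, hs.2.le.trans hd.2⟩, hsO⟩) (not_le.2 hs.2)
  have hdB : y d ∈ B := by
    have h1 : ContinuousWithinAt y (Ico a d) d := (hy.2.1 d hd).mono fun s hs =>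
      ⟨hs.1, hs.2.le.trans hd.2⟩
    have h2 := h1.mem_closure (by rw [closure_Ico had.ne]; exact right_mem_Icc.2 had.le)
      (fun s hs => hOB (hlt' s hs))
    rwa [hBc.closure_eq] at h2
  have hall : ∀ s ∈ Icc a d, y s ∈ ψ.source ∧ ψ (y s) ∈ Metric.closedBall (ψ p) ρ := by
    intro s hs
    rcases eq_or_lt_of_le hs.2 with h | h
    · rw [h]
      exact hBm _ hdB
    · exact hBm _ (hOB (hlt' s ⟨hs.1, h⟩))
  obtain ⟨-, heq⟩ := hy.2.2 p a d le_rfl had.le hd.2 fun s hs => (hall s hs).1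
  have hbd : ‖∫ s in a..d, coordVec p (y s) (needleField f w 𝔲 c s (y s))‖ ≤
      ∫ s in a..d, k s := by
    refine norm_intervalIntegral_le_of_ae_restrict (hki.mono_set (Icc_subset_Icc le_rfl hd.2)) ?_
      le_rfl had.le le_rfl
    have h1 := ae_mono (Measure.restrict_mono (Icc_subset_Icc ha (hd.2.trans hb)) le_rfl) h.bound
    filter_upwards [h1, ae_restrict_mem measurableSet_Icc] with s hs hsd
    have hR := Metric.closedBall_subset_closedBall hρ (hall s hsd).2
    rw [coordVec_needleField, h.coordVec_eq s (hall s hsd).1 hR, h.coordVec_eq s (hall s hsd).1 hR]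
    -- The needle field is a convex combination of two fields bounded by `k`.
    have e : ∀ u v : EuclideanSpace ℝ (Fin n), u + c • (v - u) = (1 - c) • u + c • v := by
      intro u v
      rw [smul_sub, sub_smul, one_smul]
      abel
    rw [e]
    have e1 := mul_le_mul_of_nonneg_left (hs (ψ (y s)) (w s)) (sub_nonneg.2 hc.2)
    have e2 := mul_le_mul_of_nonneg_left (hs (ψ (y s)) 𝔲) hc.1
    refine (norm_add_le _ _).trans ?_
    rw [norm_smul, norm_smul, Real.norm_of_nonneg hc.1, Real.norm_of_nonneg (sub_nonneg.2 hc.2)]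
    linarith
  rw [← heq] at hbd
  refine hdO ⟨(hBm _ hdB).1, ?_⟩
  rw [mem_preimage, mem_ball_iff_norm]
  have h3 := hI d hd
  calc ‖ψ (y d) - ψ p‖ = ‖(ψ (y d) - ψ (y a)) + (ψ (y a) - ψ p)‖ := by congr 1; abel
    _ < ρ := (norm_add_le _ _).trans_lt (by linarith)

/-- The oscillation `sdOsc` is a supremum over all points near `p`, so it dominates the integrand
for every curve `x` at once. Hence the bound is uniform in `x`, and no regularity of `x` is
required. -/
theorem IsScorzaDragoniPt.norm_integral_le {X : Set M}
    {φ : ℝ → (x : M) → TangentSpace (𝓡 n) x} {t : ℝ} (h : IsScorzaDragoniPt 0 S X φ t)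
    (ht : 0 < t) (hp : p ∈ X) {η : ℝ} (hη : 0 < η) :
    ∃ r > 0, ∀ᶠ τ in 𝓝[>] (0 : ℝ), ∀ x : ℝ → M,
      (∀ s ∈ Ioc (t - τ) t, x s ∈ X ∧ edist (x s) p ≤ ENNReal.ofReal r) →
      ‖∫ s in (t - τ)..t, (coordVec p (x s) (φ s (x s)) - coordVec p p (φ t p))‖ ≤ η * τ := by
  obtain ⟨htS, hlim⟩ := h
  have hη' : (0 : ℝ≥0∞) < ENNReal.ofReal η := ENNReal.ofReal_pos.2 hη
  obtain ⟨r, hr, hr0⟩ := (((hlim p hp).eventually (gt_mem_nhds hη')).and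
    self_mem_nhdsWithin).exists
  have hev := eventually_lt_of_limsup_lt hr
  -- Needle windows lie to the left of `t`, so the increment in the definition is `δ = -τ`.
  have ht' : Tendsto (fun τ : ℝ => -τ) (𝓝[>] 0) (𝓝[{δ : ℝ | δ ≠ 0 ∧ t + δ ∈ Icc 0 S}] 0) := by
    refine tendsto_nhdsWithin_iff.2 ⟨?_, ?_⟩
    · have := (continuous_neg (G := ℝ)).tendsto 0
      rw [neg_zero] at this
      exact this.mono_left nhdsWithin_le_nhds
    · filter_upwards [self_mem_nhdsWithin, nhdsWithin_le_nhds (gt_mem_nhds ht)] with τ h1 h2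
      have h1' : 0 < τ := h1
      exact ⟨by linarith, by linarith, by linarith [htS.2]⟩
  refine ⟨r, hr0, ?_⟩
  filter_upwards [ht'.eventually hev, self_mem_nhdsWithin] with τ hτ hτ0 x hx
  have hτ0' : 0 < τ := hτ0
  rw [abs_neg, abs_of_pos hτ0', ← sub_eq_add_neg, uIoc_comm, uIoc_of_le (by linarith),
    ENNReal.div_lt_iff (Or.inl (ENNReal.ofReal_pos.2 hτ0').ne') (Or.inl ENNReal.ofReal_ne_top),
    ← ENNReal.ofReal_mul hη.le] at hτ
  rw [intervalIntegral.integral_of_le (by linarith),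
    ← ENNReal.ofReal_le_ofReal_iff (by positivity), ofReal_norm]
  refine (enorm_integral_le_lintegral_enorm _).trans (le_trans ?_ hτ.le)
  refine setLIntegral_mono' measurableSet_Ioc fun s hs => ?_
  exact le_iSup₂_of_le (x s) (hx s hs).1 (le_iSup_of_le (hx s hs).2 le_rfl)

end Needle

/-! ### The effect of one needle. -/

section NeedleStep

variable {n : ℕ} {M : Type*} [EMetricSpace M] [ChartedSpace (EuclideanSpace ℝ (Fin n)) M]
  [IsManifold (𝓡 n) 2 M] {𝔚 : Type*} [MetricSpace 𝔚] {S : ℝ}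
  {f : ℝ → (x : M) → 𝔚 → TangentSpace (𝓡 n) x} {p : M}
  {R : ℝ} {k : ℝ → ℝ} {G : ℝ → EuclideanSpace ℝ (Fin n) → 𝔚 → EuclideanSpace ℝ (Fin n)}
  {w : ℝ → 𝔚} {a : ℝ} {x₀ : M} {y : ℝ → M}

/-- Carries properties valid near `t` from the left over to the whole shrinking window. With a
trivial `P` it only says that the window is eventually contained in `[b, t]`. -/
theorem eventually_forall_Icc_sub {ι : Type*} {l : Filter ι} {τ : ι → ℝ} {b t : ℝ}
    (hτ : Tendsto τ l (𝓝[>] 0)) (hbt : b < t) {P : ℝ → Prop} (hP : ∀ᶠ s in 𝓝[Icc b t] t, P s) :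
    ∀ᶠ i in l, b ≤ t - τ i ∧ 0 < τ i ∧ ∀ s ∈ Icc (t - τ i) t, P s := by
  obtain ⟨ε, hε, h⟩ := Metric.mem_nhdsWithin_iff.1 hP
  have h1 : ∀ᶠ x in 𝓝[>] (0 : ℝ), 0 < x ∧ x < min ε (t - b) :=
    (eventually_mem_nhdsWithin (a := (0 : ℝ)) (s := Ioi 0)).and
      (nhdsWithin_le_nhds (gt_mem_nhds (lt_min hε (sub_pos.2 hbt))))
  filter_upwards [hτ.eventually h1] with i hi
  have h2 := hi.2.trans_le (min_le_right _ _)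
  have h3 := hi.2.trans_le (min_le_left _ _)
  refine ⟨by linarith, hi.1, fun s hs => h ⟨?_, by linarith [hs.1], hs.2⟩⟩
  rw [Metric.mem_ball, Real.dist_eq, abs_lt]
  constructor <;> linarith [hs.1, hs.2]

/-- A family of needle trajectories started near `y a` is uniformly close to the reference
trajectory on `[a,t]`, and remains in the continuation of the unperturbed flow until `t - τ`. -/
theorem exists_unperturbed (hf : ∀ p, ∃ R k G, IsLocalModel S f p R k G) (hw : IsControl S w)
    (hy : IsTrajectory (ctrlField f w) 0 S x₀ y) {t : ℝ} (ha : 0 ≤ a) (hat : a < t) (htS : t ≤ S)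
    {𝔲 : 𝔚} {ι : Type*} {l : Filter ι} {τ c : ι → ℝ} {ζ : ι → ℝ → M}
    (hτ : Tendsto τ l (𝓝[>] 0)) (hc : ∀ᶠ i in l, c i ∈ Icc 0 (τ i))
    (h₁ : ∀ᶠ i in l, IsTrajectory (ctrlField f w) a (t - τ i) (ζ i a) (ζ i))
    (h₂ : ∀ᶠ i in l, IsTrajectory (needleField f w 𝔲 (c i / τ i)) (t - τ i) t
      (ζ i (t - τ i)) (ζ i))
    (hζ : Tendsto (fun i => ζ i a) l (𝓝 (y a))) :
    ∃ U : ι → ℝ → M, (∀ᶠ i in l, IsTrajectory (ctrlField f w) a S (ζ i a) (U i)) ∧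
      (∀ᶠ i in l, U i (t - τ i) = ζ i (t - τ i)) ∧
      (∀ N ∈ 𝓝 (y t), ∀ᶠ i in l, ∀ s ∈ Icc (t - τ i) t, U i s ∈ N) ∧
      (∀ N ∈ 𝓝 (y t), ∀ᶠ i in l, ∀ s ∈ Icc (t - τ i) t, ζ i s ∈ N) ∧
      ∀ ε : ℝ≥0∞, 0 < ε → ∀ᶠ i in l, ∀ s ∈ Icc a t, edist (ζ i s) (y s) < ε := by
  classical
  have haS : a ≤ S := hat.le.trans htS
  have h0t : 0 < t := ha.trans_lt hat
  have hfl := hy.flowsNear hf hw ha haS le_rfl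
  -- The default value `y` plays no role, since a solution from `ζ i a` eventually exists.
  set U : ι → ℝ → M := fun i => if h : ∃ z, IsTrajectory (ctrlField f w) a S (ζ i a) z then
    h.choose else y with hU
  have hUt : ∀ ε : ℝ≥0∞, 0 < ε → ∀ᶠ i in l, IsTrajectory (ctrlField f w) a S (ζ i a) (U i) ∧
      ∀ s ∈ Icc a S, edist (U i s) (y s) < ε := by
    intro ε hε
    filter_upwards [hζ.eventually (hfl.near ε hε)] with i hi
    obtain ⟨z, hz, hzy⟩ := hi
    have hex : ∃ z, IsTrajectory (ctrlField f w) a S (ζ i a) z := ⟨z, hz⟩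
    have hUi : IsTrajectory (ctrlField f w) a S (ζ i a) (U i) := by
      simp only [hU, dif_pos hex]
      exact hex.choose_spec
    refine ⟨hUi, fun s hs => ?_⟩
    rw [hUi.eqOn hf hw ha haS le_rfl hz hs]
    exact hzy s hs
  have hle : ∀ᶠ i in l, a ≤ t - τ i ∧ 0 < τ i :=
    (eventually_forall_Icc_sub hτ hat (P := fun _ => True) (by simp)).mono fun i h => ⟨h.1, h.2.1⟩
  have heq : ∀ᶠ i in l, EqOn (ζ i) (U i) (Icc a (t - τ i)) := by
    filter_upwards [hUt 1 one_pos, h₁, hle] with i hi h₁i hlei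
    exact h₁i.eqOn hf hw ha hlei.1 (by linarith) (hi.1.mono_right (by linarith))
  have hyc : ContinuousWithinAt y (Icc a t) t :=
    (hy.2.1 t ⟨h0t.le, htS⟩).mono (Icc_subset_Icc ha htS)
  have hyn : ∀ N ∈ 𝓝 (y t), ∀ᶠ i in l, ∀ s ∈ Icc (t - τ i) t, y s ∈ N := fun N hN =>
    (eventually_forall_Icc_sub hτ hat (hyc.eventually hN)).mono fun i h => h.2.2
  have hUn : ∀ N ∈ 𝓝 (y t), ∀ᶠ i in l, ∀ s ∈ Icc (t - τ i) t, U i s ∈ N := by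
    intro N hN
    obtain ⟨ε, hε, hεN⟩ := EMetric.mem_nhds_iff.1 hN
    have hε2 : 0 < ε / 2 := ENNReal.half_pos hε.ne'
    filter_upwards [hUt _ hε2, hyn _ (Metric.eball_mem_nhds (y t) hε2), hle] with i h1 h2 h3 s hs
    refine hεN ?_
    calc edist (U i s) (y t) ≤ edist (U i s) (y s) + edist (y s) (y t) := edist_triangle _ _ _
      _ < ε / 2 + ε / 2 := ENNReal.add_lt_add
          (h1.2 s ⟨h3.1.trans hs.1, hs.2.trans htS⟩) (h2 s hs)
      _ = ε := ENNReal.add_halves ε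
  have hζn : ∀ N ∈ 𝓝 (y t), ∀ᶠ i in l, ∀ s ∈ Icc (t - τ i) t, ζ i s ∈ N := by
    intro N hN
    obtain ⟨R, k, G, hm⟩ := hf (y t)
    have hinv := continuousAt_extChartAt_symm (I := 𝓡 n) (y t)
    rw [ContinuousAt, extChartAt_to_inv] at hinv
    obtain ⟨ρ', hρ', hρN⟩ := Metric.mem_nhds_iff.1 (hinv hN)
    set ρ := min ρ' R
    have hρ : 0 < ρ := lt_min hρ' hm.pos
    have hN2 : {x | x ∈ (extChartAt (𝓡 n) (y t)).source ∧ extChartAt (𝓡 n) (y t) x ∈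
        Metric.ball (extChartAt (𝓡 n) (y t) (y t)) (ρ / 2)} ∈ 𝓝 (y t) :=
      Filter.Eventually.and (extChartAt_source_mem_nhds (I := 𝓡 n) (y t))
        ((continuousAt_extChartAt (I := 𝓡 n) (y t)).preimage_mem_nhds
          (Metric.ball_mem_nhds _ (half_pos hρ)))
    -- The needle starts within `ρ/2` of the centre and moves by at most `ρ/4`, hence stays in the
    -- ball of radius `ρ`.
    obtain ⟨ε, hε, hk⟩ := exists_integral_le hm.int (η := ρ / 4) (by positivity)
      (s := t) ⟨h0t.le, htS⟩
    have hkev : ∀ᶠ s in 𝓝[Icc a t] t, |s - t| < ε :=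
      mem_nhdsWithin_of_mem_nhds (Metric.ball_mem_nhds t hε)
    filter_upwards [hUn _ hN2, heq, eventually_forall_Icc_sub hτ hat hkev, h₂, hc]
      with i h1 h2 h3 h4 h5 s hs
    have hlt : t - τ i ≤ t := by linarith [h3.2.1]
    have hm1 : t - τ i ∈ Icc (t - τ i) t := left_mem_Icc.2 hlt
    have h6 := h1 _ hm1
    rw [← h2 (right_mem_Icc.2 h3.1)] at h6
    have h7 := hk (t - τ i) t (ha.trans h3.1) hlt htS (h3.2.2 _ hm1) (by simpa using hε)
    have h8 := h6.2
    rw [mem_ball_iff_norm] at h8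
    have h9 := hm.mem_ball_of_needle ⟨div_nonneg h5.1 h3.2.1.le, div_le_one_of_le₀ h5.2 h3.2.1.le⟩
      (ha.trans h3.1) hlt htS h4 (min_le_right ρ' R) h6.1 (by
        refine (add_le_add h8.le h7).trans_lt ?_
        change ρ / 2 + ρ / 4 < ρ
        linarith) s hs
    have h10 := hρN (Metric.ball_subset_ball (min_le_left _ _) h9.2)
    rwa [mem_preimage, (extChartAt (𝓡 n) (y t)).left_inv h9.1] at h10
  refine ⟨U, (hUt 1 one_pos).mono fun i h => h.1, ?_, hUn, hζn, fun ε hε => ?_⟩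
  · filter_upwards [heq, hle] with i h1 h2
    exact (h1 (right_mem_Icc.2 h2.1)).symm
  · have hε2 : 0 < ε / 2 := ENNReal.half_pos hε.ne'
    filter_upwards [hUt ε hε, heq, hζn _ (Metric.eball_mem_nhds (y t) hε2),
      hyn _ (Metric.eball_mem_nhds (y t) hε2)] with i h1 h2 h3 h4 s hs
    rcases le_total s (t - τ i) with h | h
    · rw [h2 ⟨hs.1, h⟩]
      exact h1.2 s ⟨hs.1, hs.2.trans htS⟩
    · calc edist (ζ i s) (y s) ≤ edist (ζ i s) (y t) + edist (y s) (y t) :=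
            edist_triangle_right _ _ _
        _ < ε / 2 + ε / 2 := ENNReal.add_lt_add (h3 s ⟨h, hs.2⟩) (h4 s ⟨h, hs.2⟩)
        _ = ε := ENNReal.add_halves ε

/-- The displacement, in the chart at `p`, of a needle trajectory from the unperturbed one. -/
theorem IsLocalModel.needle_displacement (hm : IsLocalModel S f p R k G) (hw : IsControl S w)
    {𝔲 : 𝔚} {b t τ c η : ℝ} (hb : 0 ≤ b) (htS : t ≤ S) (hτ : 0 < τ) (hbt : b = t - τ)
    (hc : c ∈ Icc 0 τ) {z u : ℝ → M}
    (hz : IsTrajectory (needleField f w 𝔲 (c / τ)) b t (z b) z)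
    (hu : IsTrajectory (ctrlField f w) b t (z b) u)
    (hzs : ∀ s ∈ Icc b t, z s ∈ (extChartAt (𝓡 n) p).source ∧
      extChartAt (𝓡 n) p (z s) ∈ Metric.closedBall (extChartAt (𝓡 n) p p) R)
    (hus : ∀ s ∈ Icc b t, u s ∈ (extChartAt (𝓡 n) p).source ∧
      extChartAt (𝓡 n) p (u s) ∈ Metric.closedBall (extChartAt (𝓡 n) p p) R)
    (hz₁ : ‖∫ s in b..t, (coordVec p (z s) (f s (z s) (w s)) - coordVec p p (f t p (w t)))‖ ≤ η * τ)
    (hz₂ : ‖∫ s in b..t, (coordVec p (z s) (f s (z s) 𝔲) - coordVec p p (f t p 𝔲))‖ ≤ η * τ)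
    (hu₁ : ‖∫ s in b..t, (coordVec p (u s) (f s (u s) (w s)) - coordVec p p (f t p (w t)))‖ ≤
      η * τ) :
    ‖extChartAt (𝓡 n) p (z t) - extChartAt (𝓡 n) p (u t) -
      c • coordVec p p (f t p 𝔲 - f t p (w t))‖ ≤ 4 * η * τ := by
  have hle : b ≤ t := by linarith
  have ii : ∀ {v : ℝ → 𝔚} {x : ℝ → M}, IsControl S v → ContinuousOn x (Icc b t) →
      (∀ s ∈ Icc b t, x s ∈ (extChartAt (𝓡 n) p).source ∧
        extChartAt (𝓡 n) p (x s) ∈ Metric.closedBall (extChartAt (𝓡 n) p p) R) →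
      IntervalIntegrable (fun s => coordVec p (x s) (f s (x s) (v s))) volume b t :=
    fun hv hx hxs => intervalIntegrable_of_integrableOn_Icc (hm.integrableOn_coordVec hv hb htS hx
      (fun s hs => (hxs s hs).1) (fun s hs => (hxs s hs).2)) (left_mem_Icc.2 hle)
      (right_mem_Icc.2 hle)
  have i1 := ii hw hz.2.1 hzs
  have i2 := ii (isControl_const S 𝔲) hz.2.1 hzs
  have i3 := ii hw hu.2.1 hus
  obtain ⟨-, ez⟩ := hz.2.2 p b t le_rfl hle le_rfl fun s hs => (hzs s hs).1
  obtain ⟨-, eu⟩ := hu.2.2 p b t le_rfl hle le_rfl fun s hs => (hus s hs).1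
  simp only [coordVec_needleField] at ez
  have i4 : IntervalIntegrable (fun s => (c / τ) • (coordVec p (z s) (f s (z s) 𝔲) -
    coordVec p (z s) (f s (z s) (w s)))) volume b t := (i2.sub i1).smul (c / τ)
  rw [intervalIntegral.integral_add i1 i4, intervalIntegral.integral_smul,
    intervalIntegral.integral_sub i2 i1] at ez
  rw [hu.1] at eu
  have eu' : extChartAt (𝓡 n) p (u t) - extChartAt (𝓡 n) p (z b) =
      ∫ s in b..t, coordVec p (u s) (f s (u s) (w s)) := eu
  rw [intervalIntegral.integral_sub i1 (by simp), intervalIntegral.integral_const] at hz₁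
  rw [intervalIntegral.integral_sub i2 (by simp), intervalIntegral.integral_const] at hz₂
  rw [intervalIntegral.integral_sub i3 (by simp), intervalIntegral.integral_const] at hu₁
  rw [coordVec_sub, show extChartAt (𝓡 n) p (z t) = _ from sub_eq_iff_eq_add.1 ez,
    show extChartAt (𝓡 n) p (u t) = _ from sub_eq_iff_eq_add.1 eu']
  have htb : t - b = τ := by linarith
  rw [htb] at hz₁ hz₂ hu₁
  set Iz := ∫ s in b..t, coordVec p (z s) (f s (z s) (w s))
  set Iv := ∫ s in b..t, coordVec p (z s) (f s (z s) 𝔲)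
  set Iu := ∫ s in b..t, coordVec p (u s) (f s (u s) (w s))
  set W := coordVec p p (f t p (w t))
  set V := coordVec p p (f t p 𝔲)
  set q := c / τ with hq
  have hq0 : 0 ≤ q := div_nonneg hc.1 hτ.le
  have hq1 : q ≤ 1 := div_le_one_of_le₀ hc.2 hτ.le
  have hcq : c = q * τ := by rw [hq, div_mul_cancel₀ _ hτ.ne']
  -- The displacement is regrouped into three integrals compared with their frozen values, each at
  -- most `η τ` since `q` lies in `[0,1]`.
  have halg : Iz + q • (Iv - Iz) + extChartAt (𝓡 n) p (z b) - (Iu + extChartAt (𝓡 n) p (z b)) -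
      c • (V - W) = (1 - q) • (Iz - τ • W) + q • (Iv - τ • V) - (Iu - τ • W) := by
    rw [hcq]
    module
  rw [halg]
  have hητ : 0 ≤ η * τ := (norm_nonneg _).trans hz₁
  have e1 : ‖(1 - q) • (Iz - τ • W)‖ ≤ η * τ := by
    rw [norm_smul, Real.norm_of_nonneg (sub_nonneg.2 hq1)]
    exact (mul_le_mul (by linarith) hz₁ (norm_nonneg _) zero_le_one).trans (one_mul _).le
  have e2 : ‖q • (Iv - τ • V)‖ ≤ η * τ := by
    rw [norm_smul, Real.norm_of_nonneg hq0]
    exact (mul_le_mul hq1 hz₂ (norm_nonneg _) zero_le_one).trans (one_mul _).le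
  refine (norm_sub_le _ _).trans ((add_le_add ((norm_add_le _ _).trans (add_le_add e1 e2))
    hu₁).trans ?_)
  linarith

/-- The effect at time `S` of a needle variation of width `τ → 0` at time `t`. -/
theorem needle_step (hf : ∀ p, ∃ R k G, IsLocalModel S f p R k G) (hw : IsControl S w)
    (hy : IsTrajectory (ctrlField f w) 0 S x₀ y) {t : ℝ} (ha : 0 ≤ a) (hat : a < t) (htS : t ≤ S)
    {X : Set M} (hX : y t ∈ interior X) {𝔲 : 𝔚}
    (hSDw : IsScorzaDragoniPt 0 S X (ctrlField f w) t)
    (hSD : IsScorzaDragoniPt 0 S X (fun s x => f s x 𝔲) t)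
    {A : EuclideanSpace ℝ (Fin n) →L[ℝ] EuclideanSpace ℝ (Fin n)}
    (hA : HasStrictFDerivAt (fun u => extChartAt (𝓡 n) (y S)
      (flowMap (ctrlField f w) t S ((extChartAt (𝓡 n) (y t)).symm u))) A
      (extChartAt (𝓡 n) (y t) (y t)))
    {ι : Type*} {l : Filter ι} {τ c : ι → ℝ} {ζ : ι → ℝ → M}
    (hτ : Tendsto τ l (𝓝[>] 0)) (hc : ∀ᶠ i in l, c i ∈ Icc 0 (τ i))
    (h₁ : ∀ᶠ i in l, IsTrajectory (ctrlField f w) a (t - τ i) (ζ i a) (ζ i))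
    (h₂ : ∀ᶠ i in l, IsTrajectory (needleField f w 𝔲 (c i / τ i)) (t - τ i) t
      (ζ i (t - τ i)) (ζ i))
    (hζ : Tendsto (fun i => ζ i a) l (𝓝 (y a))) :
    (∀ ε : ℝ≥0∞, 0 < ε → ∀ᶠ i in l, ∀ s ∈ Icc a t, edist (ζ i s) (y s) < ε) ∧
      (fun i => extChartAt (𝓡 n) (y S) (flowMap (ctrlField f w) t S (ζ i t)) -
        extChartAt (𝓡 n) (y S) (flowMap (ctrlField f w) a S (ζ i a)) -
        c i • A (f t (y t) 𝔲 - f t (y t) (w t))) =o[l] τ := by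
  obtain ⟨U, hU, hUeq, hUn, hζn, hclose⟩ := exists_unperturbed hf hw hy ha hat htS hτ hc h₁ h₂ hζ
  refine ⟨hclose, ?_⟩
  have h0t : 0 < t := ha.trans_lt hat
  obtain ⟨R, k, G, hm⟩ := hf (y t)
  set p := y t with hp
  set ψ := extChartAt (𝓡 n) p with hψ
  set Δ : EuclideanSpace ℝ (Fin n) := coordVec p p (f t p 𝔲 - f t p (w t)) with hΔ
  have hΔ' : A (f t p 𝔲 - f t p (w t)) = A Δ := by rw [hΔ, coordVec_self]
  rw [hΔ']
  have hτ0 : ∀ᶠ i in l, a ≤ t - τ i ∧ 0 < τ i :=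
    (eventually_forall_Icc_sub hτ hat (P := fun _ => True) (by simp)).mono fun i h => ⟨h.1, h.2.1⟩
  have hpX : p ∈ X := interior_subset hX
  have hsrcN : ψ.source ∈ 𝓝 p := extChartAt_source_mem_nhds (I := 𝓡 n) p
  have hballN : {x | ψ x ∈ Metric.closedBall (ψ p) R} ∈ 𝓝 p :=
    (continuousAt_extChartAt (I := 𝓡 n) p).preimage_mem_nhds (Metric.closedBall_mem_nhds _ hm.pos)
  -- Displacement at time `t`, before transport by the flow.
  have hdisp : (fun i => ψ (ζ i t) - ψ (U i t) - c i • Δ) =o[l] τ := by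
    rw [Asymptotics.isLittleO_iff]
    intro η hη
    obtain ⟨r₁, hr₁, e₁⟩ := hSDw.norm_integral_le h0t hpX (η := η / 4) (by positivity)
    obtain ⟨r₂, hr₂, e₂⟩ := hSD.norm_integral_le h0t hpX (η := η / 4) (by positivity)
    have hN : X ∩ Metric.eball p (ENNReal.ofReal (min r₁ r₂)) ∈ 𝓝 p :=
      inter_mem (mem_interior_iff_mem_nhds.1 hX)
        (Metric.eball_mem_nhds p (ENNReal.ofReal_pos.2 (lt_min hr₁ hr₂)))
    have hN' := inter_mem hN (inter_mem hsrcN hballN)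
    filter_upwards [hτ.eventually e₁, hτ.eventually e₂, hτ0, hc, h₂, hU, hUeq, hUn _ hN',
      hζn _ hN'] with i e₁i e₂i hτi hci h₂i hUi hUeqi hUni hζni
    have hb : 0 ≤ t - τ i := ha.trans hτi.1
    have hr : ∀ x ∈ Metric.eball p (ENNReal.ofReal (min r₁ r₂)),
        edist x p ≤ ENNReal.ofReal r₁ ∧ edist x p ≤ ENNReal.ofReal r₂ := fun x hx =>
      ⟨(le_of_lt hx).trans (ENNReal.ofReal_le_ofReal (min_le_left _ _)),
        (le_of_lt hx).trans (ENNReal.ofReal_le_ofReal (min_le_right _ _))⟩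
    have hfin := hm.needle_displacement hw (η := η / 4) hb htS hτi.2 rfl hci h₂i
      (by rw [← hUeqi]; exact hUi.mono hτi.1 htS)
      (fun s hs => (hζni s hs).2) (fun s hs => (hUni s hs).2)
      (e₁i (ζ i) fun s hs => ⟨(hζni s (Ioc_subset_Icc_self hs)).1.1,
        (hr _ (hζni s (Ioc_subset_Icc_self hs)).1.2).1⟩)
      (e₂i (ζ i) fun s hs => ⟨(hζni s (Ioc_subset_Icc_self hs)).1.1,
        (hr _ (hζni s (Ioc_subset_Icc_self hs)).1.2).2⟩)
      (e₁i (U i) fun s hs => ⟨(hUni s (Ioc_subset_Icc_self hs)).1.1,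
        (hr _ (hUni s (Ioc_subset_Icc_self hs)).1.2).1⟩)
    refine hfin.trans (le_of_eq ?_)
    rw [Real.norm_of_nonneg hτi.2.le]
    ring
  have hcO : (fun i => c i • Δ) =O[l] τ := by
    refine Asymptotics.IsBigO.of_bound ‖Δ‖ ?_
    filter_upwards [hc, hτ0] with i hi hi'
    rw [norm_smul, Real.norm_of_nonneg hi.1, Real.norm_of_nonneg hi'.2.le, mul_comm]
    exact mul_le_mul_of_nonneg_left hi.2 (norm_nonneg _)
  have hdO : (fun i => ψ (ζ i t) - ψ (U i t)) =O[l] τ := by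
    have := hdisp.isBigO.add hcO
    simpa using this
  have htend : ∀ {x : ι → ℝ → M}, (∀ N ∈ 𝓝 p, ∀ᶠ i in l, ∀ s ∈ Icc (t - τ i) t, x i s ∈ N) →
      Tendsto (fun i => x i t) l (𝓝 p) := by
    intro x hx
    refine tendsto_iff_eventually.2 fun N hN => ?_
    filter_upwards [hx N hN, hτ0] with i h1 h2
    exact h1 t (right_mem_Icc.2 (by linarith [h2.2]))
  have hζt := htend hζn
  have hUt := htend hUn
  have hψc := continuousAt_extChartAt (I := 𝓡 n) p
  have hpair : Tendsto (fun i => (ψ (ζ i t), ψ (U i t))) l (𝓝 (ψ p, ψ p)) := by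
    rw [nhds_prod_eq]
    exact Tendsto.prodMk (hψc.tendsto.comp hζt) (hψc.tendsto.comp hUt)
  -- Both points `ζ i t` and `U i t` vary with `i`, so ordinary differentiability at `p` would not
  -- suffice.
  have hstrict := (hA.isLittleO.comp_tendsto hpair).trans_isBigO hdO
  have hAd : (fun i => A (ψ (ζ i t) - ψ (U i t) - c i • Δ)) =o[l] τ :=
    (A.isBigO_comp _ _).trans_isLittleO hdisp
  refine (hstrict.add hAd).congr' ?_ EventuallyEq.rfl
  filter_upwards [hζt.eventually hsrcN, hUt.eventually hsrcN, hU] with i h1 h2 h3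
  have h4 : flowMap (ctrlField f w) t S (U i t) = flowMap (ctrlField f w) a S (ζ i a) := by
    rw [h3.flowMap_eq hf hw ha (hat.le.trans htS) le_rfl,
      (h3.mono hat.le le_rfl).flowMap_eq hf hw h0t.le htS le_rfl]
  simp only [Function.comp_apply]
  rw [ψ.left_inv h1, ψ.left_inv h2, h4, map_sub A _ (c i • Δ), map_smul]
  abel

end NeedleStep

/-- Keeping `L_δ = L` and putting the whole error in `h_δ`, only a modulus has to be built. Let `e
δ` be the infimum of the admissible errors at scale `δ`. Since `0 ∈ F γ`, the zero map shows `e ≤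
‖L‖` at every scale, so the supremum of `e` over `(0, δ]` is finite, monotone and tends to zero. -/
theorem isQDQ_singleton_of_forall {E₁ E₂ : Type*} [NormedAddCommGroup E₁] [NormedSpace ℝ E₁]
    [NormedAddCommGroup E₂] [NormedSpace ℝ E₂] {F : E₁ → Set E₂} {L : E₁ →L[ℝ] E₂} {Γ : Set E₁}
    (h0 : ∀ γ, 0 ∈ F γ)
    (h : ∀ ε > 0, ∃ δ₀ > 0, ∀ δ : ℝ, 0 < δ → δ < δ₀ → ∃ x : E₁ → E₂,
      ContinuousOn x (Metric.closedBall 0 δ ∩ Γ) ∧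
      ∀ γ ∈ Metric.closedBall 0 δ ∩ Γ, x γ ∈ F γ ∧ ‖x γ - L γ‖ ≤ ε * δ) :
    IsQDQ F 0 0 {L} Γ := by
  refine ⟨isCompact_singleton, ?_⟩
  set G : ℝ≥0 → Set ℝ≥0 := fun δ => {ε | ∃ x : E₁ → E₂,
      ContinuousOn x (Metric.closedBall 0 (δ : ℝ) ∩ Γ) ∧
      ∀ γ ∈ Metric.closedBall 0 (δ : ℝ) ∩ Γ, x γ ∈ F γ ∧ ‖x γ - L γ‖ ≤ ε * δ} with hG
  have hL : ∀ δ, ‖L‖₊ ∈ G δ := fun δ => ⟨fun _ => 0, continuousOn_const, fun γ hγ => ⟨h0 γ, by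
    rw [zero_sub, norm_neg]
    exact (L.le_opNorm γ).trans (mul_le_mul_of_nonneg_left (mem_closedBall_zero_iff.1 hγ.1)
      (norm_nonneg _))⟩⟩
  set e : ℝ≥0 → ℝ≥0 := fun δ => sInf (G δ) with he
  have heL : ∀ δ, e δ ≤ ‖L‖₊ := fun δ => csInf_le (OrderBot.bddBelow _) (hL δ)
  have hbdd : ∀ δ, BddAbove (e '' Ioc 0 δ) := fun δ => ⟨‖L‖₊, by
    rintro _ ⟨δ', -, rfl⟩
    exact heL δ'⟩
  -- The summand `δ` makes `ρ δ` strictly larger than `e δ`, so that an admissible error below `ρ δ`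
  -- exists even if the infimum is not attained. At `0` the supremum is over the empty set, hence
  -- `0`.
  set ρ : ℝ≥0 → ℝ≥0 := fun δ => δ + sSup (e '' Ioc 0 δ) with hρ
  refine ⟨ρ, ⟨?_, ?_, ?_⟩, fun δ hδ => ?_⟩
  · intro δ₁ δ₂ hle
    refine add_le_add hle ?_
    rcases eq_or_ne δ₁ 0 with h1 | h1
    · simp [h1]
    · exact csSup_le_csSup (hbdd δ₂) ⟨e δ₁, δ₁, ⟨pos_iff_ne_zero.2 h1, le_rfl⟩, rfl⟩
        (image_mono (Ioc_subset_Ioc_right hle))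
  · simp [hρ]
  · refine tendsto_order.2 ⟨fun _ h => absurd h not_lt_zero, fun η hη => ?_⟩
    obtain ⟨δ₀, hδ₀, hδ⟩ := h ((η / 2 : ℝ≥0) : ℝ) (NNReal.coe_pos.2 (half_pos hη))
    filter_upwards [nhdsWithin_le_nhds (gt_mem_nhds (half_pos hη)),
      nhdsWithin_le_nhds (gt_mem_nhds (Real.toNNReal_pos.2 hδ₀))] with δ h1 h2
    have h3 : sSup (e '' Ioc 0 δ) ≤ η / 2 := by
      refine csSup_le' ?_
      rintro _ ⟨δ', hδ', rfl⟩
      exact csInf_le (OrderBot.bddBelow _) (hδ δ' (NNReal.coe_pos.2 hδ'.1)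
        (Real.lt_toNNReal_iff_coe_lt.1 (hδ'.2.trans_lt h2)))
    calc ρ δ < η / 2 + η / 2 := add_lt_add_of_lt_of_le h1 h3
      _ = η := add_halves η
  · have h1 : e δ < ρ δ :=
      (le_csSup (hbdd δ) ⟨δ, ⟨hδ, le_rfl⟩, rfl⟩).trans_lt (lt_add_of_pos_left _ hδ)
    obtain ⟨ε, ⟨x, hxc, hx⟩, hε⟩ := exists_lt_of_csInf_lt ⟨_, hL δ⟩ h1
    have hset : (fun v : E₁ => 0 + v) '' (Metric.closedBall 0 (δ : ℝ) ∩ Γ) =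
        Metric.closedBall 0 (δ : ℝ) ∩ Γ := by simp
    rw [hset]
    refine ⟨fun _ => L, fun γ => x γ - L γ,
      continuousOn_const.prodMk (hxc.sub L.continuous.continuousOn), fun γ hγ => ⟨⟨L, rfl, ?_⟩,
        ?_, ?_⟩⟩
    · simp
    · refine (hx γ hγ).2.trans ?_
      rw [mul_comm]
      exact mul_le_mul_of_nonneg_left (NNReal.coe_le_coe.2 hε.le) δ.2
    · simpa using (hx γ hγ).1

/-! ### Finitely generated cones as linear images of orthants. -/

section Cone

variable {E : Type*} [NormedAddCommGroup E] [NormedSpace ℝ E] {N : ℕ}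

/-- The cone of vectors with nonnegative coordinates. -/
def orthant (N : ℕ) : PointedCone ℝ (EuclideanSpace ℝ (Fin N)) where
  carrier := {γ | ∀ i, 0 ≤ γ i}
  add_mem' h₁ h₂ i := add_nonneg (h₁ i) (h₂ i)
  zero_mem' _ := le_rfl
  smul_mem' c _ h i := mul_nonneg c.2 (h i)

/-- The linear map that sends the canonical basis to the vectors `v i`. -/
def combination (v : Fin N → E) : EuclideanSpace ℝ (Fin N) →L[ℝ] E :=
  ∑ i, (EuclideanSpace.proj i : EuclideanSpace ℝ (Fin N) →L[ℝ] ℝ).smulRight (v i)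

theorem combination_apply (v : Fin N → E) (γ : EuclideanSpace ℝ (Fin N)) :
    combination v γ = ∑ i, γ i • v i := by
  simp [combination]

theorem hull_range_eq_image_orthant (v : Fin N → E) :
    (PointedCone.hull ℝ (range v) : Set E) = combination v '' (orthant N : Set _) := by
  apply Subset.antisymm
  · have h : PointedCone.hull ℝ (range v) ≤
        PointedCone.map (combination v : EuclideanSpace ℝ (Fin N) →ₗ[ℝ] E) (orthant N) := by
      refine Submodule.span_le.2 ?_
      rintro _ ⟨i, rfl⟩
      refine ⟨EuclideanSpace.single i 1, fun j => ?_, ?_⟩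
      · by_cases hj : j = i <;> simp [hj]
      · simp [combination_apply]
    exact h
  · rintro _ ⟨γ, hγ, rfl⟩
    rw [combination_apply]
    refine Submodule.sum_mem _ fun i _ => ?_
    exact Submodule.smul_mem (PointedCone.hull ℝ (range v)) (⟨γ i, hγ i⟩ : {c : ℝ // 0 ≤ c})
      (Submodule.subset_span (mem_range_self i))

end Cone

/-! ### Several needles. -/

section Variations

variable {n : ℕ} {M : Type*} [EMetricSpace M] [ChartedSpace (EuclideanSpace ℝ (Fin n)) M]
  [IsManifold (𝓡 n) 2 M] {𝔚 : Type*} [MetricSpace 𝔚] {S : ℝ}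
  {f : ℝ → (x : M) → 𝔚 → TangentSpace (𝓡 n) x} {w : ℝ → 𝔚} {x₀ : M} {y : ℝ → M}
  {N : ℕ} {𝔲 : Fin N → 𝔚} {t : Fin N → ℝ}

open Classical in
/-- The control that equals `𝔲 i` on `(t i - τ, t i]` and `w` elsewhere. -/
def needleCtrl (w : ℝ → 𝔚) (𝔲 : Fin N → 𝔚) (t : Fin N → ℝ) (τ : ℝ) (i : Fin N) : ℝ → 𝔚 :=
  (Ioc (t i - τ) (t i)).piecewise (fun _ => 𝔲 i) w

theorem isControl_needleCtrl (hw : IsControl S w) (τ : ℝ) (i : Fin N) :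
    IsControl S (needleCtrl w 𝔲 t τ i) := by
  classical
  obtain ⟨hm, 𝔲₀, hi⟩ := hw
  refine ⟨AEStronglyMeasurable.piecewise measurableSet_Ioc aestronglyMeasurable_const
    hm.restrict, 𝔲₀, ?_⟩
  refine lt_of_le_of_lt (lintegral_mono (g := fun s => edist (w s) 𝔲₀ + edist (𝔲 i) 𝔲₀) fun s => ?_)
    ?_
  · by_cases hs : s ∈ Ioc (t i - τ) (t i)
    · rw [needleCtrl, piecewise_eq_of_mem _ _ _ hs]
      exact le_add_self
    · rw [needleCtrl, piecewise_eq_of_notMem _ _ _ hs]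
      exact le_self_add
  · rw [lintegral_add_right _ measurable_const, ENNReal.add_lt_top]
    refine ⟨hi, ?_⟩
    rw [setLIntegral_const]
    exact ENNReal.mul_lt_top (edist_lt_top _ _) (by simp)

theorem relaxedField_needleCtrl_of_notMem {γ : Fin N → ℝ} {τ s : ℝ} (x : M)
    (hs : ∀ i, s ∉ Ioc (t i - τ) (t i)) :
    relaxedField f γ w (needleCtrl w 𝔲 t τ) s x = ctrlField f w s x := by
  have h : ∀ i, needleCtrl w 𝔲 t τ i s = w s := fun i => piecewise_eq_of_notMem _ _ _ (hs i)
  simp [relaxedField, ctrlField, h]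

theorem relaxedField_needleCtrl_of_mem {γ : Fin N → ℝ} {τ s : ℝ} (x : M) {i : Fin N}
    (hi : s ∈ Ioc (t i - τ) (t i)) (hs : ∀ j, j ≠ i → s ∉ Ioc (t j - τ) (t j)) :
    relaxedField f γ w (needleCtrl w 𝔲 t τ) s x = needleField f w (𝔲 i) (γ i) s x := by
  have h : ∀ j, j ≠ i → needleCtrl w 𝔲 t τ j s = w s := fun j hj =>
    piecewise_eq_of_notMem _ _ _ (hs j hj)
  have h' : needleCtrl w 𝔲 t τ i s = 𝔲 i := piecewise_eq_of_mem _ _ _ hi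
  rw [relaxedField, needleField, Finset.sum_eq_single i (fun j _ hj => by simp [h j hj])
    (fun h => absurd (Finset.mem_univ i) h), h']

/-- First-order expansion of the end-point of multiple needle variations. -/
theorem needle_expansion (hf : ∀ p, ∃ R k G, IsLocalModel S f p R k G) (hw : IsControl S w)
    (hS : 0 ≤ S) (hy : IsTrajectory (ctrlField f w) 0 S x₀ y) (ht : StrictMono t)
    (ht0 : ∀ i, 0 < t i) (htS : ∀ i, t i ≤ S) {X : Set M} (hX : ∀ i, y (t i) ∈ interior X)
    (hSDw : ∀ i, IsScorzaDragoniPt 0 S X (ctrlField f w) (t i))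
    (hSD : ∀ i, IsScorzaDragoniPt 0 S X (fun s x => f s x (𝔲 i)) (t i))
    {A : Fin N → EuclideanSpace ℝ (Fin n) →L[ℝ] EuclideanSpace ℝ (Fin n)}
    (hA : ∀ i, HasStrictFDerivAt (fun u => extChartAt (𝓡 n) (y S)
      (flowMap (ctrlField f w) (t i) S ((extChartAt (𝓡 n) (y (t i))).symm u))) (A i)
      (extChartAt (𝓡 n) (y (t i)) (y (t i))))
    {ι : Type*} {l : Filter ι} {τ : ι → ℝ} {γ : ι → Fin N → ℝ} {ζ : ι → ℝ → M}
    (hτ : Tendsto τ l (𝓝[>] 0)) (hγ : ∀ᶠ i in l, ∀ j, γ i j ∈ Icc 0 (τ i))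
    (hζ : ∀ᶠ i in l, IsTrajectory (relaxedField f (fun j => γ i j / τ i) w
      (needleCtrl w 𝔲 t (τ i))) 0 S x₀ (ζ i)) :
    (∀ ε : ℝ≥0∞, 0 < ε → ∀ᶠ i in l, ∀ s ∈ Icc 0 S, edist (ζ i s) (y s) < ε) ∧
      (fun i => extChartAt (𝓡 n) (y S) (ζ i S) - extChartAt (𝓡 n) (y S) (y S) -
        ∑ j, γ i j • A j (f (t j) (y (t j)) (𝔲 j) - f (t j) (y (t j)) (w (t j)))) =o[l] τ := by
  set ψ := extChartAt (𝓡 n) (y S) with hψ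
  set v : Fin N → EuclideanSpace ℝ (Fin n) := fun j =>
    A j (f (t j) (y (t j)) (𝔲 j) - f (t j) (y (t j)) (w (t j))) with hv
  -- Induction on the number `m` of needles already passed: `a` is the time of the last one, or `0`.
  -- The expansion concerns the point reached at time `S` when the reference flow is followed from
  -- `a` on.
  have key : ∀ m ≤ N, ∃ a, 0 ≤ a ∧ a ≤ S ∧ (∀ j : Fin N, j.val < m → t j ≤ a) ∧
      (∀ j : Fin N, m ≤ j.val → a < t j) ∧
      (∀ ε : ℝ≥0∞, 0 < ε → ∀ᶠ i in l, ∀ s ∈ Icc 0 a, edist (ζ i s) (y s) < ε) ∧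
      (fun i => ψ (flowMap (ctrlField f w) a S (ζ i a)) - ψ (y S) -
        ∑ j, if j.val < m then γ i j • v j else 0) =o[l] τ := by
    intro m
    induction m with
    | zero =>
      intro _
      have h0 : ∀ᶠ i in l, ζ i 0 = y 0 := hζ.mono fun i hi => hi.1.trans hy.1.symm
      refine ⟨0, le_rfl, hS, fun j hj => absurd hj (Nat.not_lt_zero _), fun j _ => ht0 j,
        fun ε hε => ?_, ?_⟩
      · filter_upwards [h0] with i hi s hs
        rw [le_antisymm hs.2 hs.1, hi, edist_self]
        exact hε
      · refine (Asymptotics.isLittleO_zero τ l).congr' ?_ EventuallyEq.rfl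
        filter_upwards [h0] with i hi
        rw [hi, hy.1, hy.flowMap_eq hf hw le_rfl hS le_rfl]
        simp
    | succ m ih =>
      intro hm
      obtain ⟨a, ha, haS, hlt, hge, hc, ho⟩ := ih (Nat.le_of_succ_le hm)
      set q : Fin N := ⟨m, hm⟩ with hq
      have haq : a < t q := hge q le_rfl
      have hζa : Tendsto (fun i => ζ i a) l (𝓝 (y a)) := by
        refine EMetric.tendsto_nhds.2 fun ε hε => ?_
        filter_upwards [hc ε hε] with i hi
        exact hi a (right_mem_Icc.2 ha)
      have hle : ∀ᶠ i in l, a ≤ t q - τ i ∧ 0 < τ i :=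
        (eventually_forall_Icc_sub hτ haq (P := fun _ => True) (by simp)).mono
          fun i h => ⟨h.1, h.2.1⟩
      -- For small `τ` the windows of later needles start after `t q`, so windows do not overlap.
      have hgap : ∀ᶠ i in l, ∀ j, q < j → t q ≤ t j - τ i := by
        refine eventually_all.2 fun j => ?_
        by_cases hj : q < j
        · exact (eventually_forall_Icc_sub hτ (ht hj) (P := fun _ => True) (by simp)).mono
            fun i h _ => h.1
        · exact Eventually.of_forall fun i h => absurd h hj
      have h₁ : ∀ᶠ i in l, IsTrajectory (ctrlField f w) a (t q - τ i) (ζ i a) (ζ i) := by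
        filter_upwards [hζ, hle] with i hi hlei
        refine (hi.mono ha (by linarith [htS q])).congr_field fun s hs => ?_
        refine (relaxedField_needleCtrl_of_notMem _ fun j hj => ?_).symm
        rcases lt_or_ge j.val m with h | h
        · linarith [hlt j h, hj.2, hs.1]
        · have : t q ≤ t j := ht.monotone h
          linarith [hj.1, hs.2]
      have h₂ : ∀ᶠ i in l, IsTrajectory (needleField f w (𝔲 q) (γ i q / τ i)) (t q - τ i) (t q)
          (ζ i (t q - τ i)) (ζ i) := by
        filter_upwards [hζ, hle, hgap] with i hi hlei hgapi
        refine (hi.mono (ha.trans hlei.1) (htS q)).congr_field fun s hs => ?_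
        refine (relaxedField_needleCtrl_of_mem (f := f) (w := w) (𝔲 := 𝔲) (t := t)
          (γ := fun j => γ i j / τ i) (ζ i s) hs fun j hjq hj => ?_).symm
        rcases lt_or_gt_of_ne hjq with h | h
        · have := hlt j h
          linarith [hj.2, hs.1, hlei.1]
        · linarith [hgapi j h, hj.1, hs.2]
      obtain ⟨hc', ho'⟩ := needle_step hf hw hy ha haq (htS q) (hX q) (hSDw q) (hSD q) (hA q) hτ
        (c := fun i => γ i q) (hγ.mono fun i hi => hi q) h₁ h₂ hζa
      refine ⟨t q, (ht0 q).le, htS q, fun j hj => ht.monotone (Nat.lt_succ_iff.1 hj),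
        fun j hj => ht (Nat.lt_of_succ_le hj), fun ε hε => ?_, ?_⟩
      · filter_upwards [hc ε hε, hc' ε hε] with i h1 h2 s hs
        rcases le_total s a with h | h
        · exact h1 s ⟨hs.1, h⟩
        · exact h2 s ⟨h, hs.2⟩
      · refine (ho'.add ho).congr_left fun i => ?_
        have hsum : (∑ j : Fin N, if j.val < m + 1 then γ i j • v j else 0) =
            (∑ j : Fin N, if j.val < m then γ i j • v j else 0) + γ i q • v q := by
          have hsplit : ∀ j : Fin N, (if j.val < m + 1 then γ i j • v j else 0) =
              (if j.val < m then γ i j • v j else 0) + if j = q then γ i j • v j else 0 := by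
            intro j
            rcases lt_trichotomy j.val m with h | h | h
            · have hne : j ≠ q := fun e => h.ne (congrArg Fin.val e)
              rw [if_pos (Nat.lt_succ_of_lt h), if_pos h, if_neg hne, add_zero]
            · have he : j = q := Fin.ext h
              rw [if_pos (h ▸ Nat.lt_succ_self _), if_neg h.not_lt, if_pos he, zero_add]
            · have hne : j ≠ q := fun e => h.ne' (congrArg Fin.val e)
              rw [if_neg (by omega), if_neg h.not_gt, if_neg hne, add_zero]
          rw [Finset.sum_congr rfl fun j _ => hsplit j, Finset.sum_add_distrib,
            Finset.sum_ite_eq' Finset.univ q, if_pos (Finset.mem_univ q)]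
        rw [hsum]
        simp only [hv]
        abel
  obtain ⟨a, ha, haS, hlt, -, hc, ho⟩ := key N le_rfl
  have hζt : ∀ᶠ i in l, IsTrajectory (ctrlField f w) a S (ζ i a) (ζ i) := by
    filter_upwards [hζ] with i hi
    refine (hi.mono ha le_rfl).congr_field fun s hs => ?_
    refine (relaxedField_needleCtrl_of_notMem _ fun j hj => ?_).symm
    linarith [hlt j j.2, hj.2, hs.1]
  have hζa : Tendsto (fun i => ζ i a) l (𝓝 (y a)) := by
    refine EMetric.tendsto_nhds.2 fun ε hε => ?_
    filter_upwards [hc ε hε] with i hi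
    exact hi a (right_mem_Icc.2 ha)
  refine ⟨fun ε hε => ?_, ?_⟩
  · filter_upwards [hc ε hε, hζt, hζa.eventually ((hy.flowsNear hf hw ha haS le_rfl).near ε hε)]
      with i h1 h2 h3 s hs
    rcases le_total s a with h | h
    · exact h1 s ⟨hs.1, h⟩
    · obtain ⟨z, hz, hzy⟩ := h3
      rw [h2.eqOn hf hw ha haS le_rfl hz ⟨h, hs.2⟩]
      exact hzy s ⟨h, hs.2⟩
  · refine ho.congr' ?_ EventuallyEq.rfl
    filter_upwards [hζt] with i hi
    rw [hi.flowMap_eq hf hw ha haS le_rfl]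
    simp [hv]

end Variations

/-! ### Uniform bounds and continuity of end-points. -/

section Abundance

variable {n : ℕ} {M : Type*} [EMetricSpace M] [ChartedSpace (EuclideanSpace ℝ (Fin n)) M]
  [IsManifold (𝓡 n) 2 M] {𝔚 : Type*} [MetricSpace 𝔚] {S : ℝ}
  {f : ℝ → (x : M) → 𝔚 → TangentSpace (𝓡 n) x} {w : ℝ → 𝔚} {x₀ : M} {y : ℝ → M} {a b : ℝ}

/-- Identifies the strict derivative in charts with the intrinsic differential that defines the
variational cone. -/
theorem FlowsNear.hasStrictFDerivAt_flowDiff (hf : ∀ p, ∃ R k G, IsLocalModel S f p R k G)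
    (hw : IsControl S w) (ha : 0 ≤ a) (hab : a ≤ b) (hb : b ≤ S)
    (hyt : IsTrajectory (ctrlField f w) a b x₀ y) (h : FlowsNear (ctrlField f w) y a b) :
    HasStrictFDerivAt (fun u => extChartAt (𝓡 n) (y b)
      (flowMap (ctrlField f w) a b ((extChartAt (𝓡 n) (y a)).symm u)))
      (flowDiff (ctrlField f w) a b (y a) :
        EuclideanSpace ℝ (Fin n) →L[ℝ] EuclideanSpace ℝ (Fin n))
      (extChartAt (𝓡 n) (y a) (y a)) := by
  obtain ⟨A, hA⟩ := h.diff
  have hval : flowMap (ctrlField f w) a b (y a) = y b :=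
    (hyt.mono le_rfl le_rfl).flowMap_eq hf hw ha hab hb
  have hm : HasMFDerivAt (𝓡 n) (𝓡 n) (flowMap (ctrlField f w) a b) (y a) A := by
    refine ⟨?_, ?_⟩
    · refine tendsto_iff_eventually.2 fun N hN => ?_
      rw [hval] at hN
      exact h.eventually_flowMap hf hw ha hab hb hN
    · rw [writtenInExtChartAt, hval]
      exact hA.hasFDerivAt.hasFDerivWithinAt
  have : flowDiff (ctrlField f w) a b (y a) = A := hm.mfderiv
  rw [this]
  exact hA

/-- The chart is uniformly continuous on a compact neighbourhood of `z`. The radius `ρ` does not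
depend on `ε`, so it can be fixed before the scale of the variations. -/
theorem exists_uniform_chart (z : M) : ∃ ρ : ℝ≥0∞, 0 < ρ ∧ ∀ ε > 0, ∃ δ > 0, ∀ x x' : M,
    edist x z < ρ → edist x x' < ENNReal.ofReal δ → x' ∈ (extChartAt (𝓡 n) z).source ∧
      ‖extChartAt (𝓡 n) z x' - extChartAt (𝓡 n) z x‖ ≤ ε := by
  set ψ := extChartAt (𝓡 n) z
  obtain ⟨R, hR, hRt⟩ := Metric.nhds_basis_closedBall.mem_iff.1
    (extChartAt_target_mem_nhds (I := 𝓡 n) z)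
  set K : Set M := ψ.symm '' Metric.closedBall (ψ z) R with hK
  have hKc : IsCompact K := (isCompact_closedBall (ψ z) R).image_of_continuousOn
    ((continuousOn_extChartAt_symm (I := 𝓡 n) z).mono hRt)
  have hKs : K ⊆ ψ.source := by
    rintro _ ⟨u, hu, rfl⟩
    exact ψ.map_target (hRt hu)
  have hKn : K ∈ 𝓝 z := by
    filter_upwards [extChartAt_source_mem_nhds (I := 𝓡 n) z,
      (continuousAt_extChartAt (I := 𝓡 n) z).preimage_mem_nhds (Metric.closedBall_mem_nhds _ hR)]
      with x h1 h2
    exact ⟨ψ x, h2, ψ.left_inv h1⟩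
  obtain ⟨ρ, hρ, hρK⟩ := EMetric.mem_nhds_iff.1 hKn
  have huc := hKc.uniformContinuousOn_of_continuous
    ((continuousOn_extChartAt (I := 𝓡 n) z).mono hKs)
  have hρ2 : 0 < ρ / 2 := ENNReal.half_pos hρ.ne'
  refine ⟨ρ / 2, hρ2, fun ε hε => ?_⟩
  obtain ⟨η, hη, hu⟩ := EMetric.uniformContinuousOn_iff.1 huc (ENNReal.ofReal ε)
    (ENNReal.ofReal_pos.2 hε)
  obtain ⟨δ, hδ, hδη⟩ : ∃ δ : ℝ, 0 < δ ∧ ENNReal.ofReal δ ≤ min η (ρ / 2) := by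
    have hpos : 0 < min η (ρ / 2) := lt_min hη hρ2
    rcases eq_or_ne (min η (ρ / 2)) ⊤ with h | h
    · exact ⟨1, one_pos, h ▸ le_top⟩
    · exact ⟨(min η (ρ / 2)).toReal, ENNReal.toReal_pos hpos.ne' h, ENNReal.ofReal_toReal_le⟩
  refine ⟨δ, hδ, fun x x' hx hxx' => ?_⟩
  have hx' : x' ∈ K := by
    refine hρK ?_
    calc edist x' z ≤ edist x x' + edist x z := edist_triangle_left _ _ _
      _ < ρ / 2 + ρ / 2 := ENNReal.add_lt_add
          (hxx'.trans_le (hδη.trans (min_le_right _ _))) hx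
      _ = ρ := ENNReal.add_halves ρ
  have hxK : x ∈ K := hρK (hx.trans_le ENNReal.half_le_self)
  have h1 := hu hx' hxK (by
    rw [edist_comm]
    exact hxx'.trans_le (hδη.trans (min_le_left _ _)))
  refine ⟨hKs hx', ?_⟩
  rw [edist_dist, dist_eq_norm, ENNReal.ofReal_lt_ofReal_iff hε] at h1
  exact h1.le

/-- The end-point depends continuously on the parameter when the control depends continuously on
it for the pseudo-distance of trajectories. -/
theorem continuousOn_endpoint (hf : ∀ p, ∃ R k G, IsLocalModel S f p R k G) (hS : 0 ≤ S)
    {P : Type*} [PseudoMetricSpace P] {D : Set P} {θ : P → ℝ → 𝔚}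
    (hθ : ∀ γ ∈ D, IsControl S (θ γ))
    (hc : ∀ γ₀ ∈ D, ∀ ε : ℝ, 0 < ε → ∃ η : ℝ, 0 < η ∧
      ∀ γ ∈ D, dist γ γ₀ < η → CtrlDistLT f S x₀ (θ γ) (θ γ₀) ε) :
    ContinuousOn (fun γ => flowMap (ctrlField f (θ γ)) 0 S x₀) D := by
  intro γ₀ hγ₀
  refine EMetric.tendsto_nhds.2 fun ε hε => ?_
  obtain ⟨ε', hε', hle⟩ : ∃ ε' : ℝ, 0 < ε' ∧ ENNReal.ofReal ε' ≤ ε := by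
    rcases eq_or_ne ε ⊤ with h | h
    · exact ⟨1, one_pos, h ▸ le_top⟩
    · exact ⟨ε.toReal, ENNReal.toReal_pos hε.ne' h, ENNReal.ofReal_toReal_le⟩
  obtain ⟨η, hη, h⟩ := hc γ₀ hγ₀ ε' hε'
  filter_upwards [self_mem_nhdsWithin, nhdsWithin_le_nhds (Metric.ball_mem_nhds γ₀ hη)]
    with γ hγ hd
  obtain ⟨y₁, y₂, h₁, h₂, h₁₂⟩ := h γ hγ hd
  rw [h₁.flowMap_eq hf (hθ γ hγ) le_rfl hS le_rfl, h₂.flowMap_eq hf (hθ γ₀ hγ₀) le_rfl hS le_rfl]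
  exact (h₁₂ S (right_mem_Icc.2 hS)).trans_le hle

/-- Uniformly small relaxed variations have uniformly small errors in the first-order expansion. -/
theorem exists_needle_expansion_bound {N : ℕ} {𝔲 : Fin N → 𝔚} {t : Fin N → ℝ} (hN : 0 < N)
    (hf : ∀ p, ∃ R k G, IsLocalModel S f p R k G) (hw : IsControl S w)
    (hS : 0 ≤ S) (hy : IsTrajectory (ctrlField f w) 0 S x₀ y) (ht : StrictMono t)
    (ht0 : ∀ i, 0 < t i) (htS : ∀ i, t i ≤ S) {X : Set M} (hX : ∀ i, y (t i) ∈ interior X)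
    (hSDw : ∀ i, IsScorzaDragoniPt 0 S X (ctrlField f w) (t i))
    (hSD : ∀ i, IsScorzaDragoniPt 0 S X (fun s x => f s x (𝔲 i)) (t i))
    {A : Fin N → EuclideanSpace ℝ (Fin n) →L[ℝ] EuclideanSpace ℝ (Fin n)}
    (hA : ∀ i, HasStrictFDerivAt (fun u => extChartAt (𝓡 n) (y S)
      (flowMap (ctrlField f w) (t i) S ((extChartAt (𝓡 n) (y (t i))).symm u))) (A i)
      (extChartAt (𝓡 n) (y (t i)) (y (t i)))) {ε : ℝ} (hε : 0 < ε) {ε' : ℝ≥0∞} (hε' : 0 < ε') :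
    ∃ δ₀ > 0, ∀ δ : ℝ, 0 < δ → δ < δ₀ → ∀ γ : EuclideanSpace ℝ (Fin N),
      (∀ j, 0 ≤ γ j) → ‖γ‖ ≤ δ → ∀ ζ : ℝ → M,
      IsTrajectory (relaxedField f (fun j => γ j / (N * δ)) w (needleCtrl w 𝔲 t (N * δ))) 0 S
        x₀ ζ →
      (∀ s ∈ Icc 0 S, edist (ζ s) (y s) < ε') ∧
      ‖extChartAt (𝓡 n) (y S) (ζ S) - extChartAt (𝓡 n) (y S) (y S) -
        combination (fun j => A j (f (t j) (y (t j)) (𝔲 j) - f (t j) (y (t j)) (w (t j)))) γ‖ ≤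
        ε * δ := by
  have hN' : (0 : ℝ) < N := Nat.cast_pos.2 hN
  set B : Set (ℝ × EuclideanSpace ℝ (Fin N) × (ℝ → M)) := {ω | (∀ j, 0 ≤ ω.2.1 j) ∧
    ‖ω.2.1‖ ≤ ω.1 ∧ IsTrajectory (relaxedField f (fun j => ω.2.1 j / (N * ω.1)) w
      (needleCtrl w 𝔲 t (N * ω.1))) 0 S x₀ ω.2.2} with hB
  -- The filter lets `δ → 0⁺` while `γ` and the trajectory are arbitrary among the admissible ones,
  -- so a little-o along it is a bound uniform in both.
  set l : Filter (ℝ × EuclideanSpace ℝ (Fin N) × (ℝ → M)) :=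
    comap Prod.fst (𝓝[>] (0 : ℝ)) ⊓ 𝓟 B with hl
  have hmem : ∀ᶠ ω in l, ω ∈ B := mem_inf_of_right (mem_principal_self B)
  have hfst : Tendsto (fun ω : ℝ × EuclideanSpace ℝ (Fin N) × (ℝ → M) => ω.1) l (𝓝[>] 0) :=
    tendsto_comap.mono_left inf_le_left
  have hτ : Tendsto (fun ω : ℝ × EuclideanSpace ℝ (Fin N) × (ℝ → M) => (N : ℝ) * ω.1) l
      (𝓝[>] 0) := by
    refine tendsto_nhdsWithin_iff.2 ⟨?_, ?_⟩
    · have := (tendsto_nhdsWithin_iff.1 hfst).1.const_mul (N : ℝ)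
      rwa [mul_zero] at this
    · filter_upwards [(tendsto_nhdsWithin_iff.1 hfst).2] with ω hω
      exact mul_pos hN' hω
  obtain ⟨h₁, h₂⟩ := needle_expansion (𝔲 := 𝔲) hf hw hS hy ht ht0 htS hX hSDw hSD hA
    (l := l) (τ := fun ω => N * ω.1) (γ := fun ω j => ω.2.1 j) (ζ := fun ω => ω.2.2) hτ
    (by
      filter_upwards [hmem, (tendsto_nhdsWithin_iff.1 hfst).2] with ω hω hpos j
      have h1 : ω.2.1 j ≤ ω.1 :=
        ((le_abs_self _).trans (PiLp.norm_apply_le ω.2.1 j)).trans hω.2.1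
      have h2 : (1 : ℝ) ≤ N := by exact_mod_cast hN
      have h3 : 0 < ω.1 := hpos
      exact ⟨hω.1 j, by nlinarith⟩)
    (hmem.mono fun ω hω => hω.2.2)
  -- The division by `N` compensates for the window width `N δ`.
  have h₃ := h₂.def (c := ε / N) (by positivity)
  have h₄ := (h₁ ε' hε').and h₃
  rw [hl, eventually_inf_principal, eventually_comap] at h₄
  obtain ⟨δ₀, hδ₀, h₅⟩ := mem_nhdsGT_iff_exists_Ioo_subset.1 h₄
  refine ⟨δ₀, hδ₀, fun δ hδ hδδ γ hγ hγδ ζ hζ => ?_⟩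
  obtain ⟨h₆, h₇⟩ := h₅ ⟨hδ, hδδ⟩ (δ, γ, ζ) rfl ⟨hγ, hγδ, hζ⟩
  refine ⟨h₆, ?_⟩
  rw [combination_apply]
  refine h₇.trans (le_of_eq ?_)
  rw [Real.norm_of_nonneg (by positivity)]
  field_simp

end Abundance

end QDQGap

end

/-! ### The approximating cone. -/

theorem mainTheorem4 {n : ℕ} {M : Type*} [EMetricSpace M]
    [ChartedSpace (EuclideanSpace ℝ (Fin n)) M] [IsManifold (𝓡 n) 2 M]
    [RiemannianBundle (fun x : M => TangentSpace (𝓡 n) x)]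
    [IsContinuousRiemannianBundle (EuclideanSpace ℝ (Fin n)) (fun x : M => TangentSpace (𝓡 n) x)]
    [IsRiemannianManifold (𝓡 n) M]
    {𝔚 : Type*} [MetricSpace 𝔚]
    (S : ℝ) (hS : 0 < S)
    (f : ℝ → (x : M) → 𝔚 → TangentSpace (𝓡 n) x) (hf : QDQGap.StandingHyp S f)
    (x₀ : M)
    (V : Set (ℝ → 𝔚)) (hV : ∀ v ∈ V, QDQGap.IsControl S v)
    (habundant : QDQGap.IsAbundant f S x₀ V)
    (T : Set M) (hT : IsClosed T)
    (yh : ℝ → M) (wh : ℝ → 𝔚) (hfeasible : QDQGap.IsFeasibleProcess f S x₀ T yh wh)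
    (X : Set M) (hX : IsCompact X) (hyX : ∀ s ∈ Icc 0 S, yh s ∈ interior X)
    (N : ℕ) (hN : 0 < N) (𝔲 : Fin N → 𝔚) (t : Fin N → ℝ)
    (ht : StrictMono t) (ht0 : ∀ i, 0 < t i) (htS : ∀ i, t i ≤ S)
    (hSDhat : ∀ i, QDQGap.IsScorzaDragoniPt 0 S X (QDQGap.ctrlField f wh) (t i))
    (hSD : ∀ i j, QDQGap.IsScorzaDragoniPt 0 S X (fun s x => f s x (𝔲 j)) (t i))
    (r : ℝ) (hr : 0 < r) :
    QDQGap.IsQDQApproxCone (QDQGap.localReach f S x₀ V wh r ∪ {yh S}) (yh S)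
      (QDQGap.extVarCone f S yh wh 𝔲 t : Set (TangentSpace (𝓡 n) (yh S))) := by
  open QDQGap in
  have hm : ∀ p, ∃ R k G, IsLocalModel S f p R k G := fun p => hf.exists_localModel p
  obtain ⟨hw, hy, -⟩ := hfeasible
  set A : Fin N → EuclideanSpace ℝ (Fin n) →L[ℝ] EuclideanSpace ℝ (Fin n) := fun i =>
    flowDiff (ctrlField f wh) (t i) S (yh (t i)) with hAdef
  have hA : ∀ i, HasStrictFDerivAt (fun u => extChartAt (𝓡 n) (yh S)
      (flowMap (ctrlField f wh) (t i) S ((extChartAt (𝓡 n) (yh (t i))).symm u))) (A i)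
      (extChartAt (𝓡 n) (yh (t i)) (yh (t i))) := fun i =>
    (hy.flowsNear hm hw (ht0 i).le (htS i) le_rfl).hasStrictFDerivAt_flowDiff hm hw (ht0 i).le
      (htS i) le_rfl (hy.mono (ht0 i).le le_rfl)
  set v : Fin N → EuclideanSpace ℝ (Fin n) := fun i =>
    A i (f (t i) (yh (t i)) (𝔲 i) - f (t i) (yh (t i)) (wh (t i))) with hv
  -- The set-valued map is constant. The added point `yh S` provides the value `0` in the chart that
  -- serves at large scales.
  refine ⟨Or.inr rfl, N, fun _ => localReach f S x₀ V wh r ∪ {yh S}, orthant N,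
    combination v, ?_, fun _ _ => Subset.rfl, hull_range_eq_image_orthant v⟩
  refine isQDQ_singleton_of_forall (fun γ => ⟨yh S, ⟨Or.inr rfl, mem_extChartAt_source (yh S)⟩,
    sub_self _⟩) fun ε hε => ?_
  obtain ⟨ρ, hρ, hchart⟩ := exists_uniform_chart (n := n) (yh S)
  have hr2 : 0 < ENNReal.ofReal (r / 2) := ENNReal.ofReal_pos.2 (half_pos hr)
  obtain ⟨δ₀, hδ₀, hexp⟩ := exists_needle_expansion_bound (𝔲 := 𝔲) hN hm hw hS.le hy ht ht0 htS
    (fun i => hyX _ ⟨(ht0 i).le, htS i⟩) hSDhat (fun i => hSD i i) hA (half_pos hε)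
    (lt_min hρ hr2)
  refine ⟨δ₀, hδ₀, fun δ hδ hδδ => ?_⟩
  -- The tolerance for abundance depends on `δ`: it keeps the chart error below `ε δ / 2`. The bound
  -- `r / 2` leaves the other half of `r` to the relaxed trajectory.
  obtain ⟨η, hη, hη'⟩ := hchart (ε / 2 * δ) (by positivity)
  obtain ⟨θ, hθV, hθc, hθ⟩ := habundant N hN wh (needleCtrl wh 𝔲 t (N * δ)) hw
    (fun i => isControl_needleCtrl hw _ i) (min η (r / 2)) (lt_min hη (half_pos hr))
  have hN' : (0 : ℝ) < N := Nat.cast_pos.2 hN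
  -- Each coordinate of `γ` is at most `δ`, so division by `N δ` brings the sum of the coefficients
  -- below `1`.
  set sc : EuclideanSpace ℝ (Fin N) → Fin N → ℝ := fun γ i => γ i / (N * δ) with hsc
  have hscc : Continuous sc := by
    refine continuous_pi fun i => ?_
    exact (EuclideanSpace.proj i : EuclideanSpace ℝ (Fin N) →L[ℝ] ℝ).continuous.div_const _
  have hsc_mem : ∀ γ ∈ Metric.closedBall 0 δ ∩ (orthant N : Set _), sc γ ∈ simplexHull N := by
    intro γ hγ
    refine ⟨fun i => div_nonneg (hγ.2 i) (by positivity), ?_⟩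
    rw [hsc, ← Finset.sum_div]
    refine div_le_one_of_le₀ ?_ (by positivity)
    refine (Finset.sum_le_card_nsmul Finset.univ (fun i => γ i) δ fun i _ => ?_).trans ?_
    · exact ((le_abs_self _).trans (PiLp.norm_apply_le γ i)).trans (mem_closedBall_zero_iff.1 hγ.1)
    · simp
  set e : EuclideanSpace ℝ (Fin N) → M := fun γ => flowMap (ctrlField f (θ (sc γ))) 0 S x₀ with he
  have hec : ContinuousOn e (Metric.closedBall 0 δ ∩ (orthant N : Set _)) :=
    (continuousOn_endpoint hm hS.le (fun γ hγ => hV _ (hθV γ hγ)) hθc).comp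
      hscc.continuousOn hsc_mem
  have hmain : ∀ γ ∈ Metric.closedBall 0 δ ∩ (orthant N : Set _),
      e γ ∈ localReach f S x₀ V wh r ∧ e γ ∈ (extChartAt (𝓡 n) (yh S)).source ∧
      ‖extChartAt (𝓡 n) (yh S) (e γ) - extChartAt (𝓡 n) (yh S) (yh S) - combination v γ‖ ≤
        ε * δ := by
    intro γ hγ
    obtain ⟨y, z, hy', hz, hyz⟩ := hθ (sc γ) (hsc_mem γ hγ)
    have hθV' := hθV _ (hsc_mem γ hγ)
    obtain ⟨h₁, h₂⟩ := hexp δ hδ hδδ γ hγ.2 (mem_closedBall_zero_iff.1 hγ.1) y hy'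
    have hez : e γ = z S := hz.flowMap_eq hm (hV _ hθV') le_rfl hS.le le_rfl
    have hSm : S ∈ Icc 0 S := right_mem_Icc.2 hS.le
    obtain ⟨h₃, h₄⟩ := hη' (y S) (z S) ((h₁ S hSm).trans_le (min_le_left _ _))
      ((hyz S hSm).trans_le (ENNReal.ofReal_le_ofReal (min_le_left _ _)))
    rw [hez]
    refine ⟨⟨θ (sc γ), hθV', ⟨yh, z, hy, hz, fun s hs => ?_⟩, z, hz, rfl⟩, h₃, ?_⟩
    · calc edist (yh s) (z s) ≤ edist (y s) (yh s) + edist (y s) (z s) := edist_triangle_left _ _ _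
        _ < ENNReal.ofReal (r / 2) + ENNReal.ofReal (r / 2) := ENNReal.add_lt_add
            ((h₁ s hs).trans_le (min_le_right _ _))
            ((hyz s hs).trans_le (ENNReal.ofReal_le_ofReal (min_le_right _ _)))
        _ = ENNReal.ofReal r := by
            rw [← ENNReal.ofReal_add (half_pos hr).le (half_pos hr).le, add_halves]
    · have halg : extChartAt (𝓡 n) (yh S) (z S) - extChartAt (𝓡 n) (yh S) (yh S) -
          combination v γ = (extChartAt (𝓡 n) (yh S) (z S) - extChartAt (𝓡 n) (yh S) (y S)) +
          (extChartAt (𝓡 n) (yh S) (y S) - extChartAt (𝓡 n) (yh S) (yh S) - combination v γ) := by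
        abel
      rw [halg]
      refine (norm_add_le _ _).trans ((add_le_add h₄ h₂).trans (le_of_eq ?_))
      ring
  refine ⟨fun γ => extChartAt (𝓡 n) (yh S) (e γ) - extChartAt (𝓡 n) (yh S) (yh S),
    ((continuousOn_extChartAt (I := 𝓡 n) (yh S)).comp hec fun γ hγ => (hmain γ hγ).2.1).sub
      continuousOn_const, fun γ hγ => ?_⟩
  obtain ⟨h₁, h₂, h₃⟩ := hmain γ hγ
  exact ⟨⟨e γ, ⟨Or.inl h₁, h₂⟩, rfl⟩, h₃⟩
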